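/- For nonnegative integers $a,b$ let $$Q(a,b)=\{z\in\mathbb C^{a+b} : |z_1|^2+\cdots+|z_a|^2-|z_{a+1}|^2-\cdots-|z_{a+b}|^2=1\},$$ and let $U(a,b)$ be the group of automorphisms of the projective space $\mathbb P^{a+b}\supset\mathbb C^{a+b}$ that preserve the hyperquadric $Q(a,b)$ (with its points at infinity). A rational CR map $f\colon Q(2,0)\to Q(2,1)$ is a rational map $f$ from $\mathbb C^2$ to $\mathbb C^3$ such that $f(p)\in Q(2,1)$ for all $p\in Q(2,0)$ at which $f$ is defined; its degree is the maximum of the degrees of the numerators and of the denominator when $f$ is written in lowest terms over a common denominator. Two such maps $f,g$ are Q-equivalent if $f\circ\chi=\tau\circ g$, as rational maps into $\mathbb P^3$, for some $\chi\in U(2,0)$ and $\tau\in U(2,1)$. Let $f\colon Q(2,0)\to Q(2,1)$ be a rational CR map of degree two that is not Q-equivalent to a map of the form $(z,w)\mapsto(1,g(z,w),g(z,w))$ with $g$ a rational function. Then $f$ is Q-equivalent to exactly one of the following four maps: (i) $(z,w)\mapsto(z^2,\sqrt2\,w,w^2)$, (ii) $(z,w)\mapsto\left(\frac1z,\frac{w^2}{z^2},\frac{w}{z^2}\right)$,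 (iii) $(z,w)\mapsto\left(\frac{z^2+\sqrt3\,zw+w^2-z}{w^2+z+\sqrt3\,w-1},\ \frac{w^2+z-\sqrt3\,w-1}{w^2+z+\sqrt3\,w-1},\ \frac{z^2-\sqrt3\,zw+w^2-z}{w^2+z+\sqrt3\,w-1}\right)$, (iv) $(z,w)\mapsto\left(\frac{\sqrt[4]{2}\,(zw-iz)}{w^2+\sqrt2\,iw+1},\ \frac{w^2-\sqrt2\,iw+1}{w^2+\sqrt2\,iw+1},\ \frac{\sqrt[4]{2}\,(zw+iz)}{w^2+\sqrt2\,iw+1}\right)$. -/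

import Mathlib

/-- The hyperquadric `Q(a,b) ⊆ ℂ^(a+b)`:
`|z_1|² + ⋯ + |z_a|² - |z_{a+1}|² - ⋯ - |z_{a+b}|² = 1`. -/
def hyperquadric (a b : ℕ) : Set (Fin (a + b) → ℂ) :=
  {z | ∑ i : Fin (a + b), (if (i : ℕ) < a then (1 : ℝ) else -1) * ‖z i‖ ^ 2 = 1}

/-- The Hermitian form in homogeneous coordinates `ζ ∈ ℂ^(a+b+1)` that defines (the closure in
projective space of) `Q(a,b)`: there are `a` plus signs followed by `b + 1` minus signs, and the
last coordinate is the homogenizing one. -/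
noncomputable def hqForm (a b : ℕ) (ζ : Fin (a + b + 1) → ℂ) : ℝ :=
  ∑ i : Fin (a + b + 1), (if (i : ℕ) < a then (1 : ℝ) else -1) * ‖ζ i‖ ^ 2

/-- The matrices in homogeneous coordinates that represent the elements of `U(a,b)`, the
automorphisms of the projective space of dimension `a + b` that preserve the hyperquadric
`Q(a,b)` (including its points at infinity). -/
def IsHQAut (a b : ℕ) (X : Matrix (Fin (a + b + 1)) (Fin (a + b + 1)) ℂ) : Prop :=
  IsUnit X ∧ ∀ ζ : Fin (a + b + 1) → ℂ, hqForm a b (X.mulVec ζ) = 0 ↔ hqForm a b ζ = 0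

/-- The homogeneous coordinates `(v, 1)` of a point `v` of affine space. -/
def affLift {n : ℕ} (v : Fin n → ℂ) : Fin (n + 1) → ℂ :=
  Fin.snoc (α := fun _ => ℂ) v 1

/-- The linear fractional map of `ℂ^n` induced by a matrix acting on homogeneous coordinates
(meaningful where the last entry of `X (z, 1)` is nonzero). -/
noncomputable def linFrac {n : ℕ} (X : Matrix (Fin (n + 1)) (Fin (n + 1)) ℂ) (z : Fin n → ℂ) :
    Fin n → ℂ :=
  fun i => X.mulVec (affLift z) i.castSucc / X.mulVec (affLift z) (Fin.last n)

/-- A rational map from `ℂ^n` to `ℂ^N`, written as a polynomial numerator with `N` components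
over a common nonzero polynomial denominator. -/
structure RatMap (n N : ℕ) where
  num : Fin N → MvPolynomial (Fin n) ℂ
  den : MvPolynomial (Fin n) ℂ
  den_ne_zero : den ≠ 0

namespace RatMap

variable {n N : ℕ}

/-- The set of points where the denominator does not vanish. -/
def dom (f : RatMap n N) : Set (Fin n → ℂ) :=
  {z | MvPolynomial.eval z f.den ≠ 0}

/-- The value of a rational map at a point of its domain. -/
noncomputable def eval (f : RatMap n N) (z : Fin n → ℂ) : Fin N → ℂ :=
  fun i => MvPolynomial.eval z (f.num i) / MvPolynomial.eval z f.den

/-- The components of the numerator and the denominator have no nontrivial common factor. -/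
def InLowestTerms (f : RatMap n N) : Prop :=
  ∀ h : MvPolynomial (Fin n) ℂ, (∀ i, h ∣ f.num i) → h ∣ f.den → IsUnit h

/-- The maximum of the degrees of the numerator and of the denominator; this is the degree of the
rational map when it is written in lowest terms. -/
def degree (f : RatMap n N) : ℕ :=
  max (Finset.univ.sup fun i => (f.num i).totalDegree) f.den.totalDegree

/-- `f` takes `Q(a,b)` to `Q(c,d)` wherever it is defined. As `f` is holomorphic on its domain,
its restriction to `Q(a,b)` is then a CR map to `Q(c,d)`. -/
def IsCRMap (a b c d : ℕ) (f : RatMap (a + b) (c + d)) : Prop :=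
  ∀ z ∈ hyperquadric a b, z ∈ f.dom → f.eval z ∈ hyperquadric c d

/-- Q-equivalence: `f ∘ χ = τ ∘ g` with `χ ∈ U(a,b)` and `τ ∈ U(c,d)`, as maps into projective
space. The two sides are compared at every `z` at which `χ z`, `f (χ z)` and `g z` are defined, a
nonempty Zariski open set; there, the homogeneous coordinates of `f (χ z)` and those of `τ (g z)`
have to be proportional. -/
def QEquiv (a b c d : ℕ) (f g : RatMap (a + b) (c + d)) : Prop :=
  ∃ (X : Matrix (Fin (a + b + 1)) (Fin (a + b + 1)) ℂ)
    (T : Matrix (Fin (c + d + 1)) (Fin (c + d + 1)) ℂ),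
    IsHQAut a b X ∧ IsHQAut c d T ∧
    ∀ z : Fin (a + b) → ℂ, X.mulVec (affLift z) (Fin.last (a + b)) ≠ 0 →
      linFrac X z ∈ f.dom → z ∈ g.dom →
      ∃ r : ℂ, r ≠ 0 ∧ T.mulVec (affLift (g.eval z)) = r • affLift (f.eval (linFrac X z))

/-- The map `(1, p/q, p/q)`. -/
def oneGG (p q : MvPolynomial (Fin 2) ℂ) (hq : q ≠ 0) : RatMap 2 3 where
  num := ![q, p, p]
  den := q
  den_ne_zero := hq

open MvPolynomial in
/-- `(z, w) ↦ (z², √2 w, w²)`. -/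
noncomputable def map1 : RatMap 2 3 where
  num := ![X 0 ^ 2, C ((Real.sqrt 2 : ℝ) : ℂ) * X 1, X 1 ^ 2]
  den := 1
  den_ne_zero := one_ne_zero

open MvPolynomial in
/-- `(z, w) ↦ (1 / z, w² / z², w / z²)`, over the common denominator `z²`. -/
noncomputable def map2 : RatMap 2 3 where
  num := ![X 0, X 1 ^ 2, X 1]
  den := X 0 ^ 2
  den_ne_zero := pow_ne_zero 2 (X_ne_zero 0)

open MvPolynomial in
/-- `(z, w) ↦ (z² + √3 z w + w² - z, w² + z - √3 w - 1, z² - √3 z w + w² - z)`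
divided by `w² + z + √3 w - 1`. -/
noncomputable def map3 : RatMap 2 3 where
  num := ![X 0 ^ 2 + C ((Real.sqrt 3 : ℝ) : ℂ) * X 0 * X 1 + X 1 ^ 2 - X 0,
    X 1 ^ 2 + X 0 - C ((Real.sqrt 3 : ℝ) : ℂ) * X 1 - 1,
    X 0 ^ 2 - C ((Real.sqrt 3 : ℝ) : ℂ) * X 0 * X 1 + X 1 ^ 2 - X 0]
  den := X 1 ^ 2 + X 0 + C ((Real.sqrt 3 : ℝ) : ℂ) * X 1 - 1
  den_ne_zero h := by
    have := congrArg (MvPolynomial.eval (0 : Fin 2 → ℂ)) h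
    simp at this

open MvPolynomial in
/-- `(z, w) ↦ (2^(1/4) (z w - i z), w² - √2 i w + 1, 2^(1/4) (z w + i z))`
divided by `w² + √2 i w + 1`. -/
noncomputable def map4 : RatMap 2 3 where
  num := ![C (((2 : ℝ) ^ (1 / 4 : ℝ) : ℝ) : ℂ) * (X 0 * X 1 - C Complex.I * X 0),
    X 1 ^ 2 - C ((Real.sqrt 2 : ℝ) : ℂ) * C Complex.I * X 1 + 1,
    C (((2 : ℝ) ^ (1 / 4 : ℝ) : ℝ) : ℂ) * (X 0 * X 1 + C Complex.I * X 0)]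
  den := X 1 ^ 2 + C ((Real.sqrt 2 : ℝ) : ℂ) * C Complex.I * X 1 + 1
  den_ne_zero h := by
    have := congrArg (MvPolynomial.eval (0 : Fin 2 → ℂ)) h
    simp at this

/-- The list of the four normal forms. -/
noncomputable def normalForm : Fin 4 → RatMap 2 3 :=
  ![map1, map2, map3, map4]

end RatMap

namespace HQ

open Complex ComplexConjugate
set_option linter.unusedSimpArgs false

/-- Forms on `ℂ^n` that are linear in the first and conjugate linear in the second variable. -/
abbrev SesqForm (n : ℕ) := (Fin n → ℂ) →ₗ[ℂ] (Fin n → ℂ) →ₗ⋆[ℂ] ℂ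

/-- Hermitian symmetry. -/
def SesqForm.IsHerm {n : ℕ} (H : SesqForm n) : Prop := ∀ x y, conj (H x y) = H y x

/-- The diagonal sesquilinear form with real coefficients `ε`. -/
noncomputable def diagForm {n : ℕ} (ε : Fin n → ℝ) : SesqForm n :=
  LinearMap.mk₂'ₛₗ _ _ (fun x y => ∑ i, (ε i : ℂ) * x i * conj (y i))
    (by intros; simp [mul_add, add_mul, Finset.sum_add_distrib])
    (by intros; simp only [Pi.smul_apply, smul_eq_mul, Finset.mul_sum, RingHom.id_apply]
        exact Finset.sum_congr rfl fun _ _ => by ring)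
    (by intros; simp [mul_add, Finset.sum_add_distrib])
    (by intros; simp only [Pi.smul_apply, smul_eq_mul, Finset.mul_sum, map_mul]
        exact Finset.sum_congr rfl fun _ _ => by ring)

theorem diagForm_apply {n : ℕ} (ε : Fin n → ℝ) (x y : Fin n → ℂ) :
    diagForm ε x y = ∑ i, (ε i : ℂ) * x i * conj (y i) := rfl

theorem diagForm_isHerm {n : ℕ} (ε : Fin n → ℝ) : (diagForm ε).IsHerm := fun x y => by
  simp only [diagForm_apply, map_sum, map_mul, conj_ofReal, conj_conj]
  exact Finset.sum_congr rfl fun _ _ => by ring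

theorem diagForm_single {n : ℕ} (ε : Fin n → ℝ) (i j : Fin n) :
    diagForm ε (Pi.single i 1) (Pi.single j 1) = if i = j then (ε i : ℂ) else 0 := by
  rw [diagForm_apply, Finset.sum_eq_single i]
  · by_cases h : i = j
    · subst h; simp
    · simp [h]
  · intro k _ hk; simp [hk]
  · simp

theorem SesqForm.IsHerm.self_im {n : ℕ} {H : SesqForm n} (h : H.IsHerm) (x : Fin n → ℂ) :
    ((H x x).re : ℂ) = H x x := conj_eq_iff_re.1 (h x x)

/-- Two sesquilinear forms agree if they agree on the standard basis. -/
theorem sesq_ext {n : ℕ} {B B' : SesqForm n}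
    (h : ∀ i j, B (Pi.single i 1) (Pi.single j 1) = B' (Pi.single i 1) (Pi.single j 1)) :
    B = B' :=
  LinearMap.ext_basis (Pi.basisFun ℂ (Fin n)) (Pi.basisFun ℂ (Fin n)) (by simpa using h)

/-- If `a + b ω + c / ω` vanishes for three unimodular values of `ω`, all coefficients vanish. -/
theorem laurent_eq_zero {a b c : ℂ} (h : ∀ ω : ℂ, ω * conj ω = 1 → a + ω * b + conj ω * c = 0) :
    a = 0 ∧ b = 0 ∧ c = 0 := by
  have h1 := h 1 (by simp)
  have h2 := h (-1) (by simp)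
  have h3 := h I (by simp)
  simp only [map_one, map_neg, conj_I] at h1 h2 h3
  have ha : a = 0 := by linear_combination (h1 + h2) / 2
  subst ha
  have hI : I * I = -1 := I_mul_I
  have hc : c = 0 := by
    linear_combination (h1) / 2 + I * h3 / 2 - (b / 2) * hI + (c/2) * hI
  subst hc
  exact ⟨rfl, by linear_combination h1, rfl⟩

theorem herm_prop_of_null {n : ℕ} {ε : Fin n → ℝ} (hε : ∀ i, ε i = 1 ∨ ε i = -1)
    {i₀ j₀ : Fin n} (hi₀ : ε i₀ = 1) (hj₀ : ε j₀ = -1) {H : SesqForm n} (hH : H.IsHerm)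
    (h : ∀ x, diagForm ε x x = 0 → H x x = 0) :
    ∃ c : ℝ, H = (c : ℂ) • diagForm ε := by
  classical
  set e : Fin n → Fin n → ℂ := fun i => Pi.single i 1 with he
  have hD : ∀ i j, diagForm ε (e i) (e j) = if i = j then (ε i : ℂ) else 0 := diagForm_single ε
  have opp : ∀ i j, ε i = - ε j → H (e i) (e i) + H (e j) (e j) = 0 ∧ H (e j) (e i) = 0 ∧
      H (e i) (e j) = 0 := by
    intro i j hij
    have hne : i ≠ j := by
      rintro rfl
      rcases hε i with h | h <;> rw [h] at hij <;> norm_num at hij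
    apply laurent_eq_zero
    intro ω hω
    have := h (e i + ω • e j) (by
      simp [hD, hne, hne.symm, hij]
      linear_combination (ε j : ℂ) * hω)
    simp only [map_add, map_smul, LinearMap.add_apply, LinearMap.smul_apply,
      LinearMap.map_smulₛₗ, smul_eq_mul] at this
    linear_combination this - H (e j) (e j) * hω
  have same : ∀ i i' j, i ≠ i' → ε i = - ε j → ε i' = - ε j → H (e i) (e i') = 0 := by
    intro i i' j hne hij hij'
    obtain ⟨h1, h2, h3⟩ := opp i j hij
    obtain ⟨h1', h2', h3'⟩ := opp i' j hij'
    have hij0 : i ≠ j := by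
      rintro rfl
      rcases hε i with h | h <;> rw [h] at hij <;> norm_num at hij
    have hij0' : i' ≠ j := by
      rintro rfl
      rcases hε i' with h | h <;> rw [h] at hij' <;> norm_num at hij'
    obtain ⟨s, hs, hsc⟩ : ∃ s : ℂ, s * s = 2 ∧ conj s = s := ⟨((Real.sqrt 2 : ℝ) : ℂ), by
      rw [← ofReal_mul, Real.mul_self_sqrt (by norm_num)]; simp, conj_ofReal _⟩
    refine (laurent_eq_zero (a := 0) (b := H (e i') (e i)) (c := H (e i) (e i')) ?_).2.2
    intro ω hω
    have := h (e i + ω • e i' + s • e j) (by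
      simp [hD, hne, hne.symm, hij0.symm, hij0'.symm, hij, hij', hsc, hij0, hij0']
      linear_combination (-ε j : ℂ) * hω + (ε j : ℂ) * hs)
    simp only [map_add, map_smul, LinearMap.add_apply, LinearMap.smul_apply,
      LinearMap.map_smulₛₗ, smul_eq_mul, h2, h3, h2', h3', hsc] at this
    linear_combination this - H (e i') (e i') * hω - H (e j) (e j) * hs - h1 - h1'
  have hne0 : ∀ i, ∃ j, ε i = - ε j := fun i => by
    rcases hε i with h | h
    · exact ⟨j₀, by rw [h, hj₀]; norm_num⟩
    · exact ⟨i₀, by rw [h, hi₀]⟩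
  refine ⟨(H (e i₀) (e i₀)).re, sesq_ext fun i j => ?_⟩
  rw [hH.self_im]
  change H (e i) (e j) = H (e i₀) (e i₀) * diagForm ε (e i) (e j)
  rw [hD]
  by_cases hij : i = j
  · subst hij
    rw [if_pos rfl]
    rcases hε i with h | h
    · have a := (opp i j₀ (by rw [h, hj₀]; norm_num)).1
      have b := (opp i₀ j₀ (by rw [hi₀, hj₀]; norm_num)).1
      rw [h]; push_cast; linear_combination a - b
    · have a := (opp i i₀ (by rw [h, hi₀])).1
      rw [h]; push_cast; linear_combination a
  · rw [if_neg hij, mul_zero]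
    by_cases hs : ε i = ε j
    · obtain ⟨k, hk⟩ := hne0 i
      exact same i j k hij hk (hs ▸ hk)
    · refine (opp i j ?_).2.2
      rcases hε i with h | h <;> rcases hε j with h' | h' <;> rw [h, h'] at hs ⊢ <;>
        first | exact absurd rfl hs | norm_num

/-- The signs of the form defining `Q(a,b)`. -/
noncomputable def sgn (a n : ℕ) : Fin n → ℝ := fun i => if (i : ℕ) < a then 1 else -1

theorem sgn_cases (a n : ℕ) (i : Fin n) : sgn a n i = 1 ∨ sgn a n i = -1 := by
  unfold sgn; split_ifs <;> simp

theorem hqForm_eq (a b : ℕ) (ζ : Fin (a + b + 1) → ℂ) :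
    (hqForm a b ζ : ℂ) = diagForm (sgn a (a + b + 1)) ζ ζ := by
  simp only [hqForm, diagForm_apply, sgn, ofReal_sum, ofReal_mul, mul_assoc, mul_conj']
  push_cast
  rfl

theorem diagForm_mulVec_comp {n : ℕ} (ε : Fin n → ℝ) (X : Matrix (Fin n) (Fin n) ℂ) :
    ∃ H : SesqForm n, H.IsHerm ∧ ∀ x y, H x y = diagForm ε (X.mulVec x) (X.mulVec y) :=
  ⟨((diagForm ε).comp X.mulVecLin).compl₂ X.mulVecLin, fun _ _ => diagForm_isHerm ε _ _,
    fun _ _ => rfl⟩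

/-- `X` multiplies the form by a nonzero real constant. -/
def Scales {n : ℕ} (ε : Fin n → ℝ) (X : Matrix (Fin n) (Fin n) ℂ) (c : ℝ) : Prop :=
  c ≠ 0 ∧ ∀ x y, diagForm ε (X.mulVec x) (X.mulVec y) = c * diagForm ε x y

theorem Scales.isUnit {n : ℕ} {ε : Fin n → ℝ} (hε : ∀ i, ε i = 1 ∨ ε i = -1)
    {X : Matrix (Fin n) (Fin n) ℂ} {c : ℝ} (h : Scales ε X c) : IsUnit X := by
  rw [← Matrix.mulVec_injective_iff_isUnit]
  refine (injective_iff_map_eq_zero X.mulVecLin).2 ?_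
  intro x hx
  funext i
  have := h.2 x (Pi.single i 1)
  rw [show X.mulVec x = 0 from hx, map_zero, LinearMap.zero_apply, diagForm_apply,
    Finset.sum_eq_single i] at this
  · have hi : (ε i : ℂ) ≠ 0 := by rcases hε i with h | h <;> rw [h] <;> norm_num
    have hc : (c : ℂ) ≠ 0 := by exact_mod_cast h.1
    simpa [hi, hc] using this
  · intro k _ hk; simp [hk]
  · simp

theorem Scales.isHQAut {a b : ℕ} {X : Matrix (Fin (a + b + 1)) (Fin (a + b + 1)) ℂ} {c : ℝ}
    (h : Scales (sgn a (a + b + 1)) X c) : IsHQAut a b X := by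
  refine ⟨h.isUnit (sgn_cases _ _), fun ζ => ?_⟩
  rw [← ofReal_eq_zero, hqForm_eq, h.2, ← hqForm_eq]
  simp [h.1]

theorem _root_.IsHQAut.exists_scales {a b : ℕ} (ha : 0 < a)
    {X : Matrix (Fin (a + b + 1)) (Fin (a + b + 1)) ℂ} (h : IsHQAut a b X) :
    ∃ c : ℝ, Scales (sgn a (a + b + 1)) X c := by
  obtain ⟨H, hH, hHX⟩ := diagForm_mulVec_comp (sgn a (a + b + 1)) X
  have h0 : sgn a (a + b + 1) 0 = 1 := by simp [sgn, ha]
  obtain ⟨c, hc⟩ := herm_prop_of_null (sgn_cases a (a + b + 1)) (i₀ := 0) (j₀ := Fin.last _)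
    h0 (by simp [sgn]) hH (fun x hx => by
      rw [hHX, ← hqForm_eq, ofReal_eq_zero, h.2, ← ofReal_eq_zero, hqForm_eq, hx])
  have key : ∀ x y, diagForm (sgn a (a + b + 1)) (X.mulVec x) (X.mulVec y) =
      c * diagForm (sgn a (a + b + 1)) x y := fun x y => by
    rw [← hHX, hc]; rfl
  refine ⟨c, ?_, key⟩
  rintro rfl
  obtain ⟨u, hu⟩ := (Matrix.mulVec_surjective_iff_isUnit.2 h.1) (Pi.single 0 1)
  have := key u u
  rw [hu, diagForm_single, if_pos rfl, h0] at this
  simp at this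

/-- Functions on `ℂ^n` given by a polynomial. -/
def IsPolyFun {n : ℕ} (φ : (Fin n → ℂ) → ℂ) : Prop :=
  ∃ p : MvPolynomial (Fin n) ℂ, ∀ x, MvPolynomial.eval x p = φ x

namespace IsPolyFun

variable {n : ℕ} {φ ψ : (Fin n → ℂ) → ℂ}

theorem const (c : ℂ) : IsPolyFun (fun _ : Fin n → ℂ => c) := ⟨MvPolynomial.C c, by simp⟩

theorem coord (i : Fin n) : IsPolyFun (fun x : Fin n → ℂ => x i) := ⟨MvPolynomial.X i, by simp⟩

theorem add (hφ : IsPolyFun φ) (hψ : IsPolyFun ψ) : IsPolyFun (fun x => φ x + ψ x) := by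
  obtain ⟨p, hp⟩ := hφ
  obtain ⟨q, hq⟩ := hψ
  exact ⟨p + q, by simp [hp, hq]⟩

theorem mul (hφ : IsPolyFun φ) (hψ : IsPolyFun ψ) : IsPolyFun (fun x => φ x * ψ x) := by
  obtain ⟨p, hp⟩ := hφ
  obtain ⟨q, hq⟩ := hψ
  exact ⟨p * q, by simp [hp, hq]⟩

theorem sub (hφ : IsPolyFun φ) (hψ : IsPolyFun ψ) : IsPolyFun (fun x => φ x - ψ x) := by
  obtain ⟨p, hp⟩ := hφ
  obtain ⟨q, hq⟩ := hψ
  exact ⟨p - q, by simp [hp, hq]⟩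

theorem sum {ι : Type*} (s : Finset ι) {Φ : ι → (Fin n → ℂ) → ℂ} (h : ∀ i, IsPolyFun (Φ i)) :
    IsPolyFun (fun x => ∑ i ∈ s, Φ i x) := by
  choose p hp using h
  exact ⟨∑ i ∈ s, p i, by simp [hp]⟩

theorem eq_zero_or (hφ : IsPolyFun φ) (hψ : IsPolyFun ψ) (h : ∀ x, φ x * ψ x = 0) :
    (∀ x, φ x = 0) ∨ ∀ x, ψ x = 0 := by
  obtain ⟨p, hp⟩ := hφ
  obtain ⟨q, hq⟩ := hψ
  have : p * q = 0 := MvPolynomial.funext fun x => by simp [hp, hq, h]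
  rcases mul_eq_zero.1 this with h | h
  · left; intro x; rw [← hp, h, map_zero]
  · right; intro x; rw [← hq, h, map_zero]

theorem eq_zero_of_real (hφ : IsPolyFun φ) (h : ∀ x : Fin n → ℝ, φ (fun i => (x i : ℂ)) = 0) :
    ∀ x, φ x = 0 := by
  obtain ⟨p, hp⟩ := hφ
  have : p = 0 := by
    refine MvPolynomial.funext_set (fun _ => Set.range ((↑) : ℝ → ℂ))
      (fun _ => Set.infinite_range_of_injective ofReal_injective) fun x hx => ?_
    choose y hy using fun i => hx i (Set.mem_univ i)
    have : x = fun i => (y i : ℂ) := funext fun i => (hy i).symm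
    rw [map_zero, hp, this, h]
  intro x; rw [← hp, this, map_zero]

end IsPolyFun

/-- Bilinear maps `ℂ³ × ℂ³ → ℂ⁴`. -/
abbrev Bil := (Fin 3 → ℂ) →ₗ[ℂ] (Fin 3 → ℂ) →ₗ[ℂ] (Fin 4 → ℂ)

/-- The form of signature `(2,1)` on `ℂ³`. -/
noncomputable abbrev J : SesqForm 3 := diagForm (sgn 2 3)

/-- The form of signature `(2,2)` on `ℂ⁴`. -/
noncomputable abbrev K : SesqForm 4 := diagForm (sgn 2 4)

theorem J_apply (x y : Fin 3 → ℂ) :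
    J x y = x 0 * conj (y 0) + x 1 * conj (y 1) - x 2 * conj (y 2) := by
  simp [diagForm_apply, Fin.sum_univ_three, sgn]; ring

theorem K_apply (x y : Fin 4 → ℂ) :
    K x y = x 0 * conj (y 0) + x 1 * conj (y 1) - x 2 * conj (y 2) - x 3 * conj (y 3) := by
  simp [diagForm_apply, Fin.sum_univ_four, sgn]; ring

theorem bil_expand (F : Bil) (Z W : Fin 3 → ℂ) (i : Fin 4) :
    F Z W i = ∑ j, ∑ k, Z j * W k * F (Pi.single j 1) (Pi.single k 1) i := by
  conv_lhs => rw [LinearMap.pi_apply_eq_sum_univ F Z]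
  simp only [LinearMap.sum_apply, LinearMap.smul_apply, Finset.sum_apply, Pi.smul_apply,
    smul_eq_mul]
  refine Finset.sum_congr rfl fun j _ => ?_
  rw [LinearMap.pi_apply_eq_sum_univ (F _) W]
  simp only [Finset.sum_apply, Pi.smul_apply, smul_eq_mul, Finset.mul_sum, mul_assoc]
  refine Finset.sum_congr rfl fun k _ => ?_
  have hs : ∀ j : Fin 3, (fun l => if j = l then (1 : ℂ) else 0) = Pi.single j 1 := fun j => by
    funext l; simp [Pi.single_apply, eq_comm]
  rw [hs, hs]

theorem IsPolyFun.bil {n : ℕ} (F : Bil) {Z W : (Fin n → ℂ) → Fin 3 → ℂ}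
    (hZ : ∀ i, IsPolyFun (fun x => Z x i)) (hW : ∀ i, IsPolyFun (fun x => W x i)) (i : Fin 4) :
    IsPolyFun (fun x => F (Z x) (W x) i) := by
  simp_rw [fun x => bil_expand F (Z x) (W x) i]
  exact .sum _ fun j => .sum _ fun k => ((hZ j).mul (hW k)).mul (.const _)

/-- The coordinatewise conjugate. -/
def cj {n : ℕ} (x : Fin n → ℂ) : Fin n → ℂ := fun i => conj (x i)

theorem IsPolyFun.conj_bil {n : ℕ} (F : Bil) {Z W : (Fin n → ℂ) → Fin 3 → ℂ}
    (hZ : ∀ i, IsPolyFun (fun x => Z x i)) (hW : ∀ i, IsPolyFun (fun x => W x i)) (i : Fin 4) :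
    IsPolyFun (fun x => conj (F (cj (Z x)) (cj (W x)) i)) := by
  simp_rw [fun x => bil_expand F (cj (Z x)) (cj (W x)) i, map_sum, map_mul, cj, conj_conj]
  exact .sum _ fun j => .sum _ fun k => ((hZ j).mul (hW k)).mul (.const _)

theorem IsPolyFun.K_bil {n : ℕ} (F : Bil) {Z W : (Fin n → ℂ) → Fin 3 → ℂ}
    (hZ : ∀ i, IsPolyFun (fun x => Z x i)) (hW : ∀ i, IsPolyFun (fun x => W x i)) :
    IsPolyFun (fun x => K (F (Z x) (Z x)) (F (cj (W x)) (cj (W x)))) := by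
  simp only [diagForm_apply]
  exact .sum _ fun i => ((IsPolyFun.const _).mul (.bil F hZ hZ i)).mul (.conj_bil F hW hW i)

/-- `F` is the homogenization of `f`: a symmetric bilinear map whose quadratic map restricts to
(numerators, denominator) on the affine chart. -/
structure Lift (f : RatMap 2 3) (F : Bil) : Prop where
  symm : ∀ Z W, F Z W = F W Z
  val : ∀ z : Fin 2 → ℂ, F (affLift z) (affLift z) =
    Fin.snoc (α := fun _ => ℂ) (fun i => MvPolynomial.eval z (f.num i)) (MvPolynomial.eval z f.den)

theorem affLift_two (z : Fin 2 → ℂ) : affLift z = ![z 0, z 1, 1] := by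
  funext i; fin_cases i <;> rfl

namespace Lift

variable {f : RatMap 2 3} {F : Bil}

theorem val_last (h : Lift f F) (z : Fin 2 → ℂ) :
    F (affLift z) (affLift z) 3 = MvPolynomial.eval z f.den := by
  rw [h.val]; rfl

theorem val_eq (h : Lift f F) {z : Fin 2 → ℂ} (hz : z ∈ f.dom) :
    F (affLift z) (affLift z) = MvPolynomial.eval z f.den • affLift (f.eval z) := by
  have hz' : MvPolynomial.eval z f.den ≠ 0 := hz
  rw [h.val]
  funext i
  refine Fin.lastCases ?_ (fun i => ?_) i
  · rw [Fin.snoc_last, Pi.smul_apply, affLift, Fin.snoc_last, smul_eq_mul, mul_one]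
  · simp [affLift, RatMap.eval, mul_div_cancel₀, hz']

theorem exists_ne (h : Lift f F) : ∃ z, F (affLift z) (affLift z) 3 ≠ 0 := by
  by_contra! hc
  exact f.den_ne_zero (MvPolynomial.funext fun z => by rw [← h.val_last, hc, map_zero])

end Lift

/-- Homogeneous coordinates with nonvanishing last entry. -/
theorem eq_smul_affLift {Z : Fin 3 → ℂ} (hZ : Z 2 ≠ 0) :
    Z = Z 2 • affLift (n := 2) ![Z 0 / Z 2, Z 1 / Z 2] := by
  rw [affLift_two]
  funext i
  fin_cases i <;> simp [mul_div_cancel₀, hZ]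

theorem mem_hyperquadric_iff {a b : ℕ} (z : Fin (a + b) → ℂ) :
    z ∈ hyperquadric a b ↔ diagForm (sgn a (a + b + 1)) (affLift z) (affLift z) = 0 := by
  rw [← hqForm_eq, ofReal_eq_zero, hqForm, Fin.sum_univ_castSucc]
  simp only [hyperquadric, Set.mem_ofPred_eq, affLift, Fin.snoc_castSucc, Fin.snoc_last,
    Fin.val_castSucc, Fin.val_last]
  rw [if_neg (by omega)]
  simp only [norm_one]
  constructor <;> intro h <;> linarith

theorem K_null_of_CR {f : RatMap 2 3} {F : Bil} (h : Lift f F) (hCR : RatMap.IsCRMap 2 0 2 1 f)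
    {Z : Fin 3 → ℂ} (hZ : J Z Z = 0) (hden : F Z Z 3 ≠ 0) : K (F Z Z) (F Z Z) = 0 := by
  have h2 : Z 2 ≠ 0 := by
    intro h2
    apply hden
    rw [J_apply, h2, mul_conj', mul_conj'] at hZ
    have h3 : ‖Z 0‖ ^ 2 + ‖Z 1‖ ^ 2 = 0 := by
      have : ((‖Z 0‖ ^ 2 + ‖Z 1‖ ^ 2 : ℝ) : ℂ) = 0 := by push_cast; simpa using hZ
      exact_mod_cast this
    have h0 : Z 0 = 0 := by
      have : ‖Z 0‖ ^ 2 = 0 := by nlinarith [sq_nonneg ‖Z 0‖, sq_nonneg ‖Z 1‖]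
      simpa using this
    have h1 : Z 1 = 0 := by
      have : ‖Z 1‖ ^ 2 = 0 := by nlinarith [sq_nonneg ‖Z 0‖, sq_nonneg ‖Z 1‖]
      simpa using this
    have : Z = 0 := by funext i; fin_cases i <;> simp [h0, h1, h2]
    simp [this]
  obtain ⟨z, hz⟩ : ∃ z : Fin 2 → ℂ, Z = Z 2 • affLift z := ⟨_, eq_smul_affLift h2⟩
  have hc : conj (Z 2) ≠ 0 := by simpa using h2
  rw [hz] at hZ hden ⊢
  simp only [map_smul, LinearMap.smul_apply, LinearMap.map_smulₛₗ, smul_eq_mul, mul_eq_zero, h2,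
    hc, false_or, Pi.smul_apply] at hZ hden ⊢
  have hdom : z ∈ f.dom := by
    rw [h.val_last] at hden
    exact fun h0 => hden (by simp [h0])
  have := (mem_hyperquadric_iff (a := 2) (b := 1) _).1
    (hCR z ((mem_hyperquadric_iff (a := 2) (b := 0) z).2 hZ) hdom)
  rw [h.val_eq hdom]
  have this' : K (affLift (f.eval z)) (affLift (f.eval z)) = 0 := this
  simp [this']

/-- A quadratic map that vanishes off a plane is zero. -/
theorem bil_eq_zero_of_off_plane {M : Type*} [AddCommGroup M] [Module ℂ M]
    {h : (Fin 3 → ℂ) →ₗ[ℂ] (Fin 3 → ℂ) →ₗ[ℂ] M}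
    (hs : ∀ Z W, h Z W = h W Z) (l : (Fin 3 → ℂ) →ₗ[ℂ] ℂ) {u : Fin 3 → ℂ} (hu : l u ≠ 0)
    (h0 : ∀ Z, l Z ≠ 0 → h Z Z = 0) (Z : Fin 3 → ℂ) : h Z Z = 0 := by
  by_cases hZ : l Z = 0
  · have h1 := h0 (Z + u) (by simpa [hZ])
    have h2 := h0 (Z - u) (by simpa [hZ])
    have h3 := h0 u hu
    simp only [map_add, map_sub, LinearMap.add_apply, LinearMap.sub_apply, h3, hs u Z] at h1 h2
    have : (2 : ℂ) • h Z Z = 0 := by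
      rw [two_smul]
      have := congrArg₂ (· + ·) h1 h2
      simp only [add_zero] at this
      rw [← this]; abel
    simpa using this
  · exact h0 Z hZ

theorem cj_cj {n : ℕ} (x : Fin n → ℂ) : cj (cj x) = x := funext fun i => conj_conj (x i)

theorem cj_smul {n : ℕ} (c : ℂ) (x : Fin n → ℂ) : cj (c • x) = conj c • cj x := by
  funext i; simp [cj]

/-- A rational parametrization, over the reals, of the null cone of `J`. -/
noncomputable def heis (ι : ℂ) (v : Fin 3 → ℂ) : Fin 3 → ℂ :=
  ![-(v 0 ^ 2 + v 1 ^ 2) / 2 + ι * v 2 + 1 / 2, v 0 + ι * v 1,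
    -(v 0 ^ 2 + v 1 ^ 2) / 2 + ι * v 2 - 1 / 2]

theorem isPolyFun_heis (ι : ℂ) (i : Fin 3) : IsPolyFun (fun v => heis ι v i) := by
  fin_cases i
  · exact ⟨MvPolynomial.C (-1 / 2) * (MvPolynomial.X 0 ^ 2 + MvPolynomial.X 1 ^ 2) +
      MvPolynomial.C ι * MvPolynomial.X 2 + MvPolynomial.C (1 / 2), fun x => by
        simp [heis]; ring⟩
  · exact ⟨MvPolynomial.X 0 + MvPolynomial.C ι * MvPolynomial.X 1, fun x => by simp [heis]⟩
  · exact ⟨MvPolynomial.C (-1 / 2) * (MvPolynomial.X 0 ^ 2 + MvPolynomial.X 1 ^ 2) +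
      MvPolynomial.C ι * MvPolynomial.X 2 - MvPolynomial.C (1 / 2), fun x => by
        simp [heis]; ring⟩

theorem K_bil_smul (F : Bil) (a b : ℂ) (Z W : Fin 3 → ℂ) :
    K (F (a • Z) (a • Z)) (F (b • W) (b • W)) = a ^ 2 * conj b ^ 2 * K (F Z Z) (F W W) := by
  simp only [map_smul, LinearMap.smul_apply, LinearMap.map_smulₛₗ, smul_eq_mul]
  ring

section

variable {f : RatMap 2 3} {F : Bil}

theorem Lift.comp_three_ne (h : Lift f F) : ∃ v, F (heis I v) (heis I v) 3 ≠ 0 := by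
  by_contra! hc
  obtain ⟨z, hz⟩ := h.exists_ne
  apply hz
  set l : (Fin 3 → ℂ) →ₗ[ℂ] ℂ := LinearMap.proj (R := ℂ) (φ := fun _ : Fin 3 => ℂ) 0 - LinearMap.proj 2 with hl
  have hlZ : ∀ Z, l Z = Z 0 - Z 2 := fun Z => rfl
  refine bil_eq_zero_of_off_plane (h := F.compr₂ (LinearMap.proj (R := ℂ) (φ := fun _ : Fin 4 => ℂ) 3)) (fun Z W => ?_)
    l (u := ![1, 0, 0]) (by simp [hlZ]) (fun Z hZ => ?_) (affLift z)
  · simp [h.symm Z W]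
  · rw [hlZ] at hZ
    obtain ⟨v, hv⟩ : ∃ v, Z = (Z 0 - Z 2) • heis I v := by
      refine ⟨![Z 1 / (Z 0 - Z 2), 0, -I * ((Z 0 + Z 2) / (2 * (Z 0 - Z 2)) +
        (Z 1 / (Z 0 - Z 2)) ^ 2 / 2)], ?_⟩
      have e : ∀ a : ℂ, I * (-I * a) = a := fun a => by linear_combination (-a) * I_mul_I
      funext i
      fin_cases i <;> simp only [heis, Pi.smul_apply, smul_eq_mul, Matrix.cons_val, Fin.reduceFinMk,
        Fin.zero_eta, Fin.mk_one, e] <;> field_simp <;> ring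
    rw [hv]
    simp [hc]

theorem K_heis_eq_zero (h : Lift f F) (hCR : RatMap.IsCRMap 2 0 2 1 f) (v : Fin 3 → ℂ) :
    K (F (heis I v) (heis I v)) (F (cj (heis (-I) v)) (cj (heis (-I) v))) = 0 := by
  have p1 : IsPolyFun (fun v => F (heis I v) (heis I v) 3) :=
    .bil F (isPolyFun_heis I) (isPolyFun_heis I) 3
  have p2 := IsPolyFun.K_bil F (isPolyFun_heis I) (isPolyFun_heis (-I))
  have hprod := (p1.mul p2).eq_zero_of_real fun v => by
    have e : cj (heis (-I) fun i => (v i : ℂ)) = heis I fun i => (v i : ℂ) := by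
      funext i
      fin_cases i <;> simp [cj, heis, conj_ofNat]
    rw [e, mul_eq_zero]
    by_cases hd : F (heis I fun i => (v i : ℂ)) (heis I fun i => (v i : ℂ)) 3 = 0
    · exact .inl hd
    · refine .inr (K_null_of_CR h hCR ?_ hd)
      simp [J_apply, heis, conj_ofNat]
      linear_combination (-(v 1 : ℂ) ^ 2) * I_mul_I
  rcases p1.eq_zero_or p2 hprod with h1 | h2
  · obtain ⟨v, hv⟩ := h.comp_three_ne
    exact absurd (h1 v) hv
  · exact h2 v

theorem K_eq_zero_generic (h : Lift f F) (hCR : RatMap.IsCRMap 2 0 2 1 f) {Z W : Fin 3 → ℂ}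
    (hZ : Z 0 - Z 2 ≠ 0) (hW : W 0 - W 2 ≠ 0) (hZW : Z 0 * W 0 + Z 1 * W 1 - Z 2 * W 2 = 0) :
    K (F Z Z) (F (cj W) (cj W)) = 0 := by
  set v : Fin 3 → ℂ := ![(Z 1 / (Z 0 - Z 2) + W 1 / (W 0 - W 2)) / 2,
    -I * ((Z 1 / (Z 0 - Z 2) - W 1 / (W 0 - W 2)) / 2),
    -I * ((Z 0 + Z 2) / (2 * (Z 0 - Z 2)) +
      (Z 1 / (Z 0 - Z 2)) * (W 1 / (W 0 - W 2)) / 2)] with hv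
  have e : ∀ a : ℂ, I * (-I * a) = a := fun a => by linear_combination (-a) * I_mul_I
  have e2 : ∀ a : ℂ, -I * (-I * a) = -a := fun a => by linear_combination a * I_mul_I
  have e3 : ∀ a : ℂ, (-I * a) ^ 2 = - a ^ 2 := fun a => by linear_combination a ^ 2 * I_mul_I
  have h1 : Z = (Z 0 - Z 2) • heis I v := by
    funext i
    fin_cases i <;> simp only [hv, heis, Pi.smul_apply, smul_eq_mul, Matrix.cons_val,
      Fin.reduceFinMk, Fin.zero_eta, Fin.mk_one, e, e3] <;> field_simp <;> ring
  have h2 : W = (W 0 - W 2) • heis (-I) v := by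
    funext i
    fin_cases i <;> simp only [hv, heis, Pi.smul_apply, smul_eq_mul, Matrix.cons_val,
      Fin.reduceFinMk, Fin.zero_eta, Fin.mk_one, e2, e3] <;> field_simp
    · linear_combination 8 * (Z 0 - Z 2) * (W 0 - W 2) * hZW
    · ring
    · linear_combination 8 * (Z 0 - Z 2) * (W 0 - W 2) * hZW
  rw [h1, h2, cj_smul, K_bil_smul, K_heis_eq_zero h hCR, mul_zero]

theorem K_eq_zero_of_J (h : Lift f F) (hCR : RatMap.IsCRMap 2 0 2 1 f) {Z W : Fin 3 → ℂ}
    (hZW : J Z W = 0) : K (F Z Z) (F W W) = 0 := by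
  set Zp : (Fin 6 → ℂ) → Fin 3 → ℂ := fun x => ![x 0, x 1, x 2] with hZp
  set Wp : (Fin 6 → ℂ) → Fin 3 → ℂ := fun x => ![x 1 * x 5 + x 2 * x 4, -x 2 * x 3 - x 0 * x 5,
    x 0 * x 4 - x 1 * x 3] with hWp
  have pZ : ∀ i, IsPolyFun (fun x => Zp x i) := by
    intro i; fin_cases i
    exacts [.coord 0, .coord 1, .coord 2]
  have pW : ∀ i, IsPolyFun (fun x => Wp x i) := by
    intro i; fin_cases i
    · exact ((IsPolyFun.coord 1).mul (.coord 5)).add ((IsPolyFun.coord 2).mul (.coord 4))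
    · refine ⟨-MvPolynomial.X 2 * MvPolynomial.X 3 - MvPolynomial.X 0 * MvPolynomial.X 5, ?_⟩
      simp [hWp]
    · exact ((IsPolyFun.coord 0).mul (.coord 4)).sub ((IsPolyFun.coord 1).mul (.coord 3))
  have p1 := ((pZ 0).sub (pZ 2)).mul ((pW 0).sub (pW 2))
  have p2 := IsPolyFun.K_bil F pZ pW
  have key : ∀ x, K (F (Zp x) (Zp x)) (F (cj (Wp x)) (cj (Wp x))) = 0 := by
    refine (p1.eq_zero_or p2 fun x => ?_).resolve_left fun h => ?_
    · rw [mul_eq_zero]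
      by_contra! hc
      rw [mul_ne_zero_iff] at hc
      refine hc.2 (K_eq_zero_generic h hCR hc.1.1 hc.1.2 ?_)
      simp only [hZp, hWp, Matrix.cons_val]
      ring
    · have := h ![1, 0, 0, 0, 1, 0]
      simp [hZp, hWp] at this
  have hb : Z 0 * cj W 0 + Z 1 * cj W 1 - Z 2 * cj W 2 = 0 := by rw [← hZW, J_apply]; rfl
  suffices hx : Z = 0 ∨ ∃ x, Zp x = Z ∧ Wp x = cj W by
    rcases hx with rfl | ⟨x, h1, h2⟩
    · simp
    · have := key x
      rwa [h1, h2, cj_cj] at this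
  by_cases h0 : Z 0 = 0
  · by_cases h1 : Z 1 = 0
    · by_cases h2 : Z 2 = 0
      · left; funext i; fin_cases i <;> assumption
      · right
        refine ⟨![Z 0, Z 1, Z 2, -cj W 1 / Z 2, cj W 0 / Z 2, 0], ?_, ?_⟩ <;> funext i <;>
          fin_cases i <;> simp [hZp, hWp, h0, h1] <;> try field_simp
        rw [h0, h1] at hb
        simpa [h2, eq_comm] using hb
    · right
      refine ⟨![Z 0, Z 1, Z 2, -cj W 2 / Z 1, 0, cj W 0 / Z 1], ?_, ?_⟩ <;> funext i <;>
        fin_cases i <;> simp [hZp, hWp, h0] <;> try field_simp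
      rw [h0] at hb
      linear_combination -hb
  · right
    refine ⟨![Z 0, Z 1, Z 2, 0, cj W 2 / Z 0, -cj W 1 / Z 0], ?_, ?_⟩ <;> funext i <;>
      fin_cases i <;> simp [hZp, hWp] <;> field_simp
    linear_combination -hb

end

/-- A Laurent polynomial of degree at most two that vanishes on the unit circle is zero. -/
theorem laurent_two_eq_zero {a b c d e : ℂ} (h : ∀ ω : ℂ, ω * conj ω = 1 →
    a + ω * b + conj ω * c + ω ^ 2 * d + conj ω ^ 2 * e = 0) :
    a = 0 ∧ b = 0 ∧ c = 0 ∧ d = 0 ∧ e = 0 := by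
  have h1 := h 1 (by simp)
  have h2 := h (-1) (by simp)
  have h3 := h I (by simp)
  have h4 := h (-I) (by simp)
  have h5 := h ((3 + 4 * I) / 5) (by
    simp [conj_ofNat]; linear_combination (-16 / 25) * I_mul_I)
  simp only [map_one, map_neg, conj_I, map_div₀, map_add, map_mul, conj_ofNat] at h1 h2 h3 h4 h5
  have hI : I ^ 2 = -1 := I_sq
  have hbc : b + c = 0 := by linear_combination (h1 - h2) / 2
  have hbc' : b - c = 0 := by linear_combination (-I / 2) * (h3 - h4) + (b - c) * hI
  have hb : b = 0 := by linear_combination (hbc + hbc') / 2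
  have hc : c = 0 := by linear_combination (hbc - hbc') / 2
  have ha : a = 0 := by linear_combination (h1 + h2 + h3 + h4) / 4 - (d + e) / 2 * hI
  subst hb hc ha
  have hde : d + e = 0 := by linear_combination h1
  have hd : d * I = 0 := by
    linear_combination (25 / 48) * h5 + (7 / 48) * hde - (d + e) / 3 * hI
      + (25 / 48) * (24 / 25) * I * hde
  have hd : d = 0 := by simpa using hd
  exact ⟨rfl, rfl, rfl, hd, by linear_combination hde - hd⟩

section

variable {F : Bil} (hs : ∀ Z W, F Z W = F W Z) (hN : ∀ Z W, J Z W = 0 → K (F Z Z) (F W W) = 0)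

/-- Standard basis vectors. -/
noncomputable abbrev E (i : Fin 3) : Fin 3 → ℂ := Pi.single i 1

/-- Inner products of the values of `F` at pairs of standard basis vectors. -/
noncomputable def gram (F : Bil) (i j k l : Fin 3) : ℂ := K (F (E i) (E j)) (F (E k) (E l))

theorem gram_conj (F : Bil) (i j k l : Fin 3) : conj (gram F i j k l) = gram F k l i j :=
  diagForm_isHerm _ _ _

include hs in
theorem gram_symm (i j k l : Fin 3) : gram F i j k l = gram F j i k l := by
  unfold gram; rw [hs]

include hs in
theorem gram_symm' (i j k l : Fin 3) : gram F i j k l = gram F i j l k := by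
  unfold gram; rw [hs (E k)]

/-- The signs of `J`. -/
noncomputable abbrev s3 (i : Fin 3) : ℂ := (sgn 2 3 i : ℂ)

theorem s3_sq (i : Fin 3) : s3 i * s3 i = 1 := by
  rcases sgn_cases 2 3 i with h | h <;> simp [s3, h]

theorem conj_s3 (i : Fin 3) : conj (s3 i) = s3 i := conj_ofReal _

theorem J_E (i j : Fin 3) : J (E i) (E j) = if i = j then s3 i else 0 := diagForm_single _ i j

theorem J_test {j k : Fin 3} (hjk : j ≠ k) {ω : ℂ} (hω : ω * conj ω = 1) :
    J (E j + ω • E k) (E j + (-(s3 j * s3 k) * ω) • E k) = 0 := by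
  simp only [map_add, map_smul, LinearMap.add_apply, LinearMap.smul_apply,
    LinearMap.map_smulₛₗ, smul_eq_mul, J_E, hjk, hjk.symm, if_true, if_false, map_mul, map_neg,
    conj_s3]
  linear_combination (-s3 j * s3 k * s3 k) * hω - s3 j * s3_sq k

include hs hN in
theorem gram_two {j k : Fin 3} (hjk : j ≠ k) :
    gram F j j k k = 0 ∧ gram F j k j j = s3 j * s3 k * gram F k k j k ∧
    gram F j j j j + gram F k k k k = 4 * (s3 j * s3 k) * gram F j k j k := by
  have hσ : (s3 j * s3 k) * (s3 j * s3 k) = 1 := by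
    linear_combination s3_sq j * s3 k * s3 k + s3_sq k
  obtain ⟨ha, hb, hc, hd, he⟩ := laurent_two_eq_zero
    (a := gram F j j j j - 4 * (s3 j * s3 k) * gram F j k j k + gram F k k k k)
    (b := 2 * gram F j k j j - 2 * (s3 j * s3 k) * gram F k k j k)
    (c := 2 * gram F j k k k - 2 * (s3 j * s3 k) * gram F j j j k)
    (d := gram F k k j j) (e := gram F j j k k) (by
      intro ω hω
      have := hN _ _ (J_test hjk hω)
      simp only [map_add, map_smul, LinearMap.add_apply, LinearMap.smul_apply,
        LinearMap.map_smulₛₗ, smul_eq_mul, map_mul, map_neg, conj_s3, hs (E k) (E j)] at this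
      simp only [gram]
      set σ := s3 j * s3 k
      linear_combination (exp := 1) this + 
        (4 * σ * K (F (E j) (E k)) (F (E j) (E k)) * 1 ) * (hω) +
        (2 * σ * ω * K (F (E k) (E k)) (F (E j) (E k)) -
          2 * conj ω * K (F (E j) (E k)) (F (E k) (E k))
          - K (F (E k) (E k)) (F (E k) (E k)) * (ω * conj ω + 1)) * hω
        - (conj ω ^ 2 * K (F (E j) (E j)) (F (E k) (E k))
          + 2 * ω * conj ω ^ 2 * K (F (E j) (E k)) (F (E k) (E k))
          + ω ^ 2 * conj ω ^ 2 * K (F (E k) (E k)) (F (E k) (E k))) * hσ)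
  exact ⟨he, by linear_combination hb / 2, by linear_combination ha⟩

include hs hN in
theorem gram_three {j k l : Fin 3} (hjk : j ≠ k) (hjl : j ≠ l) (hkl : k ≠ l) :
    gram F j j k l = 0 ∧ 2 * gram F j k j l = s3 j * s3 k * gram F k k k l := by
  obtain ⟨ha, hb, hc, hd, he⟩ := laurent_two_eq_zero
    (a := gram F j j j l - 2 * (s3 j * s3 k) * gram F j k k l)
    (b := 2 * gram F j k j l - (s3 j * s3 k) * gram F k k k l)
    (c := -(s3 j * s3 k) * gram F j j k l)
    (d := gram F k k j l) (e := 0) (by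
      intro ω hω
      have h0 := J_test hjk hω
      have h1 : ∀ v : ℂ, J (E j + ω • E k) ((E j + (-(s3 j * s3 k) * ω) • E k) + v • E l) = 0 := by
        intro v
        rw [map_add, h0, LinearMap.map_smulₛₗ]
        simp [J_E, hjl, hkl]
      have h2 := hN _ _ (h1 1)
      have h3 := hN _ _ (h1 (-1))
      simp only [map_add, map_smul, LinearMap.add_apply, LinearMap.smul_apply,
        LinearMap.map_smulₛₗ, smul_eq_mul, map_mul, map_neg, conj_s3, map_one, hs (E k) (E j),
        hs (E l) (E j), hs (E l) (E k)] at h2 h3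
      simp only [gram]
      set σ := s3 j * s3 k
      linear_combination (h2 - h3) / 4 +
        (2 * σ * K (F (E j) (E k)) (F (E k) (E l)) + 
         σ * ω * K (F (E k) (E k)) (F (E k) (E l))) * hω)
  refine ⟨?_, by linear_combination hb⟩
  have hσ : (s3 j * s3 k) * (s3 j * s3 k) = 1 := by
    linear_combination s3_sq j * s3 k * s3 k + s3_sq k
  linear_combination (-(s3 j * s3 k)) * hc - gram F j j k l * hσ

/-- Matrix coefficients of the Hermitian quotient. -/
noncomputable def quotCoeff (F : Bil) (i j : Fin 3) : ℂ :=
  if i = j then s3 i * gram F i i i i else 2 * s3 j * gram F j i j j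

/-- The Hermitian quotient of the pulled back form by `J`. -/
noncomputable def quotForm (F : Bil) : SesqForm 3 :=
  LinearMap.mk₂'ₛₗ _ _ (fun x y => ∑ i, ∑ j, quotCoeff F i j * x i * conj (y j))
    (by intros; simp [mul_add, add_mul, Finset.sum_add_distrib])
    (by intros; simp only [Pi.smul_apply, smul_eq_mul, Finset.mul_sum, RingHom.id_apply]
        exact Finset.sum_congr rfl fun _ _ => Finset.sum_congr rfl fun _ _ => by ring)
    (by intros; simp [mul_add, Finset.sum_add_distrib])
    (by intros; simp only [Pi.smul_apply, smul_eq_mul, Finset.mul_sum, map_mul]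
        exact Finset.sum_congr rfl fun _ _ => Finset.sum_congr rfl fun _ _ => by ring)

theorem quotForm_E (F : Bil) (i j : Fin 3) : quotForm F (E i) (E j) = quotCoeff F i j := by
  change ∑ k, ∑ l, quotCoeff F k l * E i k * conj (E j l) = _
  rw [Finset.sum_eq_single i, Finset.sum_eq_single j]
  · simp
  · intro l _ hl; simp [hl]
  · simp
  · intro k _ hk; simp [hk]
  · simp

include hs hN in
theorem quotForm_isHerm : (quotForm F).IsHerm := by
  have hc : ∀ i j, conj (quotCoeff F i j) = quotCoeff F j i := by
    intro i j
    unfold quotCoeff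
    by_cases h : i = j
    · subst h; simp [gram_conj, conj_ofReal]
    · rw [if_neg h, if_neg (Ne.symm h)]
      simp only [map_mul, conj_s3, gram_conj, conj_ofNat]
      have := (gram_two hs hN h).2.1
      rw [gram_symm' hs j j j i]
      have h2 := (gram_two hs hN h).2.1
      linear_combination (-2 * s3 i) * h2 - 2 * s3 j * gram F j j i j * s3_sq i
  intro x y
  change conj (∑ i, ∑ j, quotCoeff F i j * x i * conj (y j)) =
    ∑ i, ∑ j, quotCoeff F i j * y i * conj (x j)
  simp only [map_sum, map_mul, hc, conj_conj]
  rw [Finset.sum_comm]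
  exact Finset.sum_congr rfl fun _ _ => Finset.sum_congr rfl fun _ _ => by ring

/-- `F` pulls `K` back to the product of `q` and `J` (in polarized form). -/
def GramRel (F : Bil) (q : SesqForm 3) (a b c d : Fin 3 → ℂ) : Prop :=
  4 * K (F a b) (F c d) = q a c * J b d + q a d * J b c + q b c * J a d + q b d * J a c

include hs in
theorem GramRel.swap {q : SesqForm 3} {a b c d : Fin 3 → ℂ} (h : GramRel F q a b c d) :
    GramRel F q a b d c := by
  unfold GramRel at *
  rw [hs d c]; linear_combination h

theorem GramRel.flip {q : SesqForm 3} (hq : q.IsHerm) {a b c d : Fin 3 → ℂ}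
    (h : GramRel F q a b c d) : GramRel F q c d a b := by
  have := congrArg conj h
  simp only [map_mul, map_add, conj_ofNat, diagForm_isHerm (sgn 2 4) _ _,
    diagForm_isHerm (sgn 2 3) _ _, hq _ _] at this
  unfold GramRel
  linear_combination this

theorem GramRel.ext {q : SesqForm 3} {a b c : Fin 3 → ℂ} (h : ∀ l, GramRel F q a b c (E l))
    (d : Fin 3 → ℂ) : GramRel F q a b c d := by
  have : (4 : ℂ) • (K (F a b)).comp (F c) =
      q a c • J b + J b c • q a + q b c • J a + J a c • q b := by
    refine (Pi.basisFun ℂ (Fin 3)).ext fun l => ?_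
    have := h l
    unfold GramRel at this
    simp only [Pi.basisFun_apply, LinearMap.smul_apply, LinearMap.comp_apply, LinearMap.add_apply,
      smul_eq_mul]
    linear_combination this
  have := LinearMap.congr_fun this d
  simp only [LinearMap.smul_apply, LinearMap.comp_apply, LinearMap.add_apply,
    smul_eq_mul] at this
  unfold GramRel
  linear_combination this

include hs in
theorem gramRel_of_basis {q : SesqForm 3} (hq : q.IsHerm)
    (h : ∀ i j k l, GramRel F q (E i) (E j) (E k) (E l)) (a b c d : Fin 3 → ℂ) :
    GramRel F q a b c d := by
  have h1 : ∀ i j c d, GramRel F q (E i) (E j) c d := fun i j c d =>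
    GramRel.ext (fun l => (GramRel.ext (fun k => (h i j l k)) c).swap hs) d
  have h2 : ∀ c d a b, GramRel F q c d a b := fun c d a b =>
    GramRel.ext (fun l => (GramRel.ext (fun k => ((h1 l k c d).flip hq)) a).swap hs) b
  exact h2 a b c d

include hs hN in
theorem gramRel_quotForm (a b c d : Fin 3 → ℂ) : GramRel F (quotForm F) a b c d := by
  refine gramRel_of_basis hs (quotForm_isHerm hs hN) (fun i j k l => ?_) a b c d
  have R1 := fun {i k : Fin 3} (h : i ≠ k) => (gram_two hs hN h).1
  have R2 := fun {i k : Fin 3} (h : i ≠ k) => (gram_two hs hN h).2.1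
  have R3 := fun {i k : Fin 3} (h : i ≠ k) => (gram_two hs hN h).2.2
  have R4 := fun {i j k : Fin 3} (h : i ≠ j) (h' : i ≠ k) (h'' : j ≠ k) =>
    (gram_three hs hN h h' h'').1
  have R5 := fun {i j k : Fin 3} (h : i ≠ j) (h' : i ≠ k) (h'' : j ≠ k) =>
    (gram_three hs hN h h' h'').2
  have R4' : ∀ {i j k : Fin 3} (_ : i ≠ j) (_ : i ≠ k) (_ : j ≠ k), gram F j k i i = 0 := by
    intro i j k h h' h''
    rw [← gram_conj, R4 h h' h'', map_zero]
  have mixed : ∀ {i j l : Fin 3} (_ : i ≠ j) (_ : i ≠ l) (_ : j ≠ l),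
      4 * gram F i j i l = s3 i * quotCoeff F j l := by
    intro i j l h h' h''
    rw [quotCoeff, if_neg h'']
    have a := R5 h h' h''
    have b := R2 h''.symm
    rw [gram_symm' hs j j l j] at b
    linear_combination 2 * a - 2 * s3 i * s3 l * b - 2 * s3 i * s3 j * gram F j j j l * s3_sq l
  unfold GramRel
  simp only [J_E, quotForm_E]
  change 4 * gram F i j k l = _
  rcases eq_or_ne i j with rfl | hij
  · rcases eq_or_ne k l with rfl | hkl
    · rcases eq_or_ne i k with rfl | hik
      · simp only [quotCoeff, if_true]
        linear_combination (-4) * gram F i i i i * s3_sq i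
      · rw [R1 hik]; simp [hik]
    · rcases eq_or_ne i k with rfl | hik
      · simp only [quotCoeff, hkl, if_true, if_false]
        have := R2 hkl.symm
        rw [gram_symm' hs i i l i] at this
        linear_combination (-4) * s3 i * s3 l * this - 4 * gram F i i i l * s3_sq l * s3 i * s3 i
          - 4 * gram F i i i l * s3_sq i
      · rcases eq_or_ne i l with rfl | hil
        · simp only [quotCoeff, hik, if_true, if_false]
          have := R2 hik.symm
          linear_combination (-4) * s3 i * s3 k * this - 4 * gram F i i k i * s3_sq k * s3 i * s3 i
            - 4 * gram F i i k i * s3_sq i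
        · rw [R4 hik hil hkl]; simp [hik, hil]
  · rcases eq_or_ne k l with rfl | hkl
    · rcases eq_or_ne i k with rfl | hik
      · simp only [quotCoeff, hij.symm, if_true, if_false]
        linear_combination (-4) * gram F i j i i * s3_sq i
      · rcases eq_or_ne j k with rfl | hjk
        · simp only [quotCoeff, hij, if_true, if_false]
          rw [gram_symm hs i j]
          linear_combination (-4) * gram F j i j j * s3_sq j
        · rw [R4' (Ne.symm hik) (Ne.symm hjk) hij]; simp [hik, hjk]
    · rcases eq_or_ne i k with rfl | hik
      · rcases eq_or_ne j l with rfl | hjl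
        · simp only [quotCoeff, hij, hij.symm, if_true, if_false]
          linear_combination (-s3 i * s3 j) * R3 hij - 4 * gram F i j i j *
            (s3_sq i * s3 j * s3 j + s3_sq j)
        · rw [mixed hij hkl hjl]; simp [hij.symm, hjl, hkl]; ring
      · rcases eq_or_ne i l with rfl | hil
        · rcases eq_or_ne j k with rfl | hjk
          · simp only [quotCoeff, hij, hij.symm, if_true, if_false]
            rw [gram_symm' hs]
            linear_combination (-s3 i * s3 j) * R3 hij - 4 * gram F i j i j *
              (s3_sq i * s3 j * s3 j + s3_sq j)
          · rw [gram_symm' hs, mixed hij hik hjk]; simp [hij.symm, hjk, hik]; ring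
        · rcases eq_or_ne j k with rfl | hjk
          · rw [gram_symm hs, mixed hij.symm hkl hil]; simp [hij, hil, hkl]; ring
          · have hjl : j = l := by omega
            subst hjl
            rw [gram_symm hs, gram_symm' hs, mixed hij.symm hjk hik]; simp [hij, hik, hjk]; ring

end

/-- Symmetric bilinear forms on `ℂ³` homogenizing a polynomial of degree at most two. -/
theorem exists_homogenization {p : MvPolynomial (Fin 2) ℂ} (hp : p.totalDegree ≤ 2) :
    ∃ h : (Fin 3 → ℂ) →ₗ[ℂ] (Fin 3 → ℂ) →ₗ[ℂ] ℂ, (∀ Z W, h Z W = h W Z) ∧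
      ∀ z, h (affLift z) (affLift z) = MvPolynomial.eval z p := by
  have mono : ∀ m : Fin 2 →₀ ℕ, m ∈ p.support →
      ∃ l l' : (Fin 3 → ℂ) →ₗ[ℂ] ℂ, ∀ z : Fin 2 → ℂ,
        l (affLift z) * l' (affLift z) = z 0 ^ m 0 * z 1 ^ m 1 := by
    intro m hm
    have h1 : m 0 + m 1 ≤ 2 := by
      have := MvPolynomial.le_totalDegree hm
      rw [Finsupp.sum_fintype _ _ (fun _ => rfl), Fin.sum_univ_two] at this
      omega
    let x : Fin 3 → ((Fin 3 → ℂ) →ₗ[ℂ] ℂ) := fun i => LinearMap.proj (R := ℂ) (φ := fun _ => ℂ) i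
    have hx : ∀ i Z, x i Z = Z i := fun _ _ => rfl
    generalize m 0 = a at h1 ⊢
    generalize m 1 = b at h1 ⊢
    have ha : a ≤ 2 := by omega
    have hb : b ≤ 2 := by omega
    interval_cases a <;> interval_cases b
    · exact ⟨x 2, x 2, fun z => by simp [hx, affLift_two]⟩
    · exact ⟨x 1, x 2, fun z => by simp [hx, affLift_two]⟩
    · exact ⟨x 1, x 1, fun z => by simp [hx, affLift_two, sq]⟩
    · exact ⟨x 0, x 2, fun z => by simp [hx, affLift_two]⟩
    · exact ⟨x 0, x 1, fun z => by simp [hx, affLift_two]⟩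
    · omega
    · exact ⟨x 0, x 0, fun z => by simp [hx, affLift_two, sq]⟩
    · omega
    · omega
  choose! l l' hl using mono
  refine ⟨∑ m ∈ p.support, (p.coeff m / 2) • (((LinearMap.mul ℂ ℂ).compl₁₂ (l m) (l' m)) +
    ((LinearMap.mul ℂ ℂ).compl₁₂ (l' m) (l m))), fun Z W => ?_, fun z => ?_⟩
  · simp only [LinearMap.sum_apply, LinearMap.smul_apply, LinearMap.add_apply,
      LinearMap.compl₁₂_apply, LinearMap.mul_apply', smul_eq_mul]
    exact Finset.sum_congr rfl fun m _ => by ring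
  · simp only [LinearMap.sum_apply, LinearMap.smul_apply, LinearMap.add_apply,
      LinearMap.compl₁₂_apply, LinearMap.mul_apply', smul_eq_mul]
    rw [MvPolynomial.eval_eq']
    refine Finset.sum_congr rfl fun m hm => ?_
    rw [Fin.prod_univ_two, ← hl m hm]
    ring

/-- Assemble a bilinear map from its components. -/
noncomputable def bilOfComponents (h : Fin 4 → (Fin 3 → ℂ) →ₗ[ℂ] (Fin 3 → ℂ) →ₗ[ℂ] ℂ) : Bil :=
  LinearMap.mk₂ ℂ (fun Z W i => h i Z W) (by intros; funext; simp) (by intros; funext; simp)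
    (by intros; funext; simp) (by intros; funext; simp)

theorem exists_lift {f : RatMap 2 3} (hf : f.degree ≤ 2) : ∃ F, Lift f F := by
  have hd : f.den.totalDegree ≤ 2 := (le_max_right _ _).trans hf
  have hn : ∀ i, (f.num i).totalDegree ≤ 2 := fun i =>
    ((Finset.le_sup (f := fun i => (f.num i).totalDegree) (Finset.mem_univ i)).trans
      (le_max_left _ _)).trans hf
  choose h hs hv using fun i => exists_homogenization (hn i)
  obtain ⟨hd, hds, hdv⟩ := exists_homogenization hd
  refine ⟨bilOfComponents (Fin.snoc (α := fun _ => _) h hd), fun Z W => ?_, fun z => ?_⟩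
  · funext i
    refine Fin.lastCases ?_ (fun i => ?_) i
    · change Fin.snoc (α := fun _ => _) h hd (Fin.last 3) Z W =
        Fin.snoc (α := fun _ => _) h hd (Fin.last 3) W Z
      rw [Fin.snoc_last, hds]
    · change Fin.snoc (α := fun _ => _) h hd i.castSucc Z W =
        Fin.snoc (α := fun _ => _) h hd i.castSucc W Z
      rw [Fin.snoc_castSucc, hs]
  · funext i
    refine Fin.lastCases ?_ (fun i => ?_) i
    · change Fin.snoc (α := fun _ => _) h hd (Fin.last 3) _ _ = _
      rw [Fin.snoc_last, hdv, Fin.snoc_last]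
    · change Fin.snoc (α := fun _ => _) h hd i.castSucc _ _ = _
      rw [Fin.snoc_castSucc, hv, Fin.snoc_castSucc]

/-- A matrix whose columns have, up to a nonzero scalar, the same Gram matrix as a spanning family
of columns is obtained from it by an isometry. -/
theorem exists_isometry {ι : Type*} [Fintype ι] {n : ℕ} {ε : Fin n → ℝ}
    (hε : ∀ i, ε i = 1 ∨ ε i = -1) {a c : ι → Fin n → ℂ} {s : ℝ} (hs : s ≠ 0)
    (hg : ∀ i j, diagForm ε (a i) (a j) = s * diagForm ε (c i) (c j))
    (hspan : ∀ y, ∃ t : ι → ℂ, ∑ i, t i • c i = y) :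
    ∃ T : Matrix (Fin n) (Fin n) ℂ, Scales ε T s ∧ ∀ i, T.mulVec (c i) = a i := by
  classical
  choose t ht using hspan
  set D := diagForm ε
  have hD : ∀ t t' : ι → ℂ, D (∑ i, t i • a i) (∑ i, t' i • a i) =
      s * D (∑ i, t i • c i) (∑ i, t' i • c i) := by
    intro t t'
    simp only [map_sum, map_smul, LinearMap.sum_apply, LinearMap.smul_apply, LinearMap.map_smulₛₗ,
      smul_eq_mul, Finset.mul_sum, hg]
    exact Finset.sum_congr rfl fun _ _ => Finset.sum_congr rfl fun _ _ => by ring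
  set T : Matrix (Fin n) (Fin n) ℂ := Matrix.of fun l m => (∑ i, t (Pi.single m 1) i • a i) l
  have hT : ∀ x, T.mulVec x = ∑ i, (∑ m, x m * t (Pi.single m 1) i) • a i := by
    intro x
    funext l
    simp only [Matrix.mulVec, dotProduct, T, Matrix.of_apply, Finset.sum_apply, Pi.smul_apply,
      smul_eq_mul, Finset.sum_mul]
    rw [Finset.sum_comm]
    exact Finset.sum_congr rfl fun _ _ => Finset.sum_congr rfl fun _ _ => by ring
  have hx : ∀ x, ∑ i, (∑ m, x m * t (Pi.single m 1) i) • c i = x := by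
    intro x
    simp only [Finset.sum_smul, mul_smul]
    rw [Finset.sum_comm]
    simp only [← Finset.smul_sum, ht]
    funext l
    simp [Finset.sum_apply, Pi.single_apply]
  have hS : Scales ε T s := ⟨hs, fun x y => by
    rw [hT, hT]
    change D _ _ = _
    rw [hD, hx, hx]⟩
  refine ⟨T, hS, fun j => ?_⟩
  have hu := Matrix.mulVec_surjective_iff_isUnit.2 (hS.isUnit hε)
  rw [← sub_eq_zero]
  funext l
  obtain ⟨y, hy⟩ := hu (Pi.single l 1)
  have h0 : D (T.mulVec (c j) - a j) (T.mulVec y) = 0 := by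
    rw [map_sub, LinearMap.sub_apply, hS.2]
    have e1 : a j = ∑ i, (if i = j then (1 : ℂ) else 0) • a i := by simp
    have e2 : c j = ∑ i, (if i = j then (1 : ℂ) else 0) • c i := by simp
    rw [hT y, e1, hD, ← e2, hx, sub_self]
  rw [hy] at h0
  change diagForm ε _ _ = 0 at h0
  rw [diagForm_apply, Finset.sum_eq_single l] at h0
  · have hl : (ε l : ℂ) ≠ 0 := by rcases hε l with h | h <;> rw [h] <;> norm_num
    simpa [hl] using h0
  · intro k _ hk; simp [hk]
  · simp

theorem bil_expand_vec (F : Bil) (Z W : Fin 3 → ℂ) :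
    F Z W = ∑ j, ∑ k, (Z j * W k) • F (E j) (E k) := by
  funext i
  rw [bil_expand]
  simp [Finset.sum_apply]

theorem qEquiv_of_linear {f g : RatMap 2 3} {F G : Bil} (hf : Lift f F) (hg : Lift g G)
    {X : Matrix (Fin 3) (Fin 3) ℂ} {T : Matrix (Fin 4) (Fin 4) ℂ} {c s : ℝ}
    (hX : Scales (sgn 2 3) X c) (hT : Scales (sgn 2 4) T s)
    (h : ∀ Z, F (X.mulVec Z) (X.mulVec Z) = T.mulVec (G Z Z)) :
    RatMap.QEquiv 2 0 2 1 f g := by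
  refine ⟨X, T, hX.isHQAut (a := 2) (b := 0), hT.isHQAut (a := 2) (b := 1), fun z hz hzf hzg => ?_⟩
  have hz' : X.mulVec (affLift z) 2 ≠ 0 := hz
  have h1 := eq_smul_affLift hz'
  have e : linFrac X z = ![X.mulVec (affLift z) 0 / X.mulVec (affLift z) 2,
      X.mulVec (affLift z) 1 / X.mulVec (affLift z) 2] := by
    funext i; fin_cases i <;> rfl
  rw [e] at hzf ⊢
  generalize ![X.mulVec (affLift z) 0 / X.mulVec (affLift z) 2,
      X.mulVec (affLift z) 1 / X.mulVec (affLift z) 2] = χ at h1 hzf ⊢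
  generalize X.mulVec (affLift z) 2 = μ at h1 hz'
  have h2 := h (affLift z)
  rw [h1, map_smul, map_smul, LinearMap.smul_apply, hf.val_eq hzf, hg.val_eq hzg,
    Matrix.mulVec_smul] at h2
  have hd1 : MvPolynomial.eval z g.den ≠ 0 := hzg
  have hd2 : MvPolynomial.eval χ f.den ≠ 0 := hzf
  refine ⟨(MvPolynomial.eval z g.den)⁻¹ * (μ * (μ * MvPolynomial.eval χ f.den)),
    mul_ne_zero (inv_ne_zero hd1) (mul_ne_zero hz' (mul_ne_zero hz' hd2)), ?_⟩
  rw [mul_smul, mul_smul, mul_smul, h2, inv_smul_smul₀ hd1]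

theorem qEquiv_of_forms {f g : RatMap 2 3} {F G : Bil} (hf : Lift f F) (hg : Lift g G)
    {q r : SesqForm 3} (hq : ∀ a b c d, GramRel F q a b c d) (hr : ∀ a b c d, GramRel G r a b c d)
    (X : (Fin 3 → ℂ) →ₗ[ℂ] (Fin 3 → ℂ)) {c s : ℝ} (hc : c ≠ 0) (hs : s ≠ 0)
    (hJ : ∀ Z W, J (X Z) (X W) = c * J Z W) (hX : ∀ Z W, q (X Z) (X W) = s * r Z W)
    (hspan : ∀ y, ∃ t : Fin 3 × Fin 3 → ℂ, ∑ p, t p • G (E p.1) (E p.2) = y) :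
    RatMap.QEquiv 2 0 2 1 f g := by
  obtain ⟨T, hT, hTc⟩ := exists_isometry (ε := sgn 2 4) (sgn_cases 2 4)
    (a := fun p : Fin 3 × Fin 3 => F (X (E p.1)) (X (E p.2)))
    (c := fun p : Fin 3 × Fin 3 => G (E p.1) (E p.2)) (s := s * c) (mul_ne_zero hs hc)
    (fun i j => by
      have h1 := hq (X (E i.1)) (X (E i.2)) (X (E j.1)) (X (E j.2))
      have h2 := hr (E i.1) (E i.2) (E j.1) (E j.2)
      unfold GramRel at h1 h2
      simp only [hJ, hX] at h1
      push_cast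
      linear_combination h1 / 4 - s * c / 4 * h2) hspan
  have hXm : ∀ Z, (LinearMap.toMatrix' X).mulVec Z = X Z := fun Z => LinearMap.toMatrix'_mulVec X Z
  refine qEquiv_of_linear hf hg (X := LinearMap.toMatrix' X) (c := c) ⟨hc, fun x y => by
    rw [hXm, hXm]; exact hJ x y⟩ hT fun Z => ?_
  rw [hXm, bil_expand_vec G, ← Fintype.sum_prod_type', Matrix.mulVec_sum]
  simp only [Matrix.mulVec_smul, hTc]
  rw [Fintype.sum_prod_type' (f := fun i j => (Z i * Z j) • F (X (E i)) (X (E j)))]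
  have := bil_expand_vec (F.compl₁₂ X X) Z Z
  simpa using this

theorem exists_ne_zero_combination {n m p : ℕ} (hpm : p < m) (x : Fin m → Fin n → ℂ)
    (L : (Fin n → ℂ) →ₗ[ℂ] (Fin p → ℂ)) : ∃ c : Fin m → ℂ, c ≠ 0 ∧ L (∑ i, c i • x i) = 0 := by
  have h : LinearMap.ker (L ∘ₗ Fintype.linearCombination ℂ x) ≠ ⊥ :=
    LinearMap.ker_ne_bot_of_finrank_lt (by simpa using hpm)
  obtain ⟨c, hc, hc0⟩ := Submodule.exists_mem_ne_zero_of_ne_bot h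
  exact ⟨c, hc0, by simpa [Fintype.linearCombination_apply] using hc⟩

/-- Inertia: `m` orthogonal vectors on which the form is nonnegative, where the form is nonpositive
on a subspace of codimension `p < m`. -/
theorem exists_null_combination {n m p : ℕ} (hpm : p < m) {D : SesqForm n}
    (x : Fin m → Fin n → ℂ) (hx : ∀ i j, i ≠ j → D (x i) (x j) = 0)
    {a : Fin m → ℝ} (ha : ∀ i, D (x i) (x i) = a i) (ha0 : ∀ i, 0 ≤ a i)
    (L : (Fin n → ℂ) →ₗ[ℂ] (Fin p → ℂ)) (hL : ∀ u, L u = 0 → (D u u).re ≤ 0) :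
    ∃ c : Fin m → ℂ, c ≠ 0 ∧ L (∑ i, c i • x i) = 0 ∧
      D (∑ i, c i • x i) (∑ i, c i • x i) = 0 ∧ ∀ i, c i = 0 ∨ a i = 0 := by
  obtain ⟨c, hc, hLc⟩ := exists_ne_zero_combination hpm x L
  have h1 : D (∑ i, c i • x i) (∑ i, c i • x i) = ((∑ i, ‖c i‖ ^ 2 * a i : ℝ) : ℂ) := by
    simp only [map_sum, map_smul, LinearMap.sum_apply, LinearMap.smul_apply, LinearMap.map_smulₛₗ,
      smul_eq_mul]
    push_cast
    refine Finset.sum_congr rfl fun i _ => ?_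
    rw [Finset.sum_eq_single i]
    · rw [ha, ← mul_conj']; ring
    · intro j _ hj; rw [hx _ _ hj]; ring
    · simp
  have h2 := hL _ hLc
  rw [h1, ofReal_re] at h2
  have h3 : ∀ i ∈ Finset.univ, 0 ≤ ‖c i‖ ^ 2 * a i := fun i _ => mul_nonneg (sq_nonneg _) (ha0 i)
  have h4 : ∑ i, ‖c i‖ ^ 2 * a i = 0 := le_antisymm h2 (Finset.sum_nonneg h3)
  refine ⟨c, hc, hLc, by rw [h1, h4, ofReal_zero], fun i => ?_⟩
  have := (Finset.sum_eq_zero_iff_of_nonneg h3).1 h4 i (Finset.mem_univ i)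
  simpa using this

theorem K_self (x : Fin 4 → ℂ) :
    K x x = ((‖x 0‖ ^ 2 + ‖x 1‖ ^ 2 - ‖x 2‖ ^ 2 - ‖x 3‖ ^ 2 : ℝ) : ℂ) := by
  rw [K_apply]; simp [mul_conj']

theorem J_self (x : Fin 3 → ℂ) :
    J x x = ((‖x 0‖ ^ 2 + ‖x 1‖ ^ 2 - ‖x 2‖ ^ 2 : ℝ) : ℂ) := by
  rw [J_apply]; simp [mul_conj']

/-- The first two coordinates. -/
def firstTwo (n : ℕ) : (Fin (n + 2) → ℂ) →ₗ[ℂ] (Fin 2 → ℂ) where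
  toFun x := ![x 0, x 1]
  map_add' x y := by funext i; fin_cases i <;> simp
  map_smul' c x := by funext i; fin_cases i <;> simp

theorem firstTwo_eq_zero {n : ℕ} {x : Fin (n + 2) → ℂ} (h : firstTwo n x = 0) :
    x 0 = 0 ∧ x 1 = 0 := ⟨congrFun h 0, congrFun h 1⟩

theorem K_nonpos {u : Fin 4 → ℂ} (h : firstTwo 2 u = 0) : (K u u).re ≤ 0 := by
  obtain ⟨h0, h1⟩ := firstTwo_eq_zero h
  rw [K_self, ofReal_re, h0, h1]
  simp only [norm_zero]
  nlinarith [sq_nonneg ‖u 2‖, sq_nonneg ‖u 3‖]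

theorem eq_zero_of_K {u : Fin 4 → ℂ} (h : firstTwo 2 u = 0) (hu : K u u = 0) : u = 0 := by
  obtain ⟨h0, h1⟩ := firstTwo_eq_zero h
  rw [K_self, ofReal_eq_zero, h0, h1] at hu
  simp only [norm_zero] at hu
  have h2 : u 2 = 0 := by
    have : ‖u 2‖ ^ 2 = 0 := by nlinarith [sq_nonneg ‖u 2‖, sq_nonneg ‖u 3‖]
    simpa using this
  have h3 : u 3 = 0 := by
    have : ‖u 3‖ ^ 2 = 0 := by nlinarith [sq_nonneg ‖u 2‖, sq_nonneg ‖u 3‖]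
    simpa using this
  funext i; fin_cases i <;> assumption

/-- Interchange of the positive and the negative coordinates. -/
def swapCoord : (Fin 4 → ℂ) →ₗ[ℂ] (Fin 4 → ℂ) where
  toFun x := ![x 2, x 3, x 0, x 1]
  map_add' x y := by funext i; fin_cases i <;> simp
  map_smul' c x := by funext i; fin_cases i <;> simp

theorem swapCoord_injective {x : Fin 4 → ℂ} (h : swapCoord x = 0) : x = 0 := by
  funext i
  fin_cases i
  exacts [congrFun h 2, congrFun h 3, congrFun h 0, congrFun h 1]

theorem K_swapCoord (x y : Fin 4 → ℂ) : K (swapCoord x) (swapCoord y) = -K x y := by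
  simp only [K_apply, swapCoord, LinearMap.coe_mk, AddHom.coe_mk, Matrix.cons_val]
  ring

/-- Three orthogonal vectors of `ℂ^{2,2}` cannot all be positive. -/
theorem K_three_pos {x : Fin 3 → Fin 4 → ℂ} (hx : ∀ i j, i ≠ j → K (x i) (x j) = 0)
    {a : Fin 3 → ℝ} (ha : ∀ i, K (x i) (x i) = a i) (ha0 : ∀ i, 0 < a i) : False := by
  obtain ⟨c, hc, -, -, h⟩ := exists_null_combination (by norm_num) x hx ha (fun i => (ha0 i).le)
    (firstTwo 2) (fun u => K_nonpos)
  exact hc (funext fun i => (h i).resolve_right (ha0 i).ne')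

/-- Three orthogonal vectors of `ℂ^{2,2}` cannot all be negative. -/
theorem K_three_neg {x : Fin 3 → Fin 4 → ℂ} (hx : ∀ i j, i ≠ j → K (x i) (x j) = 0)
    {a : Fin 3 → ℝ} (ha : ∀ i, K (x i) (x i) = a i) (ha0 : ∀ i, a i < 0) : False :=
  K_three_pos (x := fun i => swapCoord (x i)) (a := fun i => -a i)
    (fun i j h => by rw [K_swapCoord, hx i j h, neg_zero])
    (fun i => by rw [K_swapCoord, ha]; simp) (fun i => by simpa using ha0 i)

theorem K_re_nonpos_of_perp {x y v : Fin 4 → ℂ} (hxx : K x x = 0) (hxy : K x y = 0)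
    (hyy : K y y = 0) (hi : ∀ a b : ℂ, a • x + b • y = 0 → a = 0 ∧ b = 0) (hvx : K v x = 0)
    (hvy : K v y = 0) : (K v v).re ≤ 0 := by
  obtain ⟨c, hc, hL⟩ := exists_ne_zero_combination (by norm_num) ![v, x, y] (firstTwo 2)
  rw [Fin.sum_univ_three] at hL
  simp only [Matrix.cons_val] at hL
  have hyx : K y x = 0 := by rw [← diagForm_isHerm (sgn 2 4) x y, hxy, map_zero]
  have hxv : K x v = 0 := by rw [← diagForm_isHerm (sgn 2 4) v x, hvx, map_zero]
  have hyv : K y v = 0 := by rw [← diagForm_isHerm (sgn 2 4) v y, hvy, map_zero]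
  have hu : K (c 0 • v + c 1 • x + c 2 • y) (c 0 • v + c 1 • x + c 2 • y) =
      (‖c 0‖ ^ 2 : ℝ) * K v v := by
    simp only [map_add, map_smul, LinearMap.add_apply, LinearMap.smul_apply, LinearMap.map_smulₛₗ,
      smul_eq_mul, hxx, hxy, hyy, hyx, hxv, hyv, hvx, hvy]
    push_cast
    rw [← mul_conj']; ring
  by_cases h0 : c 0 = 0
  · exfalso
    have := eq_zero_of_K hL (by rw [hu, h0]; simp)
    rw [h0, zero_smul, zero_add] at this
    obtain ⟨h1, h2⟩ := hi _ _ this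
    exact hc (by funext i; fin_cases i <;> assumption)
  · have := K_nonpos hL
    rw [hu, re_ofReal_mul] at this
    have hp : 0 < ‖c 0‖ ^ 2 := by positivity
    by_contra! hcon
    nlinarith [mul_pos hp hcon]

/-- A maximal isotropic subspace of `ℂ^{2,2}` contains every vector orthogonal to it; in particular
such a vector is isotropic. -/
theorem K_eq_zero_of_perp {x y v : Fin 4 → ℂ} (hxx : K x x = 0) (hxy : K x y = 0)
    (hyy : K y y = 0) (hi : ∀ a b : ℂ, a • x + b • y = 0 → a = 0 ∧ b = 0) (hvx : K v x = 0)
    (hvy : K v y = 0) : K v v = 0 := by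
  have h1 := K_re_nonpos_of_perp hxx hxy hyy hi hvx hvy
  have h2 := K_re_nonpos_of_perp (x := swapCoord x) (y := swapCoord y) (v := swapCoord v)
    (by rw [K_swapCoord, hxx, neg_zero]) (by rw [K_swapCoord, hxy, neg_zero])
    (by rw [K_swapCoord, hyy, neg_zero])
    (fun a b h => hi a b (swapCoord_injective (by simpa using h)))
    (by rw [K_swapCoord, hvx, neg_zero]) (by rw [K_swapCoord, hvy, neg_zero])
  rw [K_swapCoord, neg_re] at h2
  rw [← (diagForm_isHerm (sgn 2 4)).self_im v, ofReal_eq_zero]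
  linarith

/-- An isotropic vector of `ℂ^{2,2}` orthogonal to two orthogonal positive vectors is zero. -/
theorem eq_zero_of_perp_pos {x y v : Fin 4 → ℂ} {a b : ℝ} (ha : 0 < a) (hb : 0 < b)
    (hxx : K x x = a) (hyy : K y y = b) (hxy : K x y = 0) (hvx : K v x = 0) (hvy : K v y = 0)
    (hvv : K v v = 0) : v = 0 := by
  have hyx : K y x = 0 := by rw [← diagForm_isHerm (sgn 2 4) x y, hxy, map_zero]
  have hxv : K x v = 0 := by rw [← diagForm_isHerm (sgn 2 4) v x, hvx, map_zero]
  have hyv : K y v = 0 := by rw [← diagForm_isHerm (sgn 2 4) v y, hvy, map_zero]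
  obtain ⟨c, hc, hL, hu, h⟩ := exists_null_combination (D := K) (by norm_num) ![x, y, v]
    (fun i j h => by fin_cases i <;> fin_cases j <;> first | exact absurd rfl h | assumption)
    (a := ![a, b, 0]) (fun i => by fin_cases i <;> simp [hxx, hyy, hvv])
    (fun i => by fin_cases i <;> simp [ha.le, hb.le])
    (firstTwo 2) (fun u => K_nonpos)
  have h0 : c 0 = 0 := (h 0).resolve_right ha.ne'
  have h1 : c 1 = 0 := (h 1).resolve_right hb.ne'
  have := eq_zero_of_K hL hu
  rw [Fin.sum_univ_three] at this
  simp only [h0, h1, zero_smul, zero_add, Matrix.cons_val, smul_eq_zero] at this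
  refine this.resolve_left fun h2 => hc ?_
  funext i; fin_cases i <;> assumption

theorem eq_zero_of_perp_neg {x y v : Fin 4 → ℂ} {a b : ℝ} (ha : a < 0) (hb : b < 0)
    (hxx : K x x = a) (hyy : K y y = b) (hxy : K x y = 0) (hvx : K v x = 0) (hvy : K v y = 0)
    (hvv : K v v = 0) : v = 0 := by
  refine swapCoord_injective (eq_zero_of_perp_pos (x := swapCoord x) (y := swapCoord y)
    (neg_pos.2 ha) (neg_pos.2 hb) ?_ ?_ ?_ ?_ ?_ ?_) <;> rw [K_swapCoord] <;> simp [*]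

/-- Three orthogonal vectors of `ℂ^{2,1}` cannot all be positive. -/
theorem J_three_pos {x : Fin 3 → Fin 3 → ℂ} (hx : ∀ i j, i ≠ j → J (x i) (x j) = 0)
    {a : Fin 3 → ℝ} (ha : ∀ i, J (x i) (x i) = a i) (ha0 : ∀ i, 0 < a i) : False := by
  obtain ⟨c, hc, -, -, h⟩ := exists_null_combination (by norm_num) x hx ha (fun i => (ha0 i).le)
    (firstTwo 1) (fun u hu => by
      obtain ⟨h0, h1⟩ := firstTwo_eq_zero hu
      rw [J_self, ofReal_re, h0, h1]
      simp)
  exact hc (funext fun i => (h i).resolve_right (ha0 i).ne')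

/-- Two orthogonal vectors of `ℂ^{2,1}` cannot both be negative. -/
theorem J_two_neg {x y : Fin 3 → ℂ} (hxy : J x y = 0) {a b : ℝ} (ha : J x x = a) (hb : J y y = b)
    (ha0 : a < 0) (hb0 : b < 0) : False := by
  have hyx : J y x = 0 := by rw [← diagForm_isHerm (sgn 2 3) x y, hxy, map_zero]
  obtain ⟨c, hc, -, -, h⟩ := exists_null_combination (p := 1) (D := -J) (by norm_num) ![x, y]
    (fun i j h => by fin_cases i <;> fin_cases j <;> first | exact absurd rfl h | simpa)
    (a := ![-a, -b]) (fun i => by fin_cases i <;> simp [ha, hb])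
    (fun i => by fin_cases i <;> simp [ha0.le, hb0.le])
    (LinearMap.pi fun _ => LinearMap.proj 2) (fun u hu => by
      have h2 : u 2 = 0 := congrFun hu 0
      simp only [LinearMap.neg_apply, neg_re]
      rw [J_self, ofReal_re, h2]
      simp only [norm_zero]
      nlinarith [sq_nonneg ‖u 0‖, sq_nonneg ‖u 1‖])
  refine hc (funext fun i => (h i).resolve_right ?_)
  fin_cases i <;> simp [ha0.ne, hb0.ne]

/-- The sesquilinear form with a given coefficient matrix. -/
noncomputable def matForm (Q : Fin 3 → Fin 3 → ℂ) : SesqForm 3 :=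
  LinearMap.mk₂'ₛₗ _ _ (fun x y => ∑ i, ∑ j, Q i j * x i * conj (y j))
    (by intros; simp [mul_add, add_mul, Finset.sum_add_distrib])
    (by intros; simp only [Pi.smul_apply, smul_eq_mul, Finset.mul_sum, RingHom.id_apply]
        exact Finset.sum_congr rfl fun _ _ => Finset.sum_congr rfl fun _ _ => by ring)
    (by intros; simp [mul_add, Finset.sum_add_distrib])
    (by intros; simp only [Pi.smul_apply, smul_eq_mul, Finset.mul_sum, map_mul]
        exact Finset.sum_congr rfl fun _ _ => Finset.sum_congr rfl fun _ _ => by ring)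

theorem matForm_apply (Q : Fin 3 → Fin 3 → ℂ) (x y : Fin 3 → ℂ) :
    matForm Q x y = ∑ i, ∑ j, Q i j * x i * conj (y j) := rfl

/-- The Hermitian forms of the four normal forms. -/
noncomputable def normalHerm : Fin 4 → SesqForm 3 :=
  ![matForm ![![1, 0, 0], ![0, -1, 0], ![0, 0, 1]],
    matForm ![![-1, 0, 0], ![0, 1, 0], ![0, 0, 0]],
    matForm ![![0, 2 * (Real.sqrt 3 : ℝ), 0],
      ![2 * (Real.sqrt 3 : ℝ), 0, -2 * (Real.sqrt 3 : ℝ)], ![0, -2 * (Real.sqrt 3 : ℝ), 0]],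
    matForm ![![0, 0, 0], ![0, 0, 2 * (Real.sqrt 2 : ℝ) * I],
      ![0, -2 * (Real.sqrt 2 : ℝ) * I, 0]]]

theorem normalHerm_zero (Z W : Fin 3 → ℂ) :
    normalHerm 0 Z W = Z 0 * conj (W 0) - Z 1 * conj (W 1) + Z 2 * conj (W 2) := by
  simp [normalHerm, matForm_apply, Fin.sum_univ_three]; ring

theorem normalHerm_one (Z W : Fin 3 → ℂ) :
    normalHerm 1 Z W = -(Z 0 * conj (W 0)) + Z 1 * conj (W 1) := by
  simp [normalHerm, matForm_apply, Fin.sum_univ_three]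

theorem normalHerm_two (Z W : Fin 3 → ℂ) :
    normalHerm 2 Z W = 2 * (Real.sqrt 3 : ℝ) *
      ((Z 0 - Z 2) * conj (W 1) + Z 1 * (conj (W 0) - conj (W 2))) := by
  simp [normalHerm, matForm_apply, Fin.sum_univ_three]; ring

theorem normalHerm_three (Z W : Fin 3 → ℂ) :
    normalHerm 3 Z W = 2 * (Real.sqrt 2 : ℝ) * I * (Z 1 * conj (W 2) - Z 2 * conj (W 1)) := by
  simp [normalHerm, matForm_apply, Fin.sum_univ_three]; ring

/-- The three possibilities for the Hermitian quotient: it vanishes, has rank one, or is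
equivalent up to scale to one of the four normal forms. -/
def Classified (q : SesqForm 3) : Prop :=
  q = 0 ∨ (∃ (l : (Fin 3 → ℂ) →ₗ[ℂ] ℂ) (s : ℝ), l ≠ 0 ∧ s ≠ 0 ∧ ∀ Z W, q Z W = s * l Z * conj (l W)) ∨
  ∃ (k : Fin 4) (X : (Fin 3 → ℂ) →ₗ[ℂ] (Fin 3 → ℂ)) (s : ℝ), s ≠ 0 ∧
    (∀ Z W, J (X Z) (X W) = J Z W) ∧ ∀ Z W, q (X Z) (X W) = s * normalHerm k Z W

/-- The linear map with prescribed values on the standard basis. -/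
noncomputable def comb (u v w : Fin 3 → ℂ) : (Fin 3 → ℂ) →ₗ[ℂ] (Fin 3 → ℂ) :=
  Fintype.linearCombination ℂ ![u, v, w]

theorem comb_apply (u v w Z : Fin 3 → ℂ) : comb u v w Z = Z 0 • u + Z 1 • v + Z 2 • w := by
  simp [comb, Fintype.linearCombination_apply, Fin.sum_univ_three]

theorem surjective_of_J {X : (Fin 3 → ℂ) →ₗ[ℂ] (Fin 3 → ℂ)} (h : ∀ Z W, J (X Z) (X W) = J Z W) :
    Function.Surjective X := by
  have : Scales (sgn 2 3) (LinearMap.toMatrix' X) 1 := ⟨one_ne_zero, fun x y => by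
    rw [LinearMap.toMatrix'_mulVec, LinearMap.toMatrix'_mulVec]
    simpa using h x y⟩
  have := Matrix.mulVec_surjective_iff_isUnit.2 (this.isUnit (sgn_cases 2 3))
  intro y
  obtain ⟨x, hx⟩ := this y
  exact ⟨x, by rw [← hx, LinearMap.toMatrix'_mulVec]⟩

/-- A basis `e, g, f` in which `J` is `2 Re (p r̄) + |z|²`. -/
structure NullBasis (e g f : Fin 3 → ℂ) : Prop where
  ee : J e e = 0
  eg : J e g = 0
  ef : J e f = 1
  gg : J g g = 1
  gf : J g f = 0
  ff : J f f = 0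

namespace NullBasis

variable {e g f : Fin 3 → ℂ} (h : NullBasis e g f)
include h

theorem ge : J g e = 0 := by rw [← diagForm_isHerm (sgn 2 3) e g, h.eg, map_zero]
theorem fe : J f e = 1 := by rw [← diagForm_isHerm (sgn 2 3) e f, h.ef, map_one]
theorem fg : J f g = 0 := by rw [← diagForm_isHerm (sgn 2 3) g f, h.gf, map_zero]

theorem J_comb (p z r p' z' r' : ℂ) : J (p • e + z • g + r • f) (p' • e + z' • g + r' • f) =
    p * conj r' + r * conj p' + z * conj z' := by
  simp only [map_add, map_smul, LinearMap.add_apply, LinearMap.smul_apply, LinearMap.map_smulₛₗ,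
    smul_eq_mul, h.ee, h.eg, h.ef, h.gg, h.gf, h.ff, h.ge, h.fe, h.fg]
  ring

end NullBasis

section

variable {q : SesqForm 3} (hq : q.IsHerm) {e g f : Fin 3 → ℂ} {α β γ δ : ℂ}

include hq in
theorem q_comb (hee : q e e = 0) (heg : q e g = 0) (hef : q e f = α) (hgg : q g g = γ)
    (hgf : q g f = β) (hff : q f f = δ) (p z r p' z' r' : ℂ) :
    q (p • e + z • g + r • f) (p' • e + z' • g + r' • f) =
      α * p * conj r' + conj α * r * conj p' + γ * z * conj z' + β * z * conj r' +
        conj β * r * conj z' + δ * r * conj r' := by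
  have hge : q g e = 0 := by rw [← hq, heg, map_zero]
  have hfe : q f e = conj α := by rw [← hq, hef]
  have hfg : q f g = conj β := by rw [← hq, hgf]
  simp only [map_add, map_smul, LinearMap.add_apply, LinearMap.smul_apply, LinearMap.map_smulₛₗ,
    smul_eq_mul, hee, heg, hef, hgg, hgf, hff, hge, hfe, hfg]
  ring

/-- The isometry taking the standard null basis (in the first and third coordinates) to a given
one. -/
noncomputable def nullMap (e g f : Fin 3 → ℂ) : (Fin 3 → ℂ) →ₗ[ℂ] (Fin 3 → ℂ) :=
  comb ((1 / 2 : ℂ) • e + f) g ((1 / 2 : ℂ) • e - f)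

theorem nullMap_apply (e g f Z : Fin 3 → ℂ) :
    nullMap e g f Z = ((Z 0 + Z 2) / 2) • e + Z 1 • g + (Z 0 - Z 2) • f := by
  rw [nullMap, comb_apply]; module

theorem NullBasis.J_nullMap (h : NullBasis e g f) (Z W : Fin 3 → ℂ) :
    J (nullMap e g f Z) (nullMap e g f W) = J Z W := by
  rw [nullMap_apply, nullMap_apply, h.J_comb, J_apply]
  simp [conj_ofNat]; ring

/-- The same with the first two coordinates interchanged. -/
noncomputable def nullMap' (e g f : Fin 3 → ℂ) : (Fin 3 → ℂ) →ₗ[ℂ] (Fin 3 → ℂ) :=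
  comb g ((1 / 2 : ℂ) • e + f) ((1 / 2 : ℂ) • e - f)

theorem nullMap'_apply (e g f Z : Fin 3 → ℂ) :
    nullMap' e g f Z = ((Z 1 + Z 2) / 2) • e + Z 0 • g + (Z 1 - Z 2) • f := by
  rw [nullMap', comb_apply]; module

theorem NullBasis.J_nullMap' (h : NullBasis e g f) (Z W : Fin 3 → ℂ) :
    J (nullMap' e g f Z) (nullMap' e g f W) = J Z W := by
  rw [nullMap'_apply, nullMap'_apply, h.J_comb, J_apply]
  simp [conj_ofNat]; ring

include hq in
/-- Elimination of the `(g, f)` coefficient. -/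
theorem NullBasis.exists_gf_zero (h : NullBasis e g f) (hee : q e e = 0) (heg : q e g = 0)
    (hne : q e f ≠ q g g) : ∃ g' f', NullBasis e g' f' ∧ q e g' = 0 ∧ q e f' = q e f ∧
      q g' g' = q g g ∧ q g' f' = 0 := by
  have hge : q g e = 0 := by rw [← hq, heg, map_zero]
  set x := q g f / (q g g - q e f) with hx
  have hxe : x * (q g g - q e f) = q g f := div_mul_cancel₀ _ (sub_ne_zero.2 hne.symm)
  refine ⟨g + x • e, f + (-conj x) • g + (-(x * conj x) / 2) • e, ⟨h.ee, ?_, ?_, ?_, ?_, ?_⟩,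
    ?_, ?_, ?_, ?_⟩ <;>
  simp only [map_add, map_smul, LinearMap.add_apply, LinearMap.smul_apply, LinearMap.map_smulₛₗ,
    smul_eq_mul, h.ee, h.eg, h.ef, h.gg, h.gf, h.ff, h.ge, h.fe, h.fg, hee, heg, hge, map_neg,
    map_mul, map_div₀, conj_conj, conj_ofNat]
  all_goals try ring1
  linear_combination -hxe

include hq in
/-- Elimination of the `(f, f)` coefficient when the eigenvalue is not real. -/
theorem NullBasis.exists_ff_zero (h : NullBasis e g f) (hee : q e e = 0) (heg : q e g = 0)
    (hgf : q g f = 0) (hne : q e f - conj (q e f) ≠ 0) : ∃ f', NullBasis e g f' ∧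
      q e f' = q e f ∧ q g f' = 0 ∧ q f' f' = 0 := by
  have hge : q g e = 0 := by rw [← hq, heg, map_zero]
  have hfe : q f e = conj (q e f) := (hq e f).symm
  have hc : conj (q f f) = q f f := hq f f
  set y := - q f f / (q e f - conj (q e f)) with hy
  have hye : y * (q e f - conj (q e f)) = - q f f := div_mul_cancel₀ _ hne
  have hyc : conj y = - y := by
    rw [hy]
    simp only [map_div₀, map_neg, map_sub, conj_conj, hc]
    rw [← neg_sub (q e f), div_neg]
  refine ⟨f + y • e, ⟨h.ee, h.eg, ?_, h.gg, ?_, ?_⟩, ?_, ?_, ?_⟩ <;>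
  simp only [map_add, map_smul, LinearMap.add_apply, LinearMap.smul_apply, LinearMap.map_smulₛₗ,
    smul_eq_mul, h.ee, h.eg, h.ef, h.gg, h.gf, h.ff, h.ge, h.fe, h.fg, hee, heg, hge, hgf, hyc, hfe]
  all_goals try ring1
  linear_combination hye

include hq in
/-- Elimination of the `(f, f)` coefficient in the nilpotent case. -/
theorem NullBasis.exists_ff_zero' (h : NullBasis e g f) (hee : q e e = 0) (heg : q e g = 0)
    (hef : q e f = 0) (hgg : q g g = 0) (hne : q g f ≠ 0) : ∃ g' f', NullBasis e g' f' ∧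
      q e g' = 0 ∧ q e f' = 0 ∧ q g' g' = 0 ∧ q g' f' = q g f ∧ q f' f' = 0 := by
  have hge : q g e = 0 := by rw [← hq, heg, map_zero]
  have hfe : q f e = 0 := by rw [← hq, hef, map_zero]
  have hc : conj (q f f) = q f f := hq f f
  have hfg : q f g = conj (q g f) := (hq g f).symm
  set x := q f f / (2 * conj (q g f)) with hx
  have hne' : conj (q g f) ≠ 0 := by simpa using hne
  have hxe : x * conj (q g f) = q f f / 2 := by rw [hx]; field_simp
  have hxe' : conj x * q g f = q f f / 2 := by
    have := congrArg conj hxe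
    simpa [hc, conj_ofNat] using this
  refine ⟨g + x • e, f + (-conj x) • g + (-(x * conj x) / 2) • e, ⟨h.ee, ?_, ?_, ?_, ?_, ?_⟩,
    ?_, ?_, ?_, ?_, ?_⟩ <;>
  simp only [map_add, map_smul, LinearMap.add_apply, LinearMap.smul_apply, LinearMap.map_smulₛₗ,
    smul_eq_mul, h.ee, h.eg, h.ef, h.gg, h.gf, h.ff, h.ge, h.fe, h.fg, hee, heg, hge, map_neg,
    map_mul, map_div₀, conj_conj, conj_ofNat, hef, hfe, hgg, hfg]
  all_goals try ring1
  linear_combination -hxe - hxe'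

variable {F : Bil} (hs : ∀ Z W, F Z W = F W Z) (hG : ∀ a b c d, GramRel F q a b c d)

theorem GramRel.eq {a b c d : Fin 3 → ℂ} (h : GramRel F q a b c d) :
    K (F a b) (F c d) = (q a c * J b d + q a d * J b c + q b c * J a d + q b d * J a c) / 4 := by
  unfold GramRel at h; linear_combination h / 4

include hq hG in
theorem NullBasis.of_generic (h : NullBasis e g f) (hee : q e e = 0) (heg : q e g = 0)
    (h1 : q e f ≠ 0) (h2 : q e f + q g g ≠ 0) : q e f + conj (q e f) = 0 ∧ q g g = 0 := by
  have hge : q g e = 0 := by rw [← hq, heg, map_zero]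
  have hfe : q f e = conj (q e f) := (hq e f).symm
  have hi : ∀ a b : ℂ, a • F e e + b • F e g = 0 → a = 0 ∧ b = 0 := by
    intro a b hab
    have e1 : K (a • F e e + b • F e g) (F g f) = 0 := by rw [hab]; simp
    have e2 : K (a • F e e + b • F e g) (F f f) = 0 := by rw [hab]; simp
    simp only [map_add, map_smul, LinearMap.add_apply, LinearMap.smul_apply, smul_eq_mul,
      (hG _ _ _ _).eq, h.ee, h.eg, h.ef, h.gg, h.gf, h.ff, h.ge, h.fe, h.fg, hee, heg, hge] at e1 e2
    have hb : b = 0 := by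
      have : b * (q e f + q g g) = 0 := by linear_combination 4 * e1
      exact (mul_eq_zero.1 this).resolve_right h2
    subst hb
    have ha : a * q e f = 0 := by linear_combination e2
    exact ⟨(mul_eq_zero.1 ha).resolve_right h1, rfl⟩
  have k1 := K_eq_zero_of_perp (x := F e e) (y := F e g) (v := F e f)
    (by simp [(hG _ _ _ _).eq, h.ee, hee]) (by simp [(hG _ _ _ _).eq, h.ee, h.eg, hee, heg])
    (by simp [(hG _ _ _ _).eq, h.ee, h.eg, hee, heg, h.ge, hge]) hi
    (by simp [(hG _ _ _ _).eq, h.ee, hee]) (by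
      simp [(hG _ _ _ _).eq, h.ee, h.eg, h.fe, h.fg, hee, heg])
  have k2 := K_eq_zero_of_perp (x := F e e) (y := F e g) (v := F g g)
    (by simp [(hG _ _ _ _).eq, h.ee, hee]) (by simp [(hG _ _ _ _).eq, h.ee, h.eg, hee, heg])
    (by simp [(hG _ _ _ _).eq, h.ee, h.eg, hee, heg, h.ge, hge]) hi
    (by simp [(hG _ _ _ _).eq, h.ge, hge]) (by simp [(hG _ _ _ _).eq, h.ge, hge])
  simp only [(hG _ _ _ _).eq, h.ee, h.eg, h.ef, h.gg, h.gf, h.ff, h.ge, h.fe, h.fg, hee, heg, hge,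
    hfe] at k1 k2
  exact ⟨by linear_combination 4 * k1, by linear_combination k2⟩

include hq hG in
theorem NullBasis.ff_eq_zero (h : NullBasis e g f) (hee : q e e = 0) (heg : q e g = 0)
    (h1 : q e f ≠ 0) (h2 : q e f + q g g = 0) (hgf : q g f = 0) : q f f = 0 := by
  have hge : q g e = 0 := by rw [← hq, heg, map_zero]
  have hfe : q f e = conj (q e f) := (hq e f).symm
  have hfg : q f g = 0 := by rw [← hq, hgf, map_zero]
  have hgg : q g g = - q e f := by linear_combination h2
  have hcon : conj (q e f) = q e f := by
    have := hq g g
    rw [hgg, map_neg] at this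
    linear_combination -this
  obtain ⟨s, hs, hsc⟩ : ∃ s : ℂ, s * s = 2 ∧ conj s = s := ⟨((Real.sqrt 2 : ℝ) : ℂ), by
    rw [← ofReal_mul, Real.mul_self_sqrt (by norm_num)]; simp, conj_ofReal _⟩
  have hi : ∀ a b : ℂ, a • F e e + b • (F g g + s • F e f) = 0 → a = 0 ∧ b = 0 := by
    intro a b hab
    have e1 : K (a • F e e + b • (F g g + s • F e f)) (F g g) = 0 := by rw [hab]; simp
    have e2 : K (a • F e e + b • (F g g + s • F e f)) (F f f) = 0 := by rw [hab]; simp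
    simp only [map_add, map_smul, LinearMap.add_apply, LinearMap.smul_apply, smul_eq_mul,
      (hG _ _ _ _).eq, h.ee, h.eg, h.ef, h.gg, h.gf, h.ff, h.ge, h.fe, h.fg, hee, heg, hge,
      hgf, hgg] at e1 e2
    have hb : b * q e f = 0 := by linear_combination -e1
    have hb := (mul_eq_zero.1 hb).resolve_right h1
    subst hb
    have ha : a * q e f = 0 := by linear_combination e2
    exact ⟨(mul_eq_zero.1 ha).resolve_right h1, rfl⟩
  have k := K_eq_zero_of_perp (x := F e e) (y := F g g + s • F e f) (v := F g f)
    (by simp [(hG _ _ _ _).eq, h.ee, hee])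
    (by simp [(hG _ _ _ _).eq, h.ee, h.eg, hee, heg])
    (by
      simp only [map_add, map_smul, LinearMap.add_apply, LinearMap.smul_apply,
        LinearMap.map_smulₛₗ, smul_eq_mul, hsc, (hG _ _ _ _).eq, h.ee, h.eg, h.ef, h.gg, h.gf,
        h.ff, h.ge, h.fe, h.fg, hee, heg, hge, hgf, hgg, hfe, hfg, hcon]
      linear_combination (q e f / 2) * hs) hi
    (by simp [(hG _ _ _ _).eq, h.ge, hge]) (by
      simp [(hG _ _ _ _).eq, h.ge, hge, hgf, hfg, h.fg, h.gf, h.fe])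
  simp only [(hG _ _ _ _).eq, h.ee, h.eg, h.ef, h.gg, h.gf, h.ff, h.ge, h.fe, h.fg, hee, heg, hge,
    hfe, hgf, hfg] at k
  linear_combination 4 * k

include hq hG in
theorem NullBasis.ff_eq_zero_of_ef (h : NullBasis e g f) (hee : q e e = 0) (heg : q e g = 0)
    (hef : q e f = 0) (hgg : q g g ≠ 0) (hgf : q g f = 0) : q f f = 0 := by
  have hge : q g e = 0 := by rw [← hq, heg, map_zero]
  have hfe : q f e = 0 := by rw [← hq, hef, map_zero]
  by_contra hff
  have hi : ∀ a b : ℂ, a • F e f + b • F e g = 0 → a = 0 ∧ b = 0 := by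
    intro a b hab
    have e1 : K (a • F e f + b • F e g) (F g f) = 0 := by rw [hab]; simp
    have e2 : K (a • F e f + b • F e g) (F f f) = 0 := by rw [hab]; simp
    have hfg : q f g = 0 := by rw [← hq, hgf, map_zero]
    simp only [map_add, map_smul, LinearMap.add_apply, LinearMap.smul_apply, smul_eq_mul,
      (hG _ _ _ _).eq, h.ee, h.eg, h.ef, h.gg, h.gf, h.ff, h.ge, h.fe, h.fg, hee, heg, hge, hgf,
      hef, hfe, hfg] at e1 e2
    have hb : b * q g g = 0 := by linear_combination 4 * e1
    have hb := (mul_eq_zero.1 hb).resolve_right hgg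
    subst hb
    have ha : a * q f f = 0 := by linear_combination 2 * e2
    exact ⟨(mul_eq_zero.1 ha).resolve_right hff, rfl⟩
  have k := K_eq_zero_of_perp (x := F e f) (y := F e g) (v := F g g)
    (by simp [(hG _ _ _ _).eq, h.ee, hee, hef, hfe])
    (by simp [(hG _ _ _ _).eq, h.ee, h.eg, hee, heg, h.fg, h.fe, hef, hfe])
    (by simp [(hG _ _ _ _).eq, h.ee, h.eg, hee, heg, h.ge, hge]) hi
    (by simp [(hG _ _ _ _).eq, h.ge, hge, h.gf, hgf])
    (by simp [(hG _ _ _ _).eq, h.ge, hge])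
  simp only [(hG _ _ _ _).eq, h.gg] at k
  exact hgg (by linear_combination k)

end

theorem Classified.of_rank_one {q : SesqForm 3} {l : (Fin 3 → ℂ) →ₗ[ℂ] ℂ} {s : ℝ}
    (h : ∀ Z W, q Z W = s * l Z * conj (l W)) : Classified q := by
  by_cases hs : s = 0
  · exact .inl (LinearMap.ext fun Z => LinearMap.ext fun W => by simp [h, hs])
  by_cases hl : l = 0
  · exact .inl (LinearMap.ext fun Z => LinearMap.ext fun W => by simp [h, hl])
  exact .inr (.inl ⟨l, s, hl, hs, h⟩)

theorem Classified.of_isometry_rank_one {q : SesqForm 3} {X : (Fin 3 → ℂ) →ₗ[ℂ] (Fin 3 → ℂ)}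
    (hX : ∀ Z W, J (X Z) (X W) = J Z W) (u : Fin 3 → ℂ) {s : ℝ}
    (h : ∀ Z W, q (X Z) (X W) = s * J (X Z) u * conj (J (X W) u)) : Classified q := by
  refine .of_rank_one (l := J.flip u) (s := s) fun Z W => ?_
  obtain ⟨Z, rfl⟩ := surjective_of_J hX Z
  obtain ⟨W, rfl⟩ := surjective_of_J hX W
  rw [h]; rfl

section

variable {F : Bil} {q : SesqForm 3} (hq : q.IsHerm) (hG : ∀ a b c d, GramRel F q a b c d)

include hq hG in
theorem NullBasis.classified {e g f : Fin 3 → ℂ} (h : NullBasis e g f) (hee : q e e = 0)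
    (heg : q e g = 0) : Classified q := by
  have hgam := hq.self_im g
  have hdel := hq.self_im f
  by_cases hα : q e f = 0
  · by_cases hγ : q g g = 0
    · by_cases hβ : q g f = 0
      · refine .of_isometry_rank_one h.J_nullMap e (s := (q f f).re) fun Z W => ?_
        rw [nullMap_apply, nullMap_apply,
          q_comb hq hee heg hα hγ hβ rfl, hdel]
        simp [h.ee, h.ge, h.fe]
      · obtain ⟨g', f', h', h1, h2, h3, h4, h5⟩ := h.exists_ff_zero' hq hee heg hα hγ hβ
        set β := q g f with hβdef
        have hn : (‖β‖ : ℂ) ≠ 0 := by simpa using hβ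
        have hbb : β * conj β = (‖β‖ : ℂ) * ‖β‖ := by rw [mul_conj']; ring
        set t : ℂ := conj β / ‖β‖ with ht
        have htc : conj t = β / ‖β‖ := by rw [ht]; simp
        have htt : t * conj t = 1 := by
          rw [htc, ht, div_mul_div_comm, mul_comm (conj β), hbb, div_self (mul_ne_zero hn hn)]
        have htb : t * β = ‖β‖ := by
          rw [ht, div_mul_eq_mul_div, mul_comm (conj β), hbb, mul_div_assoc, div_self hn, mul_one]
        have hb : NullBasis e (t • g') f' := ⟨h'.ee, by simp [h'.eg], h'.ef, by
          simp [h'.gg, mul_comm, htt], by simp [h'.gf], h'.ff⟩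
        have hs3 : ((Real.sqrt 3 : ℝ) : ℂ) ≠ 0 := by simp
        refine .inr (.inr ⟨2, nullMap e (t • g') f', ‖β‖ / (2 * Real.sqrt 3),
          div_ne_zero (by simpa using hβ) (by positivity), hb.J_nullMap, fun Z W => ?_⟩)
        rw [nullMap_apply, nullMap_apply, q_comb hq hee (by simp [h1]) h2
          (γ := 0) (by simp [h3]) (β := ‖β‖) (by simp [h4, htb]) h5, normalHerm_two]
        push_cast
        simp only [map_zero, map_sub, conj_ofReal]
        field_simp
        ring
    · obtain ⟨g', f', h', h1, h2, h3, h4⟩ := h.exists_gf_zero hq hee heg (by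
        rw [hα]; exact Ne.symm hγ)
      rw [hα] at h2
      have h5 := h'.ff_eq_zero_of_ef hq hG hee h1 h2 (by rwa [h3]) h4
      refine .of_isometry_rank_one h'.J_nullMap g' (s := (q g g).re) fun Z W => ?_
      rw [nullMap_apply, nullMap_apply, q_comb hq hee h1 h2 h3 h4 h5, hgam]
      simp [h'.eg, h'.gg, h'.fg]
  · by_cases hαγ : q e f + q g g = 0
    · have hgg : q g g = - q e f := by linear_combination hαγ
      obtain ⟨g', f', h', h1, h2, h3, h4⟩ := h.exists_gf_zero hq hee heg (fun hc => by
        rw [← hc] at hαγ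
        exact hα (by linear_combination hαγ / 2))
      have h5 := h'.ff_eq_zero hq hG hee h1 (by rwa [h2]) (by rwa [h2, h3]) h4
      have hc : conj (q e f) = q e f := by
        have := hq g g
        rw [hgg, map_neg] at this
        linear_combination -this
      have hr : ((q e f).re : ℂ) = q e f := conj_eq_iff_re.1 hc
      refine .inr (.inr ⟨0, nullMap' e g' f', -(q e f).re, neg_ne_zero.2 fun h0 => hα (by
        rw [← hr, h0, ofReal_zero]), h'.J_nullMap', fun Z W => ?_⟩)
      rw [nullMap'_apply, nullMap'_apply, q_comb hq hee h1 h2 h3 h4 h5, normalHerm_zero, hgg, hc]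
      push_cast
      rw [hr]
      simp [conj_ofNat]
      ring
    · obtain ⟨hre, hγ⟩ := h.of_generic hq hG hee heg hα hαγ
      obtain ⟨g', f', h', h1, h2, h3, h4⟩ := h.exists_gf_zero hq hee heg (by rwa [hγ])
      have hne : q e f' - conj (q e f') ≠ 0 := fun h0 => hα (by
        rw [h2] at h0; linear_combination (h0 + hre) / 2)
      obtain ⟨f'', h'', k1, k2, k3⟩ := h'.exists_ff_zero hq hee h1 h4 hne
      have hre' : (q e f).re = 0 := by
        have := congrArg re hre
        simp at this
        linarith
      have hα' : q e f = (q e f).im * I := by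
        apply Complex.ext <;> simp [hre']
      have hs2 : ((Real.sqrt 2 : ℝ) : ℂ) ≠ 0 := by simp
      refine .inr (.inr ⟨3, nullMap' e g' f'', -(q e f).im / (2 * Real.sqrt 2),
        div_ne_zero (neg_ne_zero.2 fun h0 => hα (by rw [hα', h0]; simp)) (by positivity),
        h''.J_nullMap', fun Z W => ?_⟩)
      rw [nullMap'_apply, nullMap'_apply, q_comb hq hee h1 (k1.trans h2) (h3.trans hγ) k2 k3,
        normalHerm_three, show conj (q e f) = - q e f by linear_combination hre, hα']
      push_cast
      simp [conj_ofNat]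
      field_simp
      ring

include hq hG in
theorem classified_of_null_eigenvector {e : Fin 3 → ℂ} (he0 : e ≠ 0) (hJ : J e e = 0) {α : ℂ}
    (he : ∀ W, q e W = α * J e W) : Classified q := by
  have hc : (‖e 0‖ ^ 2 + ‖e 1‖ ^ 2 - ‖e 2‖ ^ 2 : ℝ) = 0 := by
    rw [J_self] at hJ; exact_mod_cast hJ
  have h2 : e 2 ≠ 0 := by
    intro h2
    rw [h2] at hc
    simp only [norm_zero] at hc
    have h0 : e 0 = 0 := by
      have : ‖e 0‖ ^ 2 = 0 := by nlinarith [sq_nonneg ‖e 0‖, sq_nonneg ‖e 1‖]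
      simpa using this
    have h1 : e 1 = 0 := by
      have : ‖e 1‖ ^ 2 = 0 := by nlinarith [sq_nonneg ‖e 0‖, sq_nonneg ‖e 1‖]
      simpa using this
    exact he0 (by funext i; fin_cases i <;> assumption)
  obtain ⟨a, ha⟩ : ∃ a, a = e 0 / e 2 := ⟨_, rfl⟩
  obtain ⟨b, hb⟩ : ∃ b, b = e 1 / e 2 := ⟨_, rfl⟩
  have hab : (e 2)⁻¹ • e = ![a, b, 1] := by
    funext i
    fin_cases i <;> simp [ha, hb, h2, div_eq_inv_mul]
  have heig : ∀ W, q ![a, b, 1] W = α * J ![a, b, 1] W := fun W => by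
    rw [← hab, map_smul, map_smul, LinearMap.smul_apply, LinearMap.smul_apply, he]
    simp only [smul_eq_mul]; ring
  have hJab : J ![a, b, 1] ![a, b, 1] = 0 := by
    simp [← hab, hJ]
  have hn : a * conj a + b * conj b = 1 := by
    rw [J_apply] at hJab
    simp at hJab
    linear_combination hJab
  have hN : NullBasis ![a, b, 1] ![-conj b, conj a, 0] ![a / 2, b / 2, -1 / 2] := by
    refine ⟨hJab, ?_, ?_, ?_, ?_, ?_⟩ <;> rw [J_apply] <;> simp [conj_ofNat] <;>
    [ring; linear_combination hn / 2; linear_combination hn; ring; linear_combination hn / 4]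
  exact hN.classified hq hG (by rw [heig, hN.ee, mul_zero]) (by rw [heig, hN.eg, mul_zero])

theorem sign_pattern {a b c : ℝ} {u : Fin 6 → ℝ} 
    (hu : u = ![a, b, c, a + b, -(a + c), -(b + c)])
    (hp : ∀ i j k, i ≠ j → i ≠ k → j ≠ k → ¬ (0 < u i ∧ 0 < u j ∧ 0 < u k))
    (hn : ∀ i j k, i ≠ j → i ≠ k → j ≠ k → ¬ (u i < 0 ∧ u j < 0 ∧ u k < 0))
    (hac : a ≠ c) (hbc : b ≠ c) : (c = 0 ∧ a + b = 0) ∨ (a = 0 ∧ b = 0) := by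
  have p1 := hp 0 1 2 (by decide) (by decide) (by decide)
  have p2 := hp 0 2 3 (by decide) (by decide) (by decide)
  have p3 := hp 1 2 3 (by decide) (by decide) (by decide)
  have p4 := hp 1 4 5 (by decide) (by decide) (by decide)
  have p5 := hp 1 3 4 (by decide) (by decide) (by decide)
  have p6 := hp 0 4 5 (by decide) (by decide) (by decide)
  have p7 := hp 0 3 5 (by decide) (by decide) (by decide)
  have p8 := hp 0 1 3 (by decide) (by decide) (by decide)
  have p9 := hp 0 2 5 (by decide) (by decide) (by decide)
  have p10 := hp 1 2 4 (by decide) (by decide) (by decide)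
  have n9 := hn 0 2 5 (by decide) (by decide) (by decide)
  have n10 := hn 1 2 4 (by decide) (by decide) (by decide)
  have n1 := hn 0 1 2 (by decide) (by decide) (by decide)
  have n2 := hn 0 2 3 (by decide) (by decide) (by decide)
  have n3 := hn 1 2 3 (by decide) (by decide) (by decide)
  have n4 := hn 1 4 5 (by decide) (by decide) (by decide)
  have n5 := hn 1 3 4 (by decide) (by decide) (by decide)
  have n6 := hn 0 4 5 (by decide) (by decide) (by decide)
  have n7 := hn 0 3 5 (by decide) (by decide) (by decide)
  have n8 := hn 0 1 3 (by decide) (by decide) (by decide)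
  clear hp hn
  subst hu
  simp only [Matrix.cons_val] at *
  rcases lt_trichotomy c 0 with hc | hc | hc <;> rcases lt_trichotomy a 0 with ha | ha | ha <;>
    rcases lt_trichotomy b 0 with hb | hb | hb <;>
    rcases lt_trichotomy (a + b) 0 with hu | hu | hu <;> grind

/-- Eigenvectors of `q` relative to `J`. -/
def IsEig (q : SesqForm 3) (v : Fin 3 → ℂ) (a : ℂ) : Prop := v ≠ 0 ∧ ∀ W, q v W = a * J v W

include hG in
theorem classified_of_orthogonal {v : Fin 3 → Fin 3 → ℂ} {a : Fin 3 → ℝ}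
    (hJ : ∀ i j, J (v i) (v j) = if i = j then s3 i else 0)
    (hv : ∀ i W, q (v i) W = a i * J (v i) W) (h02 : a 0 ≠ a 2) (h12 : a 1 ≠ a 2) :
    Classified q := by
  have hqv : ∀ i j, q (v i) (v j) = if i = j then a i * s3 i else 0 := fun i j => by
    rw [hv, hJ]; split_ifs <;> simp
  have e0 : s3 0 = 1 := by simp [s3, sgn]
  have e1 : s3 1 = 1 := by simp [s3, sgn]
  have e2 : s3 2 = -1 := by simp [s3, sgn]
  set x : Fin 6 → Fin 4 → ℂ := ![F (v 0) (v 0), F (v 1) (v 1), F (v 2) (v 2),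
    (2 : ℂ) • F (v 0) (v 1), (2 : ℂ) • F (v 0) (v 2), (2 : ℂ) • F (v 1) (v 2)] with hx
  set u : Fin 6 → ℝ := ![a 0, a 1, a 2, a 0 + a 1, -(a 0 + a 2), -(a 1 + a 2)] with hu
  have hxx : ∀ i, K (x i) (x i) = u i := by
    intro i
    fin_cases i <;> simp [hx, hu, (hG _ _ _ _).eq, hJ, hqv, e0, e1, e2, conj_ofNat] <;> ring
  have hxy : ∀ i j, i ≠ j → K (x i) (x j) = 0 := by
    intro i j hij
    fin_cases i <;> fin_cases j <;> first
      | exact absurd rfl hij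
      | simp [hx, (hG _ _ _ _).eq, hJ, hqv, conj_ofNat]
  have hinj : ∀ {i j k : Fin 6}, i ≠ j → i ≠ k → j ≠ k → ∀ l m : Fin 3, l ≠ m →
      K (x (![i, j, k] l)) (x (![i, j, k] m)) = 0 := by
    intro i j k hij hik hjk l m hlm
    apply hxy
    fin_cases l <;> fin_cases m <;> first
      | exact absurd rfl hlm
      | assumption
      | (apply Ne.symm; assumption)
  have key := sign_pattern hu
    (fun i j k hij hik hjk hpos => K_three_pos (x := fun l => x (![i, j, k] l))
      (a := fun l => u (![i, j, k] l)) (hinj hij hik hjk) (fun l => hxx _) (fun l => by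
        fin_cases l <;> simp [hpos]))
    (fun i j k hij hik hjk hpos => K_three_neg (x := fun l => x (![i, j, k] l))
      (a := fun l => u (![i, j, k] l)) (hinj hij hik hjk) (fun l => hxx _) (fun l => by
        fin_cases l <;> simp [hpos])) h02 h12
  have hXJ : ∀ Z W, J (comb (v 0) (v 1) (v 2) Z) (comb (v 0) (v 1) (v 2) W) = J Z W := by
    intro Z W
    simp only [comb_apply, map_add, map_smul, LinearMap.add_apply, LinearMap.smul_apply,
      LinearMap.map_smulₛₗ, smul_eq_mul, hJ]
    rw [J_apply]
    simp [e0, e1, e2]; ring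
  have hXq : ∀ Z W, q (comb (v 0) (v 1) (v 2) Z) (comb (v 0) (v 1) (v 2) W) =
      a 0 * Z 0 * conj (W 0) + a 1 * Z 1 * conj (W 1) - a 2 * Z 2 * conj (W 2) := by
    intro Z W
    simp only [comb_apply, map_add, map_smul, LinearMap.add_apply, LinearMap.smul_apply,
      LinearMap.map_smulₛₗ, smul_eq_mul, hqv]
    simp [e0, e1, e2]; ring
  rcases key with ⟨h2, h01⟩ | ⟨h0, h1⟩
  · refine .inr (.inr ⟨1, _, -a 0, neg_ne_zero.2 (h2 ▸ h02), hXJ, fun Z W => ?_⟩)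
    rw [hXq, normalHerm_one, h2, show a 1 = - a 0 by linarith]
    push_cast; ring
  · refine .of_isometry_rank_one hXJ (v 2) (s := -a 2) fun Z W => ?_
    rw [hXq, h0, h1]
    simp [comb_apply, hJ, e2]

end

/-- The endomorphism representing `q` with respect to `J`. -/
noncomputable def repOp (q : SesqForm 3) : (Fin 3 → ℂ) →ₗ[ℂ] (Fin 3 → ℂ) :=
  LinearMap.pi fun i => s3 i • q.flip (E i)

theorem J_repOp (q : SesqForm 3) (Z W : Fin 3 → ℂ) : J (repOp q Z) W = q Z W := by
  have h : J (repOp q Z) = q Z := by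
    refine (Pi.basisFun ℂ (Fin 3)).ext fun j => ?_
    rw [Pi.basisFun_apply, diagForm_apply, Finset.sum_eq_single j]
    · simp [repOp]
      rw [← mul_assoc]
      have := s3_sq j
      rw [this, one_mul]
    · intro k _ hk; simp [hk]
    · simp
  rw [h]

theorem J_nondeg {x : Fin 3 → ℂ} (h : ∀ W, J x W = 0) : x = 0 := by
  funext i
  have := h (E i)
  rw [diagForm_apply, Finset.sum_eq_single i] at this
  · have hi := s3_sq i
    have h0 : s3 i ≠ 0 := fun h0 => by simp [h0] at hi
    simpa [h0] using this
  · intro k _ hk; simp [hk]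
  · simp

section

variable {F : Bil} {q : SesqForm 3} (hq : q.IsHerm) (hG : ∀ a b c d, GramRel F q a b c d)

include hq in
/-- Orthogonally to at most two eigenvectors there is a further one. -/
theorem exists_eig_perp {m : ℕ} (hm : m < 3) (w : Fin m → Fin 3 → ℂ) (b : Fin m → ℂ)
    (hw : ∀ i, IsEig q (w i) (b i)) : ∃ v a, IsEig q v a ∧ ∀ i, J v (w i) = 0 := by
  set L : (Fin 3 → ℂ) →ₗ[ℂ] (Fin m → ℂ) := LinearMap.pi fun i => J.flip (w i) with hL
  have hLx : ∀ x, x ∈ LinearMap.ker L ↔ ∀ i, J x (w i) = 0 := fun x => by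
    rw [LinearMap.mem_ker, funext_iff]; rfl
  have hker : LinearMap.ker L ≠ ⊥ := LinearMap.ker_ne_bot_of_finrank_lt (by simpa using hm)
  have hinv : ∀ x ∈ LinearMap.ker L, repOp q x ∈ LinearMap.ker L := by
    intro x hx
    rw [hLx] at hx ⊢
    intro i
    rw [J_repOp, ← hq, (hw i).2, ← diagForm_isHerm (sgn 2 3), hx]
    simp
  have : Nontrivial (LinearMap.ker L) := Submodule.nontrivial_iff_ne_bot.2 hker
  obtain ⟨a, ha⟩ := Module.End.exists_eigenvalue ((repOp q).restrict hinv)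
  obtain ⟨v, hv⟩ := ha.exists_hasEigenvector
  have h1 := congrArg Subtype.val hv.apply_eq_smul
  refine ⟨v, a, ⟨fun h => hv.2 (Subtype.ext h), fun W => ?_⟩, (hLx v).1 v.2⟩
  rw [← J_repOp]
  have h1' : repOp q v = a • (v : Fin 3 → ℂ) := h1
  rw [h1']; simp

include hq in
theorem IsEig.normalize {v : Fin 3 → ℂ} {a : ℂ} (h : IsEig q v a) (hv : J v v ≠ 0) :
    ∃ (c : ℂ) (r s : ℝ), IsEig q (c • v) r ∧ (s = 1 ∨ s = -1) ∧ J (c • v) (c • v) = s := by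
  have hvr := (diagForm_isHerm (sgn 2 3)).self_im v
  set t := (J v v).re with ht
  have ht0 : t ≠ 0 := fun h0 => hv (by rw [← hvr, h0, ofReal_zero])
  have har : conj a = a := by
    have := hq v v
    rw [h.2, map_mul, diagForm_isHerm (sgn 2 3)] at this
    exact mul_right_cancel₀ hv this
  have hsq : Real.sqrt |t| ≠ 0 := by
    rw [Real.sqrt_ne_zero']; exact abs_pos.2 ht0
  refine ⟨((Real.sqrt |t|)⁻¹ : ℝ), a.re, t / |t|, ⟨smul_ne_zero (by simpa using hsq) h.1,
    fun W => ?_⟩, ?_, ?_⟩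
  · rw [conj_eq_iff_re.1 har]
    simp only [map_smul, LinearMap.smul_apply, smul_eq_mul, h.2]; ring
  · rcases lt_or_gt_of_ne ht0 with h | h
    · right; rw [abs_of_neg h, div_neg, div_self ht0]
    · left; rw [abs_of_pos h, div_self ht0]
  · simp only [map_smul, LinearMap.smul_apply, LinearMap.map_smulₛₗ, smul_eq_mul, conj_ofReal]
    rw [← hvr]
    norm_cast
    have : Real.sqrt |t| * Real.sqrt |t| = |t| := Real.mul_self_sqrt (abs_nonneg t)
    rw [← mul_assoc, ← mul_inv, this, div_eq_inv_mul]

theorem exists_perm_signs {v : Fin 3 → Fin 3 → ℂ} {s : Fin 3 → ℝ} (hs : ∀ i, s i = 1 ∨ s i = -1)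
    (hv : ∀ i j, i ≠ j → J (v i) (v j) = 0) (hvv : ∀ i, J (v i) (v i) = s i) :
    ∃ σ : Equiv.Perm (Fin 3), s (σ 0) = 1 ∧ s (σ 1) = 1 ∧ s (σ 2) = -1 := by
  have two : ∀ i j, i ≠ j → s i = -1 → s j = 1 := by
    intro i j hij hi
    refine (hs j).resolve_right fun hj => ?_
    exact J_two_neg (hv i j hij) (hvv i) (hvv j) (by rw [hi]; norm_num) (by rw [hj]; norm_num)
  have three : ∃ i, s i = -1 := by
    by_contra! hc
    exact J_three_pos hv hvv fun i => by rw [(hs i).resolve_right (hc i)]; norm_num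
  obtain ⟨i, hi⟩ := three
  have h0 : ∀ i : Fin 3, i ≠ Equiv.swap i 2 0 := by decide
  have h1 : ∀ i : Fin 3, i ≠ Equiv.swap i 2 1 := by decide
  exact ⟨Equiv.swap i 2, two i _ (h0 i) hi, two i _ (h1 i) hi, by simpa using hi⟩

include hq hG in
theorem classified : Classified q := by
  by_cases hnull : ∃ v a, IsEig q v a ∧ J v v = 0
  · obtain ⟨v, a, hv, h0⟩ := hnull
    exact classified_of_null_eigenvector hq hG hv.1 h0 hv.2
  have hnn : ∀ {v a}, IsEig q v a → J v v ≠ 0 := fun hv h0 => hnull ⟨_, _, hv, h0⟩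
  obtain ⟨v₁, a₁, h₁, -⟩ := exists_eig_perp hq (m := 0) (by norm_num) ![] ![] (fun i => i.elim0)
  obtain ⟨v₂, a₂, h₂, h₂₁⟩ := exists_eig_perp hq (m := 1) (by norm_num) ![v₁] ![a₁] (fun i => by
    fin_cases i; exact h₁)
  obtain ⟨v₃, a₃, h₃, h₃₁⟩ := exists_eig_perp hq (m := 2) (by norm_num) ![v₁, v₂] ![a₁, a₂]
    (fun i => by fin_cases i; exacts [h₁, h₂])
  have o21 : J v₂ v₁ = 0 := h₂₁ 0
  have o31 : J v₃ v₁ = 0 := h₃₁ 0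
  have o32 : J v₃ v₂ = 0 := h₃₁ 1
  have o12 : J v₁ v₂ = 0 := by rw [← diagForm_isHerm (sgn 2 3), o21, map_zero]
  have o13 : J v₁ v₃ = 0 := by rw [← diagForm_isHerm (sgn 2 3), o31, map_zero]
  have o23 : J v₂ v₃ = 0 := by rw [← diagForm_isHerm (sgn 2 3), o32, map_zero]
  obtain ⟨c₁, r₁, s₁, e₁, hs₁, k₁⟩ := h₁.normalize hq (hnn h₁)
  obtain ⟨c₂, r₂, s₂, e₂, hs₂, k₂⟩ := h₂.normalize hq (hnn h₂)
  obtain ⟨c₃, r₃, s₃, e₃, hs₃, k₃⟩ := h₃.normalize hq (hnn h₃)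
  obtain ⟨v, hv⟩ : ∃ v : Fin 3 → Fin 3 → ℂ, v = ![c₁ • v₁, c₂ • v₂, c₃ • v₃] := ⟨_, rfl⟩
  obtain ⟨r, hr⟩ : ∃ r : Fin 3 → ℝ, r = ![r₁, r₂, r₃] := ⟨_, rfl⟩
  obtain ⟨s, hs⟩ : ∃ s : Fin 3 → ℝ, s = ![s₁, s₂, s₃] := ⟨_, rfl⟩
  have hvs : ∀ i, J (v i) (v i) = s i := by
    intro i; rw [hv, hs]; fin_cases i <;> assumption
  have hvo : ∀ i j, i ≠ j → J (v i) (v j) = 0 := by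
    intro i j hij
    rw [hv]
    fin_cases i <;> fin_cases j <;> first
      | exact absurd rfl hij
      | simp [o12, o13, o21, o23, o31, o32]
  have hve : ∀ i, IsEig q (v i) (r i) := by
    intro i; rw [hv, hr]; fin_cases i <;> assumption
  have hss : ∀ i, s i = 1 ∨ s i = -1 := by
    intro i; rw [hs]; fin_cases i <;> assumption
  obtain ⟨σ, hσ0, hσ1, hσ2⟩ := exists_perm_signs hss hvo hvs
  have ne : ∀ i j, s i = 1 → s j = -1 → r i ≠ r j := by
    intro i j hi hj hij
    have hne : i ≠ j := by rintro rfl; rw [hi] at hj; norm_num at hj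
    have hsum : IsEig q (v i + v j) (r i) := by
      refine ⟨fun h0 => ?_, fun W => ?_⟩
      · have : J (v i + v j) (v i) = 0 := by rw [h0]; simp
        rw [map_add, LinearMap.add_apply, hvs, hvo _ _ hne.symm, hi] at this
        simp at this
      · rw [map_add, map_add, LinearMap.add_apply, LinearMap.add_apply, (hve i).2, (hve j).2, hij]
        ring
    refine hnn hsum ?_
    simp [hvs, hvo _ _ hne, hvo _ _ hne.symm, hi, hj]
  refine classified_of_orthogonal hG (v := fun i => v (σ i)) (a := fun i => r (σ i)) ?_
    (fun i => (hve _).2) (ne _ _ hσ0 hσ2) (ne _ _ hσ1 hσ2)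
  intro i j
  by_cases hij : i = j
  · subst hij
    rw [if_pos rfl, hvs]
    fin_cases i <;> simp [hσ0, hσ1, hσ2, s3, sgn]
  · rw [if_neg hij]
    exact hvo _ _ (fun h => hij (σ.injective h))

end

/-- The symmetric bilinear map whose quadratic components have the coefficients `a` with respect to
the monomials `z², w², t², zw, zt, wt`. -/
noncomputable def symBil (a : Fin 4 → Fin 6 → ℂ) : Bil :=
  LinearMap.mk₂ ℂ (fun Z W i => a i 0 * (Z 0 * W 0) + a i 1 * (Z 1 * W 1) + a i 2 * (Z 2 * W 2) +
    a i 3 / 2 * (Z 0 * W 1 + Z 1 * W 0) + a i 4 / 2 * (Z 0 * W 2 + Z 2 * W 0) +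
    a i 5 / 2 * (Z 1 * W 2 + Z 2 * W 1))
    (by intros; funext i; simp only [Pi.add_apply]; ring)
    (by intros; funext i; simp only [Pi.smul_apply, smul_eq_mul]; ring)
    (by intros; funext i; simp only [Pi.add_apply]; ring)
    (by intros; funext i; simp only [Pi.smul_apply, smul_eq_mul]; ring)

theorem symBil_apply (a : Fin 4 → Fin 6 → ℂ) (Z W : Fin 3 → ℂ) (i : Fin 4) :
    symBil a Z W i = a i 0 * (Z 0 * W 0) + a i 1 * (Z 1 * W 1) + a i 2 * (Z 2 * W 2) +
    a i 3 / 2 * (Z 0 * W 1 + Z 1 * W 0) + a i 4 / 2 * (Z 0 * W 2 + Z 2 * W 0) +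
    a i 5 / 2 * (Z 1 * W 2 + Z 2 * W 1) := rfl

theorem symBil_symm (a : Fin 4 → Fin 6 → ℂ) (Z W : Fin 3 → ℂ) : symBil a Z W = symBil a W Z := by
  funext i; rw [symBil_apply, symBil_apply]; ring

theorem symBil_span {a : Fin 4 → Fin 6 → ℂ} (h : ∀ y : Fin 4 → ℂ, ∃ τ : Fin 6 → ℂ, ∀ i,
    a i 0 * τ 0 + a i 1 * τ 1 + a i 2 * τ 2 + a i 3 * τ 3 + a i 4 * τ 4 + a i 5 * τ 5 = y i)
    (y : Fin 4 → ℂ) : ∃ t : Fin 3 × Fin 3 → ℂ, ∑ p, t p • symBil a (E p.1) (E p.2) = y := by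
  obtain ⟨τ, hτ⟩ := h y
  refine ⟨fun p => ![![τ 0, τ 3, τ 4], ![τ 3, τ 1, τ 5], ![τ 4, τ 5, τ 2]] p.1 p.2, ?_⟩
  funext i
  rw [← hτ i]
  simp [Fintype.sum_prod_type, Fin.sum_univ_three, symBil_apply]
  ring

/-- The homogenizations of the four normal forms. -/
noncomputable def normalBil : Fin 4 → Bil :=
  ![symBil ![![1, 0, 0, 0, 0, 0], ![0, 0, 0, 0, 0, (Real.sqrt 2 : ℝ)], ![0, 1, 0, 0, 0, 0],
      ![0, 0, 1, 0, 0, 0]],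
    symBil ![![0, 0, 0, 0, 1, 0], ![0, 1, 0, 0, 0, 0], ![0, 0, 0, 0, 0, 1], ![1, 0, 0, 0, 0, 0]],
    symBil ![![1, 1, 0, (Real.sqrt 3 : ℝ), -1, 0], ![0, 1, -1, 0, 1, -(Real.sqrt 3 : ℝ)],
      ![1, 1, 0, -(Real.sqrt 3 : ℝ), -1, 0], ![0, 1, -1, 0, 1, (Real.sqrt 3 : ℝ)]],
    symBil ![![0, 0, 0, ((2 : ℝ) ^ (1 / 4 : ℝ) : ℝ), -((2 : ℝ) ^ (1 / 4 : ℝ) : ℝ) * I, 0],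
      ![0, 1, 1, 0, 0, -(Real.sqrt 2 : ℝ) * I],
      ![0, 0, 0, ((2 : ℝ) ^ (1 / 4 : ℝ) : ℝ), ((2 : ℝ) ^ (1 / 4 : ℝ) : ℝ) * I, 0],
      ![0, 1, 1, 0, 0, (Real.sqrt 2 : ℝ) * I]]]

theorem normalBil_symm (k : Fin 4) (Z W : Fin 3 → ℂ) : normalBil k Z W = normalBil k W Z := by
  fin_cases k <;> exact symBil_symm _ _ _

theorem snoc_eq (n : Fin 3 → ℂ) (d : ℂ) : Fin.snoc (α := fun _ => ℂ) n d = ![n 0, n 1, n 2, d] := by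
  funext i; fin_cases i <;> rfl

theorem normalBil_lift (k : Fin 4) : Lift (RatMap.normalForm k) (normalBil k) := by
  refine ⟨normalBil_symm k, fun z => ?_⟩
  rw [snoc_eq, affLift_two]
  fin_cases k <;> funext i <;> fin_cases i <;>
    simp [normalBil, RatMap.normalForm, RatMap.map1, RatMap.map2, RatMap.map3, RatMap.map4,
      symBil_apply] <;> ring

theorem gramRel_of_diag {F : Bil} (hs : ∀ Z W, F Z W = F W Z) {q : SesqForm 3}
    (h : ∀ Z W, K (F Z Z) (F W W) = q Z W * J Z W) (a b c d : Fin 3 → ℂ) : GramRel F q a b c d := by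
  have h1 := h (a + b) (c + d)
  have h2 := h (a + b) (c - d)
  have h3 := h (a - b) (c + d)
  have h4 := h (a - b) (c - d)
  simp only [map_add, map_sub, LinearMap.add_apply, LinearMap.sub_apply, hs b a, hs d c]
    at h1 h2 h3 h4
  unfold GramRel
  linear_combination (h1 - h2 - h3 + h4) / 4

theorem fourth_root_sq : (((2 : ℝ) ^ (1 / 4 : ℝ) : ℝ) : ℂ) * (((2 : ℝ) ^ (1 / 4 : ℝ) : ℝ) : ℂ) =
    (Real.sqrt 2 : ℝ) := by
  rw [← ofReal_mul, ← Real.rpow_add (by norm_num), Real.sqrt_eq_rpow]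
  norm_num

theorem fourth_root_ne_zero : (((2 : ℝ) ^ (1 / 4 : ℝ) : ℝ) : ℂ) ≠ 0 := by
  rw [ofReal_ne_zero]; positivity

theorem sqrt_two_sq : ((Real.sqrt 2 : ℝ) : ℂ) * ((Real.sqrt 2 : ℝ) : ℂ) = 2 := by
  rw [← ofReal_mul, Real.mul_self_sqrt (by norm_num)]; simp

theorem normalBil_gramRel (k : Fin 4) (a b c d : Fin 3 → ℂ) :
    GramRel (normalBil k) (normalHerm k) a b c d := by
  refine gramRel_of_diag (normalBil_symm k) (fun Z W => ?_) a b c d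
  fin_cases k
  · change _ = normalHerm 0 Z W * _
    rw [normalHerm_zero, J_apply, K_apply]
    simp only [normalBil, symBil_apply, Matrix.cons_val, map_add, map_mul, map_sub, map_neg, map_zero, map_one,
      map_div₀, conj_ofReal, conj_ofNat, Fin.zero_eta]
    linear_combination Z 1 * Z 2 * conj (W 1) * conj (W 2) * sqrt_two_sq
  · change _ = normalHerm 1 Z W * _
    rw [normalHerm_one, J_apply, K_apply]
    simp only [normalBil, symBil_apply, Matrix.cons_val, map_add, map_mul, map_sub, map_neg, map_zero, map_one,
      map_div₀, conj_ofReal, conj_ofNat, Fin.mk_one]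
    ring
  · change _ = normalHerm 2 Z W * _
    rw [normalHerm_two, J_apply, K_apply]
    simp only [normalBil, symBil_apply, Matrix.cons_val, map_add, map_mul, map_sub, map_neg, map_zero, map_one,
      map_div₀, conj_ofReal, conj_ofNat, Fin.reduceFinMk]
    ring
  · change _ = normalHerm 3 Z W * _
    rw [normalHerm_three, J_apply, K_apply]
    simp only [normalBil, symBil_apply, Matrix.cons_val, map_add, map_mul, map_sub, map_neg, map_zero, map_one,
      map_div₀, conj_ofReal, conj_ofNat, Fin.reduceFinMk, conj_I]
    linear_combination 2 * I * Z 0 * conj (W 0) * (Z 1 * conj (W 2) - Z 2 * conj (W 1)) *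
      fourth_root_sq

theorem normalBil_span (k : Fin 4) (y : Fin 4 → ℂ) :
    ∃ t : Fin 3 × Fin 3 → ℂ, ∑ p, t p • normalBil k (E p.1) (E p.2) = y := by
  have h2 : ((Real.sqrt 2 : ℝ) : ℂ) ≠ 0 := by simp
  have h3 : ((Real.sqrt 3 : ℝ) : ℂ) ≠ 0 := by simp
  have h4 := fourth_root_ne_zero
  fin_cases k
  · refine symBil_span (fun y => ⟨![y 0, y 2, y 3, 0, 0, y 1 / (Real.sqrt 2 : ℝ)], fun i => ?_⟩) y
    fin_cases i <;> simp [mul_div_cancel₀, h2]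
  · refine symBil_span (fun y => ⟨![y 3, y 1, 0, 0, y 0, y 2], fun i => ?_⟩) y
    fin_cases i <;> simp
  · refine symBil_span (fun y => ⟨![(y 0 + y 2) / 2, 0, -(y 1 + y 3) / 2,
      (y 0 - y 2) / (2 * (Real.sqrt 3 : ℝ)), 0, (y 3 - y 1) / (2 * (Real.sqrt 3 : ℝ))],
      fun i => ?_⟩) y
    fin_cases i <;> simp <;> field_simp <;> ring
  · generalize hκ : (((2 : ℝ) ^ (1 / 4 : ℝ) : ℝ) : ℂ) = κ at h4
    have hI : I * I = -1 := I_mul_I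
    refine symBil_span (fun y => ⟨![0, (y 1 + y 3) / 2, 0, (y 0 + y 2) / (2 * κ),
      -I * (y 2 - y 0) / (2 * κ), -I * (y 3 - y 1) / (2 * (Real.sqrt 2 : ℝ))],
      fun i => ?_⟩) y
    fin_cases i <;> simp only [Matrix.cons_val, Fin.zero_eta, Fin.mk_one, Fin.reduceFinMk, hκ] <;>
      field_simp <;> simp only [I_sq] <;> ring

theorem qEquiv_normalForm {f : RatMap 2 3} {F : Bil} (hf : Lift f F) {q : SesqForm 3}
    (hq : ∀ a b c d, GramRel F q a b c d) {k : Fin 4} {X : (Fin 3 → ℂ) →ₗ[ℂ] (Fin 3 → ℂ)} {s : ℝ}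
    (hs : s ≠ 0) (hJ : ∀ Z W, J (X Z) (X W) = J Z W)
    (hX : ∀ Z W, q (X Z) (X W) = s * normalHerm k Z W) :
    RatMap.QEquiv 2 0 2 1 f (RatMap.normalForm k) :=
  qEquiv_of_forms hf (normalBil_lift k) hq (normalBil_gramRel k) X one_ne_zero hs
    (fun Z W => by rw [hJ]; simp) hX (normalBil_span k)

/-- A totally isotropic family in `ℂ^{2,2}` lies in the graph of a unitary map. -/
theorem exists_unitary_graph {ι : Type*} {y : ι → Fin 4 → ℂ} (h : ∀ i j, K (y i) (y j) = 0)
    {i₀ : ι} (h₀ : y i₀ 3 ≠ 0) : ∃ a b c d : ℂ, a * conj a + c * conj c = 1 ∧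
      b * conj b + d * conj d = 1 ∧ a * conj b + c * conj d = 0 ∧
      ∀ i, y i 2 = a * y i 0 + b * y i 1 ∧ y i 3 = c * y i 0 + d * y i 1 := by
  simp only [K_apply] at h
  obtain ⟨u, hu⟩ : ∃ u, u = y i₀ := ⟨_, rfl⟩
  set n := u 2 * conj (u 2) + u 3 * conj (u 3) with hn
  have hn' : u 0 * conj (u 0) + u 1 * conj (u 1) = n := by
    have := h i₀ i₀; rw [← hu] at this; linear_combination this
  have hnc : conj n = n := by rw [hn]; simp only [map_add, map_mul, conj_conj]; ring
  have hn0 : n ≠ 0 := by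
    rw [← hu] at h₀
    rw [hn, mul_conj', mul_conj']
    have : 0 < ‖u 3‖ := norm_pos_iff.2 h₀
    have h2 : 0 < ‖u 2‖ ^ 2 + ‖u 3‖ ^ 2 := by positivity
    exact_mod_cast h2.ne'
  have hA : ∀ i, y i 0 * conj (u 0) + y i 1 * conj (u 1) =
      y i 2 * conj (u 2) + y i 3 * conj (u 3) := fun i => by
    have := h i i₀; rw [← hu] at this; linear_combination this
  have hA' : ∀ i, u 0 * conj (y i 0) + u 1 * conj (y i 1) =
      u 2 * conj (y i 2) + u 3 * conj (y i 3) := fun i => by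
    have := h i₀ i; rw [← hu] at this; linear_combination this
  obtain ⟨B, hB⟩ : ∃ B : ι → ℂ, ∀ i, B i = y i 1 * u 0 - y i 0 * u 1 := ⟨_, fun _ => rfl⟩
  obtain ⟨B', hB'⟩ : ∃ B' : ι → ℂ, ∀ i, B' i = y i 3 * u 2 - y i 2 * u 3 := ⟨_, fun _ => rfl⟩
  have hBB : ∀ i j, B i * conj (B j) = B' i * conj (B' j) := fun i j => by
    simp only [hB, hB', map_sub, map_mul]
    linear_combination (y i 0 * conj (y j 0) + y i 1 * conj (y j 1)) * hn' + n * h i j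
      - (u 0 * conj (y j 0) + u 1 * conj (y j 1)) * hA i
      - (y i 2 * conj (u 2) + y i 3 * conj (u 3)) * hA' j
  obtain ⟨ω, hω, hωB⟩ : ∃ ω : ℂ, ω * conj ω = 1 ∧ ∀ i, B' i = ω * B i := by
    by_cases hz : ∀ i, B i = 0
    · refine ⟨1, by simp, fun i => ?_⟩
      have := hBB i i
      rw [hz, zero_mul, eq_comm, mul_conj'] at this
      have : B' i = 0 := by simpa using this
      rw [this, hz, mul_zero]
    · push Not at hz
      obtain ⟨j, hj⟩ := hz
      have hj' : B' j ≠ 0 := fun h0 => by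
        have := hBB j j
        rw [h0, zero_mul, mul_conj'] at this
        exact hj (by simpa using this)
      have hcj : conj (B j) ≠ 0 := by simpa using hj
      have hcj' : conj (B' j) ≠ 0 := by simpa using hj'
      refine ⟨conj (B j) / conj (B' j), ?_, fun i => ?_⟩
      · rw [map_div₀, conj_conj, conj_conj, div_mul_div_comm, div_eq_one_iff_eq
          (mul_ne_zero hcj' hj')]
        linear_combination hBB j j
      · rw [div_mul_eq_mul_div, eq_div_iff hcj']
        linear_combination - hBB i j
  refine ⟨(conj (u 0) * u 2 + ω * u 1 * conj (u 3)) / n, (conj (u 1) * u 2 - ω * u 0 * conj (u 3)) / n,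
    (conj (u 0) * u 3 - ω * u 1 * conj (u 2)) / n, (conj (u 1) * u 3 + ω * u 0 * conj (u 2)) / n,
    ?_, ?_, ?_, fun i => ⟨?_, ?_⟩⟩
  · simp only [map_div₀, map_add, map_sub, map_mul, conj_conj, hnc]
    field_simp
    linear_combination (u 1 * conj (u 1) * n) * hω + n * hn' -
      (u 0 * conj (u 0) + ω * conj ω * u 1 * conj (u 1)) * hn
  · simp only [map_div₀, map_add, map_sub, map_mul, conj_conj, hnc]
    field_simp
    linear_combination (u 0 * conj (u 0) * n) * hω + n * hn' -
      (u 1 * conj (u 1) + ω * conj ω * u 0 * conj (u 0)) * hn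
  · simp only [map_div₀, map_add, map_sub, map_mul, conj_conj, hnc]
    field_simp
    linear_combination (- u 1 * conj (u 0) * n) * hω -
      (u 1 * conj (u 0) - ω * conj ω * u 1 * conj (u 0)) * hn
  · rw [div_mul_eq_mul_div, div_mul_eq_mul_div, ← add_div, eq_div_iff hn0]
    have := hωB i
    rw [hB, hB'] at this
    linear_combination y i 2 * hn - u 2 * hA i - conj (u 3) * this
  · rw [div_mul_eq_mul_div, div_mul_eq_mul_div, ← add_div, eq_div_iff hn0]
    have := hωB i
    rw [hB, hB'] at this
    linear_combination y i 3 * hn - u 3 * hA i + conj (u 2) * this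

theorem qEquiv_oneGG_of_isotropic {f : RatMap 2 3} {F : Bil} (hf : Lift f F)
    (h : ∀ Z W, K (F Z Z) (F W W) = 0) :
    ∃ (p q : MvPolynomial (Fin 2) ℂ) (hq : q ≠ 0), RatMap.QEquiv 2 0 2 1 f (RatMap.oneGG p q hq) := by
  obtain ⟨z₀, hz₀⟩ := hf.exists_ne
  obtain ⟨a, b, c, d, h1, h2, h3, hy⟩ := exists_unitary_graph (y := fun Z => F Z Z)
    (fun Z W => h Z W) (i₀ := affLift z₀) hz₀
  have h3' : b * conj a + d * conj c = 0 := by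
    have := congrArg conj h3
    simp only [map_add, map_mul, conj_conj, map_zero] at this
    linear_combination this
  have hX : Scales (sgn 2 3) 1 1 := ⟨one_ne_zero, fun x y => by simp⟩
  have hval : ∀ z, F (affLift z) (affLift z) = ![MvPolynomial.eval z (f.num 0),
      MvPolynomial.eval z (f.num 1), MvPolynomial.eval z (f.num 2), MvPolynomial.eval z f.den] :=
    fun z => by rw [hf.val, snoc_eq]
  by_cases h0 : f.num 0 = 0
  · by_cases h1' : f.num 1 = 0
    · exfalso
      have := (hy (affLift z₀)).2
      rw [hval] at this hz₀
      simp [h0, h1'] at this hz₀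
      exact hz₀ this
    · set P : (Fin 4 → ℂ) →ₗ[ℂ] (Fin 4 → ℂ) :=
        Matrix.mulVecLin !![0, 1, 0, 0; 1, 0, 0, 0; 1, 0, 0, 0; 0, 1, 0, 0] with hP
      have hPv : ∀ y, P y = ![y 1, y 0, y 0, y 1] := fun y => by
        funext i
        fin_cases i <;> simp [hP, Matrix.mulVec, dotProduct, Fin.sum_univ_four]
      have hG : Lift (RatMap.oneGG (f.num 0) (f.num 1) h1') (F.compr₂ P) := by
        refine ⟨fun Z W => by simp [hf.symm Z W], fun z => ?_⟩
        rw [snoc_eq, LinearMap.compr₂_apply, hPv, hval]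
        simp [RatMap.oneGG]
      have hTv : ∀ y, (!![0, 1, 0, 0; 1, 0, 0, 0; 0, 0, a, b; 0, 0, c, d] :
          Matrix (Fin 4) (Fin 4) ℂ).mulVec y =
          ![y 1, y 0, a * y 2 + b * y 3, c * y 2 + d * y 3] := fun y => by
        funext i
        fin_cases i <;> simp [Matrix.mulVec, dotProduct, Fin.sum_univ_four]
      refine ⟨_, _, h1', qEquiv_of_linear hf hG hX
        (T := !![0, 1, 0, 0; 1, 0, 0, 0; 0, 0, a, b; 0, 0, c, d]) (s := 1)
        ⟨one_ne_zero, fun x y => ?_⟩ fun Z => ?_⟩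
      · rw [hTv, hTv]
        change K _ _ = _ * K _ _
        simp only [K_apply, Matrix.cons_val, map_add, map_mul, ofReal_one]
        linear_combination (-x 2 * conj (y 2)) * h1 - x 3 * conj (y 3) * h2
          - x 2 * conj (y 3) * h3 - x 3 * conj (y 2) * h3'
      · rw [Matrix.one_mulVec, LinearMap.compr₂_apply, hPv, hTv]
        funext i
        fin_cases i <;> simp [hy Z]
  · set P : (Fin 4 → ℂ) →ₗ[ℂ] (Fin 4 → ℂ) :=
      Matrix.mulVecLin !![1, 0, 0, 0; 0, 1, 0, 0; 0, 1, 0, 0; 1, 0, 0, 0] with hP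
    have hPv : ∀ y, P y = ![y 0, y 1, y 1, y 0] := fun y => by
      funext i
      fin_cases i <;> simp [hP, Matrix.mulVec, dotProduct, Fin.sum_univ_four]
    have hG : Lift (RatMap.oneGG (f.num 1) (f.num 0) h0) (F.compr₂ P) := by
      refine ⟨fun Z W => by simp [hf.symm Z W], fun z => ?_⟩
      rw [snoc_eq, LinearMap.compr₂_apply, hPv, hval]
      simp [RatMap.oneGG]
    have hTv : ∀ y, (!![1, 0, 0, 0; 0, 1, 0, 0; 0, 0, b, a; 0, 0, d, c] :
        Matrix (Fin 4) (Fin 4) ℂ).mulVec y =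
        ![y 0, y 1, b * y 2 + a * y 3, d * y 2 + c * y 3] := fun y => by
      funext i
      fin_cases i <;> simp [Matrix.mulVec, dotProduct, Fin.sum_univ_four]
    refine ⟨_, _, h0, qEquiv_of_linear hf hG hX
      (T := !![1, 0, 0, 0; 0, 1, 0, 0; 0, 0, b, a; 0, 0, d, c]) (s := 1)
      ⟨one_ne_zero, fun x y => ?_⟩ fun Z => ?_⟩
    · rw [hTv, hTv]
      change K _ _ = _ * K _ _
      simp only [K_apply, Matrix.cons_val, map_add, map_mul, ofReal_one]
      linear_combination (-x 3 * conj (y 3)) * h1 - x 2 * conj (y 2) * h2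
        - x 3 * conj (y 2) * h3 - x 2 * conj (y 3) * h3'
    · rw [Matrix.one_mulVec, LinearMap.compr₂_apply, hPv, hTv]
      funext i
      fin_cases i <;> simp [hy Z, add_comm]

theorem bil_eq_zero_of_rank_one {F : Bil} {q : SesqForm 3} (hG : ∀ a b c d, GramRel F q a b c d)
    {l : (Fin 3 → ℂ) →ₗ[ℂ] ℂ} {s : ℝ} (hl : l ≠ 0) (hs : s ≠ 0)
    (hq : ∀ Z W, q Z W = s * l Z * conj (l W)) {Z : Fin 3 → ℂ} (hZ : l Z = 0) : F Z Z = 0 := by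
  obtain ⟨v, hv⟩ : ∃ v, l v ≠ 0 := by
    by_contra! hc
    exact hl (LinearMap.ext hc)
  obtain ⟨u, hu⟩ : ∃ u, l u = 1 := ⟨(l v)⁻¹ • v, by simp [hv]⟩
  set w : (Fin 3 → ℂ) → Fin 4 → ℂ := fun a => (2 : ℂ) • F u a - l a • F u u with hw
  have hww : ∀ a b, K (w a) (w b) = s * J a b := by
    intro a b
    simp only [hw, map_sub, map_smul, LinearMap.sub_apply, LinearMap.smul_apply,
      LinearMap.map_smulₛₗ, smul_eq_mul, (hG _ _ _ _).eq, hq, hu, map_one, conj_ofNat]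
    ring
  have hZw : ∀ a, K (F Z Z) (w a) = 0 := by
    intro a
    simp only [hw, map_sub, LinearMap.map_smulₛₗ, smul_eq_mul, (hG _ _ _ _).eq, hq, hZ]
    ring
  have hZZ : K (F Z Z) (F Z Z) = 0 := by
    simp only [(hG _ _ _ _).eq, hq, hZ]; ring
  have j0 : J (E 0) (E 0) = 1 := by rw [J_E]; simp [s3, sgn]
  have j1 : J (E 1) (E 1) = 1 := by rw [J_E]; simp [s3, sgn]
  have j01 : J (E 0) (E 1) = 0 := by rw [J_E]; simp
  rcases lt_or_gt_of_ne hs with hs | hs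
  · exact eq_zero_of_perp_neg hs hs (by rw [hww, j0, mul_one]) (by rw [hww, j1, mul_one])
      (by rw [hww, j01, mul_zero]) (hZw (E 0)) (hZw (E 1)) hZZ
  · exact eq_zero_of_perp_pos hs hs (by rw [hww, j0, mul_one]) (by rw [hww, j1, mul_one])
      (by rw [hww, j01, mul_zero]) (hZw (E 0)) (hZw (E 1)) hZZ

theorem totalDegree_affine_le (a b c : ℂ) : (MvPolynomial.C a + MvPolynomial.C b * MvPolynomial.X 0 +
    MvPolynomial.C c * MvPolynomial.X 1 : MvPolynomial (Fin 2) ℂ).totalDegree ≤ 1 := by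
  have h : ∀ (c : ℂ) (i : Fin 2), (MvPolynomial.C c * MvPolynomial.X i :
      MvPolynomial (Fin 2) ℂ).totalDegree ≤ 1 := fun c i =>
    (MvPolynomial.totalDegree_mul _ _).trans (by simp)
  refine (MvPolynomial.totalDegree_add _ _).trans (max_le ?_ (h c 1))
  exact (MvPolynomial.totalDegree_add _ _).trans (max_le (by simp) (h b 0))

theorem affLift_isPolyFun (i : Fin 3) : IsPolyFun (fun z : Fin 2 → ℂ => affLift z i) := by
  simp only [affLift_two]
  fin_cases i
  exacts [.coord 0, .coord 1, .const 1]

/-- A homogenization cannot vanish on a plane. -/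
theorem not_vanish_on_plane {f : RatMap 2 3} (hred : f.InLowestTerms) (hdeg : f.degree = 2)
    {F : Bil} (hf : Lift f F) {l : (Fin 3 → ℂ) →ₗ[ℂ] ℂ} (hl : l ≠ 0)
    (h : ∀ Z, l Z = 0 → F Z Z = 0) : False := by
  have hlv : ∀ Z, l Z = Z 0 * l (E 0) + Z 1 * l (E 1) + Z 2 * l (E 2) := fun Z => by
    have : Z = Z 0 • E 0 + Z 1 • E 1 + Z 2 • E 2 := by
      funext i; fin_cases i <;> simp
    conv_lhs => rw [this]
    simp
  have hnum : ∀ (i : Fin 3) z, MvPolynomial.eval z (f.num i) =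
      F (affLift z) (affLift z) i.castSucc := fun i z => by rw [hf.val, Fin.snoc_castSucc]
  have hden : ∀ z, MvPolynomial.eval z f.den = F (affLift z) (affLift z) (Fin.last 3) := fun z => by
    rw [hf.val, Fin.snoc_last]
  by_cases h01 : l (E 0) = 0 ∧ l (E 1) = 0
  · obtain ⟨h0, h1⟩ := h01
    have haff : ∀ z i, F (affLift z) (affLift z) i = F (E 2) (E 2) i +
        2 * F (E 0) (E 2) i * z 0 + 2 * F (E 1) (E 2) i * z 1 := by
      intro z i
      have e : affLift z = (z 0 • E 0 + z 1 • E 1) + E 2 := by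
        rw [affLift_two]; funext i; fin_cases i <;> simp
      have hz := h (z 0 • E 0 + z 1 • E 1) (by simp [h0, h1])
      have hexp : ∀ x y, F (x + y) (x + y) = F x x + (2 : ℂ) • F x y + F y y := fun x y => by
        simp only [map_add, LinearMap.add_apply, hf.symm y x]; module
      rw [e, hexp, hz]
      simp
      ring
    have hle : ∀ (p : MvPolynomial (Fin 2) ℂ) (i : Fin 4),
        (∀ z, MvPolynomial.eval z p = F (affLift z) (affLift z) i) → p.totalDegree ≤ 1 := by
      intro p i hp
      have : p = MvPolynomial.C (F (E 2) (E 2) i) +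
          MvPolynomial.C (2 * F (E 0) (E 2) i) * MvPolynomial.X 0 +
          MvPolynomial.C (2 * F (E 1) (E 2) i) * MvPolynomial.X 1 :=
        MvPolynomial.funext fun z => by rw [hp, haff]; simp
      rw [this]
      exact totalDegree_affine_le _ _ _
    have : f.degree ≤ 1 := max_le (Finset.sup_le fun i _ => hle _ _ (hnum i)) (hle _ _ hden)
    omega
  · obtain ⟨v, hv⟩ : ∃ v, l v ≠ 0 := by
      by_contra! hc
      exact hl (LinearMap.ext hc)
    obtain ⟨u, hu⟩ : ∃ u, l u = 1 := ⟨(l v)⁻¹ • v, by simp [hv]⟩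
    have hfac : ∀ Z, F Z Z = l Z • ((2 : ℂ) • F Z u - l Z • F u u) := by
      intro Z
      have h0 := h (Z - l Z • u) (by simp [hu])
      simp only [map_sub, map_smul, LinearMap.sub_apply, LinearMap.smul_apply, hf.symm u Z] at h0
      rw [← sub_eq_zero, ← h0]
      module
    set L : MvPolynomial (Fin 2) ℂ := MvPolynomial.C (l (E 2)) +
      MvPolynomial.C (l (E 0)) * MvPolynomial.X 0 + MvPolynomial.C (l (E 1)) * MvPolynomial.X 1
      with hL
    have hLz : ∀ z, MvPolynomial.eval z L = l (affLift z) := fun z => by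
      rw [hlv, affLift_two]; simp [hL]; ring
    have hdvd : ∀ (p : MvPolynomial (Fin 2) ℂ) (i : Fin 4),
        (∀ z, MvPolynomial.eval z p = F (affLift z) (affLift z) i) → L ∣ p := by
      intro p i hp
      obtain ⟨m, hm⟩ : IsPolyFun (fun z : Fin 2 → ℂ => 2 * F (affLift z) u i -
          MvPolynomial.eval z L * F u u i) :=
        ((IsPolyFun.const 2).mul (.bil F affLift_isPolyFun (fun i => .const (u i)) i)).sub
          (IsPolyFun.mul ⟨L, fun _ => rfl⟩ (.const _))
      refine ⟨m, MvPolynomial.funext fun z => ?_⟩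
      rw [hp, map_mul, hm]
      simp only [hLz]
      rw [hfac]
      simp
    obtain ⟨m, hm⟩ := isUnit_iff_exists_inv.1 (hred L (fun i => hdvd _ _ (hnum i)) (hdvd _ _ hden))
    obtain ⟨z, hz⟩ : ∃ z, MvPolynomial.eval z L = 0 := by
      by_cases h0 : l (E 0) = 0
      · have h1 : l (E 1) ≠ 0 := fun h1 => h01 ⟨h0, h1⟩
        exact ⟨![0, -l (E 2) / l (E 1)], by simp [hL, mul_div_cancel₀, h1]⟩
      · exact ⟨![-l (E 2) / l (E 0), 0], by simp [hL, mul_div_cancel₀, h0]⟩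
    have := congrArg (MvPolynomial.eval z) hm
    rw [map_mul, hz, zero_mul, map_one] at this
    exact zero_ne_one this

/-- If two quadratic forms satisfy `h θ = x² h'`, where `θ` is coprime to `x`, then `h` is a multiple
of `x²`. -/
theorem quadratic_eq_of_dvd {h h' : (Fin 3 → ℂ) →ₗ[ℂ] (Fin 3 → ℂ) →ₗ[ℂ] ℂ}
    (hs : ∀ Z W, h Z W = h W Z) (hs' : ∀ Z W, h' Z W = h' W Z) {b₀ b₁ b₂ : Fin 3 → ℂ} {θ : ℂ → ℂ}
    (h1 : θ 1 ≠ 0) (h2 : θ (-1) ≠ 0) (h3 : θ 2 ≠ 0)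
    (hθ : ∀ x u : ℂ, h (x • b₀ + (b₁ + u • b₂)) (x • b₀ + (b₁ + u • b₂)) * θ u =
      x ^ 2 * h' (x • b₀ + (b₁ + u • b₂)) (x • b₀ + (b₁ + u • b₂))) (x y u : ℂ) :
    h (x • b₀ + y • b₁ + u • b₂) (x • b₀ + y • b₁ + u • b₂) = h b₀ b₀ * x ^ 2 := by
  have key : ∀ u, θ u ≠ 0 → h (b₁ + u • b₂) (b₁ + u • b₂) = 0 ∧ h b₀ (b₁ + u • b₂) = 0 := by
    intro u hu
    have hx := fun x => hθ x u
    generalize b₁ + u • b₂ = m at hx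
    simp only [map_add, map_smul, LinearMap.add_apply, LinearMap.smul_apply, smul_eq_mul,
      hs m b₀, hs' m b₀] at hx
    have k0 := hx 0
    have e1 := hx 1
    have e2 := hx (-1)
    have e3 := hx 2
    have e4 := hx (-2)
    refine ⟨(mul_eq_zero.1 (by linear_combination k0 : h m m * θ u = 0)).resolve_right hu,
      (mul_eq_zero.1 (?_ : h b₀ m * θ u = 0)).resolve_right hu⟩
    linear_combination (8 * (e1 - e2) - (e3 - e4)) / 24
  obtain ⟨a1, c1⟩ := key 1 h1
  obtain ⟨a2, c2⟩ := key (-1) h2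
  obtain ⟨a3, -⟩ := key 2 h3
  simp only [map_add, map_smul, LinearMap.add_apply, LinearMap.smul_apply, smul_eq_mul,
      hs b₂ b₁, hs b₁ b₀, hs b₂ b₀] at a1 a2 a3 c1 c2 ⊢
  have k22 : h b₂ b₂ = 0 := by linear_combination a3 / 3 - a1 / 2 + a2 / 6
  have k12 : h b₁ b₂ = 0 := by linear_combination (a1 - a2) / 4
  have k11 : h b₁ b₁ = 0 := by linear_combination (a1 + a2) / 2 - k22
  have k01 : h b₀ b₁ = 0 := by linear_combination (c1 + c2) / 2
  have k02 : h b₀ b₂ = 0 := by linear_combination (c1 - c2) / 2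
  rw [k22, k12, k11, k01, k02]; ring

/-- Two quadratic maps with proportional values are proportional, if two combinations of the
components of one of them are coprime. -/
theorem proportional_of_coprime {L G : Bil} (hL : ∀ Z W, L Z W = L W Z)
    (hG : ∀ Z W, G Z W = G W Z)
    (hp : ∀ φ ψ : (Fin 4 → ℂ) →ₗ[ℂ] ℂ, ∀ Z, φ (L Z Z) * ψ (G Z Z) = φ (G Z Z) * ψ (L Z Z))
    (l : Fin 3 → (Fin 3 → ℂ) →ₗ[ℂ] ℂ) {b₀ b₁ b₂ : Fin 3 → ℂ}
    (hl : ∀ Z, Z = l 0 Z • b₀ + l 1 Z • b₁ + l 2 Z • b₂) (hb : l 0 b₀ = 1)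
    (φ ψ : (Fin 4 → ℂ) →ₗ[ℂ] ℂ) {θ : ℂ → ℂ} (h1 : θ 1 ≠ 0) (h2 : θ (-1) ≠ 0) (h3 : θ 2 ≠ 0)
    (hφ : ∀ x y u : ℂ, φ (G (x • b₀ + y • b₁ + u • b₂) (x • b₀ + y • b₁ + u • b₂)) = x ^ 2)
    (hψ : ∀ x u : ℂ, ψ (G (x • b₀ + (b₁ + u • b₂)) (x • b₀ + (b₁ + u • b₂))) = θ u) :
    ∃ c : ℂ, ∀ Z, L Z Z = c • G Z Z := by
  have hq := quadratic_eq_of_dvd (h := L.compr₂ φ) (h' := L.compr₂ ψ) (b₀ := b₀) (b₁ := b₁)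
    (b₂ := b₂) (fun Z W => by simp [hL Z W]) (fun Z W => by simp [hL Z W]) h1 h2 h3
    (fun x u => by
      have a := hp φ ψ (x • b₀ + (b₁ + u • b₂))
      have b := hφ x 1 u
      rw [one_smul, add_assoc] at b
      rw [hψ, b] at a
      exact a)
  refine ⟨φ (L b₀ b₀), fun Z => ?_⟩
  rw [← sub_eq_zero]
  refine bil_eq_zero_of_off_plane (h := L - φ (L b₀ b₀) • G) (fun Z W => by
    simp [hL Z W, hG Z W]) (l 0) (u := b₀) (by rw [hb]; exact one_ne_zero) (fun Z hZ => ?_) Z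
  have e1 : φ (L Z Z) = φ (L b₀ b₀) * l 0 Z ^ 2 := by
    have := hq (l 0 Z) (l 1 Z) (l 2 Z)
    rw [← hl] at this
    exact this
  have e2 : φ (G Z Z) = l 0 Z ^ 2 := by
    have := hφ (l 0 Z) (l 1 Z) (l 2 Z)
    rwa [← hl] at this
  funext i
  have := hp φ (LinearMap.proj i) Z
  rw [e1, e2] at this
  simp only [LinearMap.proj_apply] at this
  have h0 : l 0 Z ^ 2 * (L Z Z i - φ (L b₀ b₀) * G Z Z i) = 0 := by linear_combination -this
  simpa using (mul_eq_zero.1 h0).resolve_left (pow_ne_zero 2 hZ)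

theorem normalBil_proportional (k : Fin 4) {L : Bil} (hL : ∀ Z W, L Z W = L W Z)
    (hp : ∀ φ ψ : (Fin 4 → ℂ) →ₗ[ℂ] ℂ, ∀ Z, φ (L Z Z) * ψ (normalBil k Z Z) =
      φ (normalBil k Z Z) * ψ (L Z Z)) : ∃ c : ℂ, ∀ Z, L Z Z = c • normalBil k Z Z := by
  have h2 : ((Real.sqrt 2 : ℝ) : ℂ) ≠ 0 := by simp
  have h3 : ((Real.sqrt 3 : ℝ) : ℂ) ≠ 0 := by simp
  let x : Fin 3 → ((Fin 3 → ℂ) →ₗ[ℂ] ℂ) := fun i => LinearMap.proj (R := ℂ) (φ := fun _ => ℂ) i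
  let y : Fin 4 → ((Fin 4 → ℂ) →ₗ[ℂ] ℂ) := fun i => LinearMap.proj (R := ℂ) (φ := fun _ => ℂ) i
  have hx : ∀ i Z, x i Z = Z i := fun _ _ => rfl
  have hy : ∀ i Z, y i Z = Z i := fun _ _ => rfl
  fin_cases k
  · refine proportional_of_coprime hL (normalBil_symm 0) hp x (b₀ := E 0) (b₁ := E 1) (b₂ := E 2)
      (fun Z => ?_) (by simp [hx]) (y 0) (y 2) (θ := fun _ => 1) one_ne_zero one_ne_zero
      one_ne_zero (fun a b c => ?_) (fun a c => ?_)
    · funext i; fin_cases i <;> simp [hx]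
    · simp [hy, normalBil, symBil_apply]; ring
    · simp [hy, normalBil, symBil_apply]
  · refine proportional_of_coprime hL (normalBil_symm 1) hp x (b₀ := E 0) (b₁ := E 1) (b₂ := E 2)
      (fun Z => ?_) (by simp [hx]) (y 3) (y 1) (θ := fun _ => 1) one_ne_zero one_ne_zero
      one_ne_zero (fun a b c => ?_) (fun a c => ?_)
    · funext i; fin_cases i <;> simp [hx]
    · simp [hy, normalBil, symBil_apply]; ring
    · simp [hy, normalBil, symBil_apply]
  · refine proportional_of_coprime hL (normalBil_symm 2) hp
      ![x 0 - x 2, x 1, (1 / 2 : ℂ) • (x 0 + x 2)]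
      (b₀ := ![1 / 2, 0, -1 / 2]) (b₁ := ![0, 1, 0]) (b₂ := ![1, 0, 1])
      (fun Z => ?_) (by simp [hx]; ring) ((1 / 2 : ℂ) • (y 0 + y 2 - y 1 - y 3))
      ((1 / (2 * (Real.sqrt 3 : ℝ)) : ℂ) • (y 0 - y 2 + y 3 - y 1)) (θ := fun u => 2 * u)
      (by norm_num) (by norm_num)
      (by norm_num) (fun a b c => ?_) (fun a c => ?_)
    · funext i; fin_cases i <;> simp [hx] <;> ring
    · simp [hy, normalBil, symBil_apply]; ring
    · simp [hy, normalBil, symBil_apply]; field_simp; ring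
  · have hI : I * I = -1 := I_mul_I
    refine proportional_of_coprime hL (normalBil_symm 3) hp
      ![x 1 - x 2, x 1 + x 2, x 0]
      (b₀ := ![0, 1 / 2, -1 / 2]) (b₁ := ![0, 1 / 2, 1 / 2]) (b₂ := ![1, 0, 0])
      (fun Z => ?_) (by simp [hx]; ring)
      ((1 / 2 : ℂ) • (y 1 + y 3) - (-I / ((Real.sqrt 2 : ℝ))) • (y 3 - y 1))
      ((1 / 2 : ℂ) • (y 1 + y 3) + (-I / ((Real.sqrt 2 : ℝ))) • (y 3 - y 1)) (θ := fun _ => 1)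
      one_ne_zero one_ne_zero one_ne_zero (fun a b c => ?_) (fun a c => ?_)
    · funext i; fin_cases i <;> simp [hx] <;> ring
    · simp [hy, normalBil, symBil_apply]; field_simp; simp only [I_sq]; ring
    · simp [hy, normalBil, symBil_apply]; field_simp; simp only [I_sq]; ring

theorem isPolyFun_mulVec (X : Matrix (Fin 3) (Fin 3) ℂ) (i : Fin 3) :
    IsPolyFun (fun Z : Fin 3 → ℂ => X.mulVec Z i) := by
  simp only [Matrix.mulVec, dotProduct]
  exact .sum _ fun j => (IsPolyFun.const _).mul (.coord j)

/-- A Q-equivalence to a normal form comes from an equality of homogenizations. -/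
theorem exists_scalar_of_qEquiv {f : RatMap 2 3} {F : Bil} (hf : Lift f F) {k : Fin 4}
    {X : Matrix (Fin 3) (Fin 3) ℂ} {T : Matrix (Fin 4) (Fin 4) ℂ} (hX : IsUnit X) (hT : IsUnit T)
    (h : ∀ z : Fin 2 → ℂ, X.mulVec (affLift z) 2 ≠ 0 → linFrac X z ∈ f.dom →
      z ∈ (RatMap.normalForm k).dom → ∃ r : ℂ, r ≠ 0 ∧
        T.mulVec (affLift ((RatMap.normalForm k).eval z)) = r • affLift (f.eval (linFrac X z))) :
    ∃ c : ℂ, c ≠ 0 ∧ ∀ Z, F (X.mulVec Z) (X.mulVec Z) = c • T.mulVec (normalBil k Z Z) := by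
  have hg := normalBil_lift k
  have hgs := normalBil_symm k
  set G := normalBil k
  set g := RatMap.normalForm k
  have hdT : IsUnit T.det := (Matrix.isUnit_iff_isUnit_det T).1 hT
  have hTT : ∀ y, T.mulVec (T⁻¹.mulVec y) = y := fun y => by
    rw [Matrix.mulVec_mulVec, Matrix.mul_nonsing_inv _ hdT, Matrix.one_mulVec]
  have hTT' : ∀ y, T⁻¹.mulVec (T.mulVec y) = y := fun y => by
    rw [Matrix.mulVec_mulVec, Matrix.nonsing_inv_mul _ hdT, Matrix.one_mulVec]
  set L : Bil := (F.compl₁₂ X.mulVecLin X.mulVecLin).compr₂ T⁻¹.mulVecLin with hL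
  have hLv : ∀ Z W, L Z W = T⁻¹.mulVec (F (X.mulVec Z) (X.mulVec W)) := fun Z W => rfl
  have gen : ∀ Z : Fin 3 → ℂ, Z 2 ≠ 0 → X.mulVec Z 2 ≠ 0 → F (X.mulVec Z) (X.mulVec Z) 3 ≠ 0 →
      G Z Z 3 ≠ 0 → ∃ ρ : ℂ, G Z Z = ρ • L Z Z := by
    intro Z h1 h2 h3 h4
    obtain ⟨z, hz⟩ : ∃ z : Fin 2 → ℂ, Z = Z 2 • affLift z := ⟨_, eq_smul_affLift h1⟩
    generalize Z 2 = μ at h1 hz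
    subst hz
    simp only [map_smul, LinearMap.smul_apply, Matrix.mulVec_smul, Pi.smul_apply, smul_eq_mul,
      mul_ne_zero_iff] at h2 h3 h4
    have hzg : z ∈ g.dom := by
      have := h4.2.2
      rw [hg.val_last] at this
      exact this
    have h5 := eq_smul_affLift h2.2
    have e : linFrac X z = ![X.mulVec (affLift z) 0 / X.mulVec (affLift z) 2,
      X.mulVec (affLift z) 1 / X.mulVec (affLift z) 2] := by
      funext i; fin_cases i <;> rfl
    rw [← e] at h5
    have h6 := h3.2.2
    rw [h5] at h6
    simp only [map_smul, LinearMap.smul_apply, Pi.smul_apply, smul_eq_mul,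
      mul_ne_zero_iff] at h6
    have hzf : linFrac X z ∈ f.dom := by
      have := h6.2.2
      rw [hf.val_last] at this
      exact this
    have hzf' : MvPolynomial.eval (linFrac X z) f.den ≠ 0 := hzf
    obtain ⟨r, hr, hTr⟩ := h z h2.2 hzf hzg
    have h7 : affLift (g.eval z) = r • T⁻¹.mulVec (affLift (f.eval (linFrac X z))) := by
      rw [← Matrix.mulVec_smul, ← hTr, hTT']
    have h8 : L (affLift z) (affLift z) = (X.mulVec (affLift z) 2 * (X.mulVec (affLift z) 2 *
        MvPolynomial.eval (linFrac X z) f.den)) • T⁻¹.mulVec (affLift (f.eval (linFrac X z))) := by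
      rw [hLv, mul_smul, mul_smul, ← Matrix.mulVec_smul, ← Matrix.mulVec_smul,
        ← Matrix.mulVec_smul, ← hf.val_eq hzf]
      conv_lhs => rw [h5]
      simp only [map_smul, LinearMap.smul_apply]
    have hne : X.mulVec (affLift z) 2 * (X.mulVec (affLift z) 2 *
        MvPolynomial.eval (linFrac X z) f.den) ≠ 0 :=
      mul_ne_zero h2.2 (mul_ne_zero h2.2 hzf')
    generalize X.mulVec (affLift z) 2 * (X.mulVec (affLift z) 2 *
        MvPolynomial.eval (linFrac X z) f.den) = t at h8 hne
    refine ⟨MvPolynomial.eval z g.den * r * t⁻¹, ?_⟩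
    simp only [map_smul, LinearMap.smul_apply]
    rw [hg.val_eq hzg, h7, h8]
    simp only [smul_smul]
    congr 1
    field_simp
  have pG := IsPolyFun.bil G (Z := fun Z => Z) (W := fun Z => Z) .coord .coord
  have pF := IsPolyFun.bil F (isPolyFun_mulVec X) (isPolyFun_mulVec X)
  have pD := (((IsPolyFun.coord 2).mul (isPolyFun_mulVec X 2)).mul (pF 3)).mul (pG 3)
  obtain ⟨zf, hzf⟩ := hf.exists_ne
  obtain ⟨zg, hzg⟩ := hg.exists_ne
  have hsurj := Matrix.mulVec_surjective_iff_isUnit.2 hX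
  have hD : ¬ ∀ Z : Fin 3 → ℂ, Z 2 * X.mulVec Z 2 * F (X.mulVec Z) (X.mulVec Z) 3 * G Z Z 3 = 0 := by
    intro hc
    rcases (((IsPolyFun.coord 2).mul (isPolyFun_mulVec X 2)).mul (pF 3)).eq_zero_or (pG 3) hc
      with hc | hc
    · rcases ((IsPolyFun.coord 2).mul (isPolyFun_mulVec X 2)).eq_zero_or (pF 3) hc with hc | hc
      · rcases (IsPolyFun.coord 2).eq_zero_or (isPolyFun_mulVec X 2) hc with hc | hc
        · simpa using hc (E 2)
        · obtain ⟨Z, hZ⟩ := hsurj (E 2)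
          have := hc Z
          rw [hZ] at this
          simp at this
      · obtain ⟨Z, hZ⟩ := hsurj (affLift zf)
        have := hc Z
        rw [hZ] at this
        exact hzf this
    · exact hzg (hc _)
  have pL : ∀ (φ : (Fin 4 → ℂ) →ₗ[ℂ] ℂ) (B : Bil), IsPolyFun (fun Z => φ (B Z Z)) := by
    intro φ B
    have : ∀ y, φ y = ∑ i, y i * φ (Pi.single i 1) := fun y => by
      conv_lhs => rw [LinearMap.pi_apply_eq_sum_univ φ y]
      refine Finset.sum_congr rfl fun i _ => ?_
      rw [smul_eq_mul]
      congr 2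
      funext j; simp [Pi.single_apply, eq_comm]
    have e : (fun Z => φ (B Z Z)) = fun Z => ∑ i, B Z Z i * φ (Pi.single i 1) :=
      funext fun Z => this _
    rw [e]
    exact .sum _ fun i => (IsPolyFun.bil B .coord .coord i).mul (.const _)
  have hp : ∀ φ ψ : (Fin 4 → ℂ) →ₗ[ℂ] ℂ, ∀ Z, φ (L Z Z) * ψ (G Z Z) = φ (G Z Z) * ψ (L Z Z) := by
    intro φ ψ Z
    have p := ((pL φ L).mul (pL ψ G)).sub ((pL φ G).mul (pL ψ L))
    have := (pD.eq_zero_or p fun Z => ?_).resolve_left hD Z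
    · linear_combination this
    · by_contra hne
      simp only [mul_ne_zero_iff] at hne
      obtain ⟨ρ, hρ⟩ := gen Z hne.1.1.1.1 hne.1.1.1.2 hne.1.1.2 hne.1.2
      apply hne.2
      rw [hρ, map_smul, map_smul]
      simp only [smul_eq_mul]; ring
  obtain ⟨c, hc⟩ := normalBil_proportional k (L := L) (fun Z W => by
    rw [hLv, hLv, hf.symm]) hp
  refine ⟨c, ?_, fun Z => ?_⟩
  · rintro rfl
    push Not at hD
    obtain ⟨Z, hZ⟩ := hD
    simp only [mul_ne_zero_iff] at hZ
    obtain ⟨ρ, hρ⟩ := gen Z hZ.1.1.1 hZ.1.1.2 hZ.1.2 hZ.2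
    apply hZ.2
    rw [hρ, hc]; simp
  · have := hc Z
    rw [hLv] at this
    rw [← Matrix.mulVec_smul]
    change _ = T.mulVec (c • G Z Z)
    rw [← this, hTT]

theorem forms_of_qEquiv {f : RatMap 2 3} {F : Bil} (hf : Lift f F) {q : SesqForm 3}
    (hq : ∀ a b c d, GramRel F q a b c d) {k : Fin 4}
    (h : RatMap.QEquiv 2 0 2 1 f (RatMap.normalForm k)) :
    ∃ (X : Matrix (Fin 3) (Fin 3) ℂ) (c s : ℝ), Scales (sgn 2 3) X c ∧ s ≠ 0 ∧
      ∀ Z W, q (X.mulVec Z) (X.mulVec W) = s * normalHerm k Z W := by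
  obtain ⟨X, T, hX, hT, h⟩ := h
  obtain ⟨c, hc⟩ := hX.exists_scales (by norm_num)
  obtain ⟨c', hc'⟩ := hT.exists_scales (by norm_num)
  have hc1 : Scales (sgn 2 3) X c := hc
  have hc2 : Scales (sgn 2 4) T c' := hc'
  obtain ⟨ρ, hρ, hF⟩ := exists_scalar_of_qEquiv hf (X := X) (T := T) hX.1 hT.1 h
  have hc0 : (c : ℂ) ≠ 0 := by exact_mod_cast hc1.1
  have hprod : ∀ Z W, (q (X.mulVec Z) (X.mulVec W) - ((c' * ‖ρ‖ ^ 2 / c : ℝ) : ℂ) *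
      normalHerm k Z W) * J Z W = 0 := by
    intro Z W
    have h1 := hq (X.mulVec Z) (X.mulVec Z) (X.mulVec W) (X.mulVec W)
    have h2 := normalBil_gramRel k Z Z W W
    unfold GramRel at h1 h2
    rw [hF, hF] at h1
    simp only [map_smul, LinearMap.smul_apply, LinearMap.map_smulₛₗ, smul_eq_mul, hc1.2,
      hc2.2] at h1
    push_cast
    rw [← mul_conj']
    field_simp
    linear_combination -h1 / 4 + ρ * conj ρ * c' * h2 / 4
  refine ⟨X, c, c' * ‖ρ‖ ^ 2 / c, hc1, div_ne_zero (mul_ne_zero hc2.1 (by simpa using hρ)) hc1.1,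
    fun Z W => ?_⟩
  by_cases hW : W = 0
  · simp [hW]
  obtain ⟨u, hu⟩ : ∃ u, J u W ≠ 0 := by
    by_contra! hcon
    refine hW (J_nondeg fun u => ?_)
    rw [← diagForm_isHerm (sgn 2 3) u W, hcon, map_zero]
  have off : ∀ Z, J Z W ≠ 0 → q (X.mulVec Z) (X.mulVec W) - ((c' * ‖ρ‖ ^ 2 / c : ℝ) : ℂ) *
      normalHerm k Z W = 0 := fun Z hZ => (mul_eq_zero.1 (hprod Z W)).resolve_right hZ
  by_cases hZ : J Z W = 0
  · have h1 := off u hu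
    have h2 := off (Z + u) (by rw [map_add, LinearMap.add_apply, hZ, zero_add]; exact hu)
    simp only [Matrix.mulVec_add, map_add, LinearMap.add_apply] at h2
    linear_combination h2 - h1
  · linear_combination off Z hZ

/-- Traces of the operator representing a form and of its square. -/
theorem trace_of_equiv {q r : SesqForm 3} {X : Matrix (Fin 3) (Fin 3) ℂ} {c s : ℝ}
    (hX : Scales (sgn 2 3) X c) (h : ∀ Z W, q (X.mulVec Z) (X.mulVec W) = s * r Z W) :
    LinearMap.trace ℂ _ (repOp q) = ((s / c : ℝ) : ℂ) * LinearMap.trace ℂ _ (repOp r) ∧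
    LinearMap.trace ℂ _ (repOp q * repOp q) =
      ((s / c : ℝ) : ℂ) ^ 2 * LinearMap.trace ℂ _ (repOp r * repOp r) := by
  have hu := hX.isUnit (sgn_cases 2 3)
  have hsurj := Matrix.mulVec_surjective_iff_isUnit.2 hu
  have hc0 : (c : ℂ) ≠ 0 := by exact_mod_cast hX.1
  have hdet := (Matrix.isUnit_iff_isUnit_det X).1 hu
  let e : (Fin 3 → ℂ) ≃ₗ[ℂ] (Fin 3 → ℂ) := Matrix.toLinearEquiv' X (Matrix.invertibleOfIsUnitDet X hdet)
  have he : ∀ Z, e Z = X.mulVec Z := fun Z => rfl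
  have hconj : repOp q = ((s / c : ℝ) : ℂ) • e.conj (repOp r) := by
    refine LinearMap.ext fun y => ?_
    obtain ⟨Z, rfl⟩ := e.surjective y
    rw [← sub_eq_zero]
    refine J_nondeg fun W => ?_
    obtain ⟨W, rfl⟩ := e.surjective W
    rw [map_sub, LinearMap.sub_apply, J_repOp, LinearMap.smul_apply, LinearEquiv.conj_apply_apply,
      e.symm_apply_apply, map_smul, LinearMap.smul_apply, he, he, he, h]
    change _ - _ • diagForm (sgn 2 3) _ _ = _
    rw [hX.2]
    change _ - _ • (_ * J _ _) = _
    rw [J_repOp]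
    push_cast
    rw [smul_eq_mul]
    field_simp
    ring
  have hmul : e.conj (repOp r) * e.conj (repOp r) = e.conj (repOp r * repOp r) :=
    (LinearEquiv.conj_comp e _ _).symm
  constructor
  · rw [hconj, map_smul, LinearMap.trace_conj', smul_eq_mul]
  · rw [hconj, smul_mul_smul_comm, hmul, map_smul, LinearMap.trace_conj', smul_eq_mul, sq]

theorem trace_repOp (r : SesqForm 3) : LinearMap.trace ℂ _ (repOp r) =
    r (E 0) (E 0) + r (E 1) (E 1) - r (E 2) (E 2) := by
  rw [LinearMap.trace_eq_matrix_trace ℂ (Pi.basisFun ℂ (Fin 3))]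
  simp [Matrix.trace, Fin.sum_univ_three, LinearMap.toMatrix_apply, repOp, s3, sgn]
  ring

theorem trace_repOp_sq (r : SesqForm 3) : LinearMap.trace ℂ _ (repOp r * repOp r) =
    r (E 0) (E 0) ^ 2 + r (E 1) (E 1) ^ 2 + r (E 2) (E 2) ^ 2 +
    2 * (r (E 0) (E 1) * r (E 1) (E 0) - r (E 0) (E 2) * r (E 2) (E 0) -
      r (E 1) (E 2) * r (E 2) (E 1)) := by
  rw [LinearMap.trace_eq_matrix_trace ℂ (Pi.basisFun ℂ (Fin 3)), LinearMap.toMatrix_mul]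
  simp [Matrix.trace, Matrix.mul_apply, Fin.sum_univ_three, LinearMap.toMatrix_apply, repOp, s3, sgn]
  ring

theorem trace_normalHerm (k : Fin 4) : LinearMap.trace ℂ _ (repOp (normalHerm k)) =
    ((![-1, 0, 0, 0] : Fin 4 → ℝ) k : ℂ) := by
  rw [trace_repOp]
  fin_cases k <;> simp [normalHerm_zero, normalHerm_one, normalHerm_two, normalHerm_three]

theorem trace_sq_normalHerm (k : Fin 4) :
    LinearMap.trace ℂ _ (repOp (normalHerm k) * repOp (normalHerm k)) =
      ((![3, 2, 0, -16] : Fin 4 → ℝ) k : ℂ) := by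
  rw [trace_repOp_sq]
  fin_cases k <;> simp [normalHerm_zero, normalHerm_one, normalHerm_two, normalHerm_three]
  · norm_num
  · norm_num
  · linear_combination (-8 * I * I) * sqrt_two_sq * (-1) + 16 * I_mul_I

theorem normalForm_unique {f : RatMap 2 3} {F : Bil} (hf : Lift f F) {q : SesqForm 3}
    (hq : ∀ a b c d, GramRel F q a b c d) {k k' : Fin 4}
    (h : RatMap.QEquiv 2 0 2 1 f (RatMap.normalForm k))
    (h' : RatMap.QEquiv 2 0 2 1 f (RatMap.normalForm k')) : k = k' := by
  obtain ⟨X, c, s, hX, hs, hXq⟩ := forms_of_qEquiv hf hq h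
  obtain ⟨X', c', s', hX', hs', hXq'⟩ := forms_of_qEquiv hf hq h'
  obtain ⟨t1, t2⟩ := trace_of_equiv hX hXq
  obtain ⟨t1', t2'⟩ := trace_of_equiv hX' hXq'
  rw [trace_normalHerm] at t1 t1'
  rw [trace_sq_normalHerm] at t2 t2'
  have e1 := t1.symm.trans t1'
  have e2 := t2.symm.trans t2'
  have ht : s / c ≠ 0 := div_ne_zero hs hX.1
  have ht' : s' / c' ≠ 0 := div_ne_zero hs' hX'.1
  generalize s / c = t at *
  generalize s' / c' = t' at *
  norm_cast at e1 e2
  have hp : 0 < t ^ 2 := by positivity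
  have hp' : 0 < t' ^ 2 := by positivity
  fin_cases k <;> fin_cases k' <;> simp at e1 e2 ⊢ <;> first
    | exact ht e1
    | exact ht' e1
    | exact absurd e2 ht
    | exact absurd e2 ht'
    | nlinarith

end HQ

theorem lemma6p1 (f : RatMap 2 3) (hred : f.InLowestTerms) (hdeg : f.degree = 2)
    (hCR : RatMap.IsCRMap 2 0 2 1 f)
    (hflat : ¬ ∃ (p q : MvPolynomial (Fin 2) ℂ) (hq : q ≠ 0),
      RatMap.QEquiv 2 0 2 1 f (RatMap.oneGG p q hq)) :
    ∃! k : Fin 4, RatMap.QEquiv 2 0 2 1 f (RatMap.normalForm k) := by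
  obtain ⟨F, hF⟩ := HQ.exists_lift hdeg.le
  have hN : ∀ Z W, HQ.J Z W = 0 → HQ.K (F Z Z) (F W W) = 0 := fun Z W h =>
    HQ.K_eq_zero_of_J hF hCR h
  have hG := HQ.gramRel_quotForm hF.symm hN
  have hq := HQ.quotForm_isHerm hF.symm hN
  rcases HQ.classified hq hG with h0 | ⟨l, s, hl, hs, h1⟩ | ⟨k, X, s, hs, hJ, hX⟩
  · refine absurd (HQ.qEquiv_oneGG_of_isotropic hF fun Z W => ?_) hflat
    rw [(hG Z Z W W).eq, h0]
    simp
  · exact (HQ.not_vanish_on_plane hred hdeg hF hl fun Z hZ =>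
      HQ.bil_eq_zero_of_rank_one hG hl hs h1 hZ).elim
  · exact ⟨k, HQ.qEquiv_normalForm hF hG hs hJ hX, fun k' hk' =>
      HQ.normalForm_unique hF hG hk' (HQ.qEquiv_normalForm hF hG hs hJ hX)⟩
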